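/- **Setting.** Let $\Sigma$ be a finite set of function symbols of arity $\ge 1$, $\Sigma_A\subseteq\Sigma$ its set of associative symbols, and $C_0$ a finite set of constants with a total precedence. Symbols in $\Sigma_A$ are variadic with admissible arities $2,3,\dots$; the others have a fixed arity. $T(\Sigma,K)$ is the set of ground terms over $\Sigma$ and a set of constants $K$. Equations $s\approx t$ are unordered pairs of terms. $A$ is the set of axioms $f(x_1,\dots,x_m,f(y_1,\dots,y_i),z_1,\dots,z_n)\approx f(x_1,\dots,x_m,y_1,\dots,y_i,z_1,\dots,z_n)$ with $f\in\Sigma_A$, all arities admissible. A term is flattened associatively by applying these axioms from left to right as long as possible; $s\approx_A t$ means that $s$ and $t$ are equal modulo $A$, equivalently, that their flattened forms coincide. Let $E$ be a finite set of equations between terms of $T(\Sigma,C_0)$. $CC^A(E)$ is the smallest relation on $T(\Sigma,C_0)$ that contains $E$ and all ground instances of $A$ and is closed under reflexivity, symmetry, transitivity and congruence. We write $s\approx_E^A t$ if $s$ and $t$ have the same value in all models of $E\cup A$. **Flattening.** Let $W=\{c_1,c_2,\dots\}$ be an infinite set of new constants. For a string $u=u_1\cdots u_n$ of constants write $f(u)$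 for $f(u_1,\dots,u_n)$, and let $\bar f(u)$ be $f(u)$ if $|u|\ge2$ and $u$ if $|u|=1$. An equation is flat if it has one of the forms $c\approx d$ (constant), $g(u)\approx c$ ($D$-flat, $g\in\Sigma$), $f(u)\approx f(v)$ ($A$-flat, $f\in\Sigma_A$), with $c,d$ constants and $u,v$ strings of constants. $S(E)$ is any set of flat equations that is obtained from $E$ by flattening all terms associatively and then, finitely often, replacing in an equation that is not $A$-flat one occurrence of a term $t=g(u)$ by a constant $c\in W$, where either $c$ does not occur yet and $t\approx c$ is added, or $t\approx c$ is already present as another equation. **Completion.** Order constants by: the precedence on $C_0$; $c\succ c'$ for $c\in W$, $c'\in C_0$; $c_i\succ c_j$ for $i<j$. Moreover $t\succ c$ if $t$ is headed by a function symbol and $c$ is a constant, and $f(u)\succ f(v)$ if $f\in\Sigma_A$ and $u$ is greater than $v$ in the length-lexicographic ordering. The inference rules are as follows; in the first two, $f\in\Sigma_A$, and for $t=\bar f(v)$, $s=\bar f(w)$ the strings $u_1t$, $su_3$, $u_1tu_3$ stand for $u_1v$, $wu_3$, $u_1vu_3$. * DEDUCE: if $f(u_1u_2)\approx s$ and $f(u_2u_3)\approx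 t$ are present, $f(u_1u_2)\succ s$, $f(u_2u_3)\succ t$ and $u_1,u_2,u_3$ are nonempty, add $f(u_1t)\approx f(su_3)$. * SIMPLIFY: if $f(u_1u_2u_3)\approx s$ and $f(u_2)\approx t$ are present, $f(u_2)\succ t$, and $s\succ t$ in case $|u_1u_3|=0$, replace $f(u_1u_2u_3)\approx s$ by $\bar f(u_1tu_3)\approx s$. * COLLAPSE: if $s[u]\approx t$ and $u\approx d$ are present, $s[u]\succ t$, $u\succ d$, $d$ is a constant, $u$ is not headed by a symbol of $\Sigma_A$, and $t\succ d$ in case $s[u]=u$, replace $s[u]\approx t$ by $s[d]\approx t$. * COMPOSE: if $t\approx c$ and $c\approx d$ are present with $c,d$ constants and $t\succ c\succ d$, replace $t\approx c$ by $t\approx d$. * DELETE: remove an equation $s\approx s$. A derivation is a finite or infinite sequence $S_0\vdash S_1\vdash\cdots$ in which each set arises from the previous one by an instance of a rule (a finite one is continued by repeating its last set). It is fair if every rule instance that is enabled (its premises are present and applying it changes the set) at all stages from some stage on is applied at some stage. Put $S_\infty(E)=\bigcup_i\bigcap_{j\ge i}S_j$ for a fair derivation with $S_0=S(E)$, and let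 $S_\infty^\succ(E)$ be the set of rules $l\to r$ with $l\approx r\in S_\infty(E)$ and $l\succ r$. For a set $R$ of rules, $p\to_{R/A}q$ means that $p\approx_A s\to_R t\approx_A q$ for some terms $s,t$. **Statement.** For every choice of $S(E)$ and of the fair derivation: 1. For all $s_0,t_0\in T(\Sigma,C_0)$: $s_0\approx t_0\in CC^A(E)$ if and only if $s_0$ and $t_0$ have the same normal form with respect to $S_\infty^\succ(E)/A$, that is, both have a normal form and every normal form of $s_0$ equals every normal form of $t_0$ modulo $A$. 2. If $S_\infty(E)$ is finite, then the word problem for $E$ modulo $A$ is decidable: there is an algorithm that decides for $s_0,t_0\in T(\Sigma,C_0)$, given as words, whether $s_0\approx_E^A t_0$. -/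

import Mathlib

/-- A finite signature is a type `Op` of function symbols (constants are kept apart) together with
the set of its associative symbols and the arity of the other symbols. -/
structure Signature (Op : Type) where
  assoc : Set Op
  arity : Op → ℕ
  arity_pos : ∀ g, 0 < arity g

/-- `F.ArityOK g n`: the symbol `g` may take `n` arguments.  Associative symbols are variadic,
with admissible arities 2, 3, 4, …; all other symbols have their fixed arity. -/
def Signature.ArityOK {Op : Type} (F : Signature Op) (g : Op) (n : ℕ) : Prop :=
  (g ∈ F.assoc ∧ 2 ≤ n) ∨ (g ∉ F.assoc ∧ n = F.arity g)

/-- Raw ground terms over function symbols `Op` and constants `K`. -/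
inductive Term (Op K : Type) : Type
  | const : K → Term Op K
  | app : Op → List (Term Op K) → Term Op K

/-- The ground terms proper: those in which every symbol has an admissible number of arguments.
`{t : Term Op K | F.WF t}` is the set `T(F, K)`. -/
inductive Signature.WF {Op K : Type} (F : Signature Op) : Term Op K → Prop
  | const (c : K) : F.WF (Term.const c)
  | app (g : Op) (ts : List (Term Op K)) (har : F.ArityOK g ts.length)
      (hts : ∀ t ∈ ts, F.WF t) : F.WF (Term.app g ts)

/-- An equation is an unordered pair of terms; `s(p, q)` stands for `p ≈ q`. -/
abbrev Eqn (Op K : Type) : Type := Sym2 (Term Op K)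

namespace Term

mutual
/-- Renaming of constants. -/
def map {Op K K' : Type} (h : K → K') : Term Op K → Term Op K'
  | const c => const (h c)
  | app g ts => app g (mapArgs h ts)
/-- Renaming of constants in a list of terms. -/
def mapArgs {Op K K' : Type} (h : K → K') : List (Term Op K) → List (Term Op K')
  | [] => []
  | t :: ts => map h t :: mapArgs h ts
end

open Classical in
/-- The list of arguments that the (already flattened) term `t` contributes below the symbol `g`:
if `g` is associative and `t = g(u₁, …, uᵢ)` these are `u₁, …, uᵢ`, otherwise it is `t` alone. -/
noncomputable def splice {Op K : Type} (F : Signature Op) (g : Op) :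
    Term Op K → List (Term Op K)
  | const c => [const c]
  | app g' us => if g' = g ∧ g ∈ F.assoc then us else [app g' us]

mutual
/-- Associative flattening of a term: its normal form for the rules
`f(x⃗, f(y⃗), z⃗) → f(x⃗, y⃗, z⃗)`, `f` associative. -/
noncomputable def flatten {Op K : Type} (F : Signature Op) : Term Op K → Term Op K
  | const c => const c
  | app g ts => app g (flattenArgs F g ts)
/-- The flattened argument list below the symbol `g`. -/
noncomputable def flattenArgs {Op K : Type} (F : Signature Op) (g : Op) :
    List (Term Op K) → List (Term Op K)
  | [] => []
  | t :: ts => splice F g (flatten F t) ++ flattenArgs F g ts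
end

/-- `HasConst c t`: the constant `c` occurs in `t`. -/
inductive HasConst {Op K : Type} (c : K) : Term Op K → Prop
  | here : HasConst c (const c)
  | arg (g : Op) (ts : List (Term Op K)) (t : Term Op K) (ht : t ∈ ts) (h : HasConst c t) :
      HasConst c (app g ts)

/-- `Replace u v s s'`: `s = s[u]` and `s' = s[v]`, that is, `s'` arises from `s` by replacing one
occurrence of the subterm `u` by `v` (the occurrence may be `s` itself). -/
inductive Replace {Op K : Type} (u v : Term Op K) : Term Op K → Term Op K → Prop
  | top : Replace u v u v
  | arg (g : Op) (xs ys : List (Term Op K)) (a b : Term Op K) (h : Replace u v a b) :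
      Replace u v (app g (xs ++ a :: ys)) (app g (xs ++ b :: ys))

/-- The term `f(w) = f(w₁, …, wₙ)` for a string `w` of constants. -/
def ofString {Op K : Type} (f : Op) (w : List K) : Term Op K := app f (w.map const)

/-- The term `f̄(w)`: the constant `c` if `w` is the one-letter string `c`, and `f(w)` otherwise. -/
def ofStringBar {Op K : Type} (f : Op) : List K → Term Op K
  | [c] => const c
  | w => ofString f w

mutual
/-- A term written as a word: `g(t₁, …, tₙ)` is the symbol `g`, followed by the words of
`t₁, …, tₙ`, followed by a closing bracket, the letter `Sum.inr (Sum.inr ())`. -/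
def word {Op K : Type} : Term Op K → List (Op ⊕ K ⊕ Unit)
  | const c => [Sum.inr (Sum.inl c)]
  | app g ts => Sum.inl g :: (wordArgs ts ++ [Sum.inr (Sum.inr ())])
/-- The concatenation of the words of a list of terms. -/
def wordArgs {Op K : Type} : List (Term Op K) → List (Op ⊕ K ⊕ Unit)
  | [] => []
  | t :: ts => word t ++ wordArgs ts
end

end Term

/-! ### Congruence closure modulo associativity, and semantic consequence -/

/-- `CC F E` is `CC^A(E)`: the smallest relation on the ground terms that contains `E`, contains
all ground instances of the associativity axioms
`f(x₁,…,xₘ, f(y₁,…,yᵢ), z₁,…,zₙ) ≈ f(x₁,…,xₘ, y₁,…,yᵢ, z₁,…,zₙ)`, `f` associative, and is closed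
under reflexivity, symmetry, transitivity and congruence. -/
inductive CC {Op K : Type} (F : Signature Op) (E : Set (Eqn Op K)) :
    Term Op K → Term Op K → Prop
  | base (s t : Term Op K) (h : s(s, t) ∈ E) : CC F E s t
  | assoc (f : Op) (xs ys zs : List (Term Op K)) (hf : f ∈ F.assoc)
      (hl : F.WF (Term.app f (xs ++ Term.app f ys :: zs))) :
      CC F E (Term.app f (xs ++ Term.app f ys :: zs)) (Term.app f (xs ++ ys ++ zs))
  | refl (s : Term Op K) (h : F.WF s) : CC F E s s
  | symm (s t : Term Op K) (h : CC F E s t) : CC F E t s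
  | trans (s t u : Term Op K) (h₁ : CC F E s t) (h₂ : CC F E t u) : CC F E s u
  | congr (g : Op) (ss ts : List (Term Op K)) (har : F.ArityOK g ss.length)
      (hlen : ss.length = ts.length)
      (h : ∀ (i : ℕ) (hi : i < ss.length), CC F E ss[i] (ts[i]'(hlen ▸ hi))) :
      CC F E (Term.app g ss) (Term.app g ts)

/-- Equality of ground terms modulo associativity. -/
def EqA {Op K : Type} (F : Signature Op) (s t : Term Op K) : Prop := CC F ∅ s t

/-- An algebra: a carrier with an interpretation of the constants and of the function symbols.
(The value of `op g` matters only on lists of an admissible length.) -/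
structure Alg (Op K : Type) where
  carrier : Type
  cst : K → carrier
  op : Op → List carrier → carrier

mutual
/-- The value of a ground term in an algebra. -/
def Alg.eval {Op K : Type} (M : Alg Op K) : Term Op K → M.carrier
  | Term.const c => M.cst c
  | Term.app g ts => M.op g (Alg.evalArgs M ts)
/-- The values of a list of ground terms. -/
def Alg.evalArgs {Op K : Type} (M : Alg Op K) : List (Term Op K) → List M.carrier
  | [] => []
  | t :: ts => Alg.eval M t :: Alg.evalArgs M ts
end

/-- `M` satisfies the associativity axioms of all associative symbols. -/
def Alg.ModelsA {Op K : Type} (F : Signature Op) (M : Alg Op K) : Prop :=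
  ∀ f ∈ F.assoc, ∀ xs ys zs : List M.carrier,
    2 ≤ ys.length → 2 ≤ xs.length + zs.length + 1 →
      M.op f (xs ++ M.op f ys :: zs) = M.op f (xs ++ ys ++ zs)

/-- `Follows F E s t` is `s ≈_E^A t`: `s` and `t` have the same value in every model of `E ∪ A`. -/
def Follows {Op K : Type} (F : Signature Op) (E : Set (Eqn Op K)) (s t : Term Op K) : Prop :=
  ∀ M : Alg Op K, M.ModelsA F → (∀ p q : Term Op K, s(p, q) ∈ E → M.eval p = M.eval q) →
    M.eval s = M.eval t

/-- A relation on ground terms is decidable if some computable predicate on pairs of words agrees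
with it on the words of ground terms. -/
def DecidableOnTerms {Op K : Type} [Primcodable Op] [Primcodable K] (F : Signature Op)
    (R : Term Op K → Term Op K → Prop) : Prop :=
  ∃ P : List (Op ⊕ K ⊕ Unit) × List (Op ⊕ K ⊕ Unit) → Prop, ComputablePred P ∧
    ∀ s t : Term Op K, F.WF s → F.WF t → (P (s.word, t.word) ↔ R s t)

/-! ### Flattening with new constants -/

/-- The constants available: the original ones, `C₀`, and new ones `c₀, c₁, c₂, …`.  The order is
the precedence: an original constant is smaller than every new one, and `cⱼ < cᵢ` if `i < j`. -/
abbrev Const (C₀ : Type) : Type := C₀ ⊕ₗ ℕᵒᵈ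

/-- The new constant `cᵢ`. -/
def newConst {C₀ : Type} (i : ℕ) : Const C₀ := Sum.inrₗ (OrderDual.toDual i)

/-- A term over the original constants, read as a term over all constants. -/
def lift {Op C₀ : Type} (t : Term Op C₀) : Term Op (Const C₀) := t.map Sum.inlₗ

/-- Equations between two constants. -/
def ConstEqn {Op K : Type} (e : Eqn Op K) : Prop :=
  ∃ c d : K, e = s(Term.const c, Term.const d)

/-- `D`-flat equations `g(c₁, …, cₙ) ≈ c`. -/
def DFlatEqn {Op K : Type} (e : Eqn Op K) : Prop :=
  ∃ (g : Op) (u : List K) (c : K), e = s(Term.ofString g u, Term.const c)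

/-- `A`-flat equations `f(c₁, …, cₘ) ≈ f(d₁, …, dₙ)`, `f` associative. -/
def AFlatEqn {Op K : Type} (F : Signature Op) (e : Eqn Op K) : Prop :=
  ∃ f ∈ F.assoc, ∃ u v : List K, e = s(Term.ofString f u, Term.ofString f v)

/-- One step of flattening a set of equations.  In an equation that is not `A`-flat, one occurrence
of a flat term `t = g(c₁, …, cₙ)` is replaced by a new constant `c`: either by one that does not
occur yet, in which case `t ≈ c` is added, or by one for which `t ≈ c` is already present as
another equation. -/
inductive FlattenStep {Op C₀ : Type} (F : Signature Op) :
    Set (Eqn Op (Const C₀)) → Set (Eqn Op (Const C₀)) → Prop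
  | name (S : Set (Eqn Op (Const C₀))) (p p' q : Term Op (Const C₀)) (g : Op)
      (u : List (Const C₀)) (i : ℕ) (he : s(p, q) ∈ S) (hA : ¬ AFlatEqn F s(p, q))
      (hfresh : ∀ e ∈ S, ∀ t ∈ e, ¬ Term.HasConst (newConst i) t)
      (hp : Term.Replace (Term.ofString g u) (Term.const (newConst i)) p p') :
      FlattenStep F S
        ((S \ {s(p, q)}) ∪ {s(p', q), s(Term.ofString g u, Term.const (newConst i))})
  | reuse (S : Set (Eqn Op (Const C₀))) (p p' q : Term Op (Const C₀)) (g : Op)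
      (u : List (Const C₀)) (i : ℕ) (he : s(p, q) ∈ S) (hA : ¬ AFlatEqn F s(p, q))
      (hmem : s(Term.ofString g u, Term.const (newConst i)) ∈ S)
      (hne : s(p, q) ≠ s(Term.ofString g u, Term.const (newConst i)))
      (hp : Term.Replace (Term.ofString g u) (Term.const (newConst i)) p p') :
      FlattenStep F S ((S \ {s(p, q)}) ∪ {s(p', q)})

/-- `FlatteningOf F E S`: the set `S` is a possible value of `S(E)`.  The terms of `E` are first
flattened associatively; then flattening steps are made until only constant, `D`-flat and
`A`-flat equations are left. -/
def FlatteningOf {Op C₀ : Type} (F : Signature Op) (E : Set (Eqn Op C₀))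
    (S : Set (Eqn Op (Const C₀))) : Prop :=
  Relation.ReflTransGen (FlattenStep F)
    (Sym2.map (fun t : Term Op C₀ => (lift t).flatten F) '' E) S ∧
  ∀ e ∈ S, ConstEqn e ∨ DFlatEqn e ∨ AFlatEqn F e

/-! ### Ground completion -/

/-- The ordering `s ≻ t` on flat ground terms: constants are compared by precedence, a term headed
by a function symbol is greater than every constant, and for an associative `f` the terms `f(u)`,
`f(v)` are compared by the length-lexicographic ordering of the strings `u`, `v`. -/
inductive TermGT {Op K : Type} [LinearOrder K] (F : Signature Op) :
    Term Op K → Term Op K → Prop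
  | const (c d : K) (h : d < c) : TermGT F (Term.const c) (Term.const d)
  | app (g : Op) (ts : List (Term Op K)) (c : K) : TermGT F (Term.app g ts) (Term.const c)
  | string (f : Op) (u v : List K) (hf : f ∈ F.assoc) (hu : 2 ≤ u.length) (hv : 2 ≤ v.length)
      (h : v.length < u.length ∨ (v.length = u.length ∧ List.Lex (· < ·) v u)) :
      TermGT F (Term.ofString f u) (Term.ofString f v)

/-- The instances of the inference rules.  `Inference F P D N` means that some rule has an instance
with set of premises `P` that deletes the equations in `D` and adds those in `N`.
A nonempty string `v` stands for the flat term `f̄(v)`, which is a constant or of the form `f(v)`,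
so that `f(u₁t)` with `t = f̄(v)` is `f(u₁v)`. -/
inductive Inference {Op K : Type} [LinearOrder K] (F : Signature Op) :
    Set (Eqn Op K) → Set (Eqn Op K) → Set (Eqn Op K) → Prop
  | deduce (f : Op) (u₁ u₂ u₃ v w : List K) (hf : f ∈ F.assoc)
      (h₁ : u₁ ≠ []) (h₂ : u₂ ≠ []) (h₃ : u₃ ≠ []) (hv : v ≠ []) (hw : w ≠ [])
      (hgt₁ : TermGT F (Term.ofString f (u₁ ++ u₂)) (Term.ofStringBar f w))
      (hgt₂ : TermGT F (Term.ofString f (u₂ ++ u₃)) (Term.ofStringBar f v)) :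
      Inference F
        {s(Term.ofString f (u₁ ++ u₂), Term.ofStringBar f w),
          s(Term.ofString f (u₂ ++ u₃), Term.ofStringBar f v)}
        ∅
        {s(Term.ofString f (u₁ ++ v), Term.ofString f (w ++ u₃))}
  | simplify (f : Op) (u₁ u₂ u₃ v : List K) (s : Term Op K) (hf : f ∈ F.assoc)
      (h₂ : 2 ≤ u₂.length) (hv : v ≠ [])
      (hgt : TermGT F (Term.ofString f u₂) (Term.ofStringBar f v))
      (htop : u₁ ++ u₃ = [] → TermGT F s (Term.ofStringBar f v)) :
      Inference F
        {s(Term.ofString f (u₁ ++ u₂ ++ u₃), s), s(Term.ofString f u₂, Term.ofStringBar f v)}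
        {s(Term.ofString f (u₁ ++ u₂ ++ u₃), s)}
        {s(Term.ofStringBar f (u₁ ++ v ++ u₃), s)}
  | collapse (s s' t u : Term Op K) (d : K) (hs : Term.Replace u (Term.const d) s s')
      (hgt₁ : TermGT F s t) (hgt₂ : TermGT F u (Term.const d))
      (hu : ∀ f ∈ F.assoc, ∀ ts : List (Term Op K), u ≠ Term.app f ts)
      (htop : s = u → TermGT F t (Term.const d)) :
      Inference F {s(s, t), s(u, Term.const d)} {s(s, t)} {s(s', t)}
  | compose (t : Term Op K) (c d : K) (hgt₁ : TermGT F t (Term.const c))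
      (hgt₂ : TermGT F (Term.const c : Term Op K) (Term.const d)) :
      Inference F {s(t, Term.const c), s(Term.const c, Term.const d)} {s(t, Term.const c)}
        {s(t, Term.const d)}
  | delete (s : Term Op K) : Inference F {s(s, s)} {s(s, s)} ∅

/-- A derivation `S 0 ⊢ S 1 ⊢ S 2 ⊢ ⋯`.  Steps that do nothing are allowed, so that finite
derivations are included (the last set being repeated forever). -/
def IsDerivation {Op K : Type} [LinearOrder K] (F : Signature Op)
    (S : ℕ → Set (Eqn Op K)) : Prop :=
  ∀ i, S (i + 1) = S i ∨
    ∃ P D N : Set (Eqn Op K), Inference F P D N ∧ P ⊆ S i ∧ S (i + 1) = (S i \ D) ∪ N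

/-- A derivation is fair if every instance of a rule that is enabled at all stages from some stage
on (its premises are present and its application has an effect) is applied at some stage. -/
def IsFair {Op K : Type} [LinearOrder K] (F : Signature Op) (S : ℕ → Set (Eqn Op K)) : Prop :=
  ∀ P D N : Set (Eqn Op K), Inference F P D N →
    (∃ i, ∀ j ≥ i, P ⊆ S j ∧ (S j \ D) ∪ N ≠ S j) →
    ∃ j, P ⊆ S j ∧ S (j + 1) = (S j \ D) ∪ N

/-- The set `⋃ᵢ ⋂_{j ≥ i} S j` of persisting equations. -/
def persisting {Op K : Type} (S : ℕ → Set (Eqn Op K)) : Set (Eqn Op K) :=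
  {e | ∃ i, ∀ j ≥ i, e ∈ S j}

/-- The rewrite system that consists of the rules `l → r` with `l ≈ r` in `S` and `l ≻ r`. -/
def orient {Op K : Type} [LinearOrder K] (F : Signature Op) (S : Set (Eqn Op K)) :
    Set (Term Op K × Term Op K) :=
  {ρ | s(ρ.1, ρ.2) ∈ S ∧ TermGT F ρ.1 ρ.2}

/-! ### Rewriting modulo associativity -/

/-- The rewrite relation `R/A` of a ground rewrite system `R`: `p →_{R/A} q` if there are `s`, `t`
with `p ≈_A s →_R t ≈_A q`. -/
def RewriteModA {Op K : Type} (F : Signature Op) (R : Set (Term Op K × Term Op K))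
    (p q : Term Op K) : Prop :=
  ∃ s t : Term Op K, EqA F p s ∧ (∃ ρ ∈ R, Term.Replace ρ.1 ρ.2 s t) ∧ EqA F t q

/-- `q` is a normal form of `p` with respect to `R/A`. -/
def IsNormalFormOf {Op K : Type} (F : Signature Op) (R : Set (Term Op K × Term Op K))
    (p q : Term Op K) : Prop :=
  Relation.ReflTransGen (RewriteModA F R) p q ∧ ∀ r : Term Op K, ¬ RewriteModA F R q r

/-- `p` and `q` have the same `R/A`-normal form: both have a normal form, and each normal form
of `p` equals each normal form of `q` modulo associativity. -/
def SameNormalForm {Op K : Type} (F : Signature Op) (R : Set (Term Op K × Term Op K))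
    (p q : Term Op K) : Prop :=
  (∃ p', IsNormalFormOf F R p p') ∧ (∃ q', IsNormalFormOf F R q q') ∧
    ∀ p' q', IsNormalFormOf F R p p' → IsNormalFormOf F R q q' → EqA F p' q'

/-!
A term modulo associativity is a word in which every constant and every opening symbol is tagged
with the symbol above it and nested associative symbols are merged.  Two well-formed terms are equal
modulo `A` if and only if their words agree, and rewriting modulo `A` with flat rules becomes string
rewriting.

A word is weighed by reading it as a numeral, which refines the length-lexicographic ordering and is
monotone in contexts.  Each completion step that removes an equation leaves a proof of it from
smaller or equal instances, so that whatever is provable at some stage by steps below a bound is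
provable below the same bound from the persisting rules.  By fairness the critical overlaps of
persisting rules have been deduced at some stage, so every peak of the persisting string rewriting
system is linked below its top and the system is convergent.  Its convertibility is therefore
equality of normal forms, and, the weight being at most exponential in the length, normal forms of a
finite system are computed by a primitive recursive function.

The constants introduced by flattening name terms over the original constants, so every model of `E`
extends to a model of the flattened equations; this gives soundness.
-/

/-! ### Ground terms and congruence closure -/

section Terms

variable {Op K : Type} {F : Signature Op}

theorem Term.induction {P : Term Op K → Prop} (const : ∀ c, P (Term.const c))
    (app : ∀ g ts, (∀ t ∈ ts, P t) → P (Term.app g ts)) (t : Term Op K) : P t :=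
  Term.rec (motive_1 := P) (motive_2 := fun ts => ∀ t ∈ ts, P t) const app
    (List.forall_mem_nil P) (fun _ _ h hs => List.forall_mem_cons.2 ⟨h, hs⟩) t

theorem Signature.wf_app_iff {g : Op} {ts : List (Term Op K)} :
    F.WF (Term.app g ts) ↔ F.ArityOK g ts.length ∧ ∀ t ∈ ts, F.WF t :=
  ⟨fun | .app _ _ har hts => ⟨har, hts⟩, fun ⟨har, hts⟩ => .app _ _ har hts⟩

theorem Signature.arityOK_iff_two_le {f : Op} (hf : f ∈ F.assoc) {n : ℕ} :
    F.ArityOK f n ↔ 2 ≤ n := by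
  simp [Signature.ArityOK, hf]

theorem Term.flattenArgs_eq_flatMap (g : Op) (ts : List (Term Op K)) :
    Term.flattenArgs F g ts = ts.flatMap fun t => Term.splice F g (Term.flatten F t) := by
  induction ts with
  | nil => rfl
  | cons t ts ih => simp [Term.flattenArgs, ih]

theorem Term.mapArgs_eq_map {K' : Type} (h : K → K') (ts : List (Term Op K)) :
    Term.mapArgs h ts = ts.map (Term.map h) := by
  induction ts with
  | nil => rfl
  | cons t ts ih => simp [Term.mapArgs, ih]

theorem Term.wordArgs_eq_flatMap (ts : List (Term Op K)) :
    Term.wordArgs ts = ts.flatMap Term.word := by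
  induction ts with
  | nil => rfl
  | cons t ts ih => simp [Term.wordArgs, ih]

theorem Alg.eval_app (M : Alg Op K) (g : Op) (ts : List (Term Op K)) :
    M.eval (Term.app g ts) = M.op g (ts.map M.eval) := by
  have evalArgs_eq_map : Alg.evalArgs M ts = ts.map M.eval := by
    induction ts with
    | nil => rfl
    | cons t ts ih => simp [Alg.evalArgs, ih]
  rw [Alg.eval, evalArgs_eq_map]

theorem Alg.eval_ofString (M : Alg Op K) (g : Op) (u : List K) :
    M.eval (Term.ofString g u) = M.op g (u.map M.cst) := by
  rw [Term.ofString, Alg.eval_app, List.map_map]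
  rfl

theorem Signature.wf_ofString {g : Op} {u : List K} :
    F.WF (Term.ofString g u) ↔ F.ArityOK g u.length := by
  rw [Term.ofString, Signature.wf_app_iff, List.length_map, and_iff_left_iff_imp,
    List.forall_mem_map]
  exact fun _ c _ => .const c

theorem Signature.WF.map {K' : Type} {t : Term Op K} (ht : F.WF t) (h : K → K') :
    F.WF (t.map h) := by
  induction t using Term.induction with
  | const c => exact .const _
  | app g ts ih =>
    rw [Signature.wf_app_iff] at ht
    rw [Term.map, Term.mapArgs_eq_map, Signature.wf_app_iff, List.length_map, List.forall_mem_map]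
    exact ⟨ht.1, fun t htm => ih t htm (ht.2 t htm)⟩

theorem Signature.WF.arg {g : Op} {xs ys : List (Term Op K)} {a : Term Op K}
    (h : F.WF (Term.app g (xs ++ a :: ys))) : F.WF a :=
  (Signature.wf_app_iff.1 h).2 a (by simp)

theorem Signature.WF.replace_arg {g : Op} {xs ys : List (Term Op K)} {a b : Term Op K}
    (h : F.WF (Term.app g (xs ++ a :: ys))) (hb : F.WF b) :
    F.WF (Term.app g (xs ++ b :: ys)) := by
  simp only [Signature.wf_app_iff, List.length_append, List.length_cons, List.forall_mem_append,
    List.forall_mem_cons] at h ⊢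
  exact ⟨h.1, h.2.1, hb, h.2.2.2⟩

theorem Term.Replace.wf {u v s s' : Term Op K} (h : Term.Replace u v s s') (hs : F.WF s)
    (hv : F.WF v) : F.WF s' := by
  induction h with
  | top => exact hv
  | arg g xs ys a b _ ih => exact hs.replace_arg (ih hs.arg)

theorem Term.Replace.wf_subterm {u v s s' : Term Op K} (h : Term.Replace u v s s')
    (hs : F.WF s) : F.WF u := by
  induction h with
  | top => exact hs
  | arg g xs ys a _ _ ih => exact ih hs.arg

theorem Term.Replace.eval_eq {M : Alg Op K} {u v s s' : Term Op K} (h : Term.Replace u v s s')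
    (huv : M.eval u = M.eval v) : M.eval s = M.eval s' := by
  induction h with
  | top => exact huv
  | arg g xs ys a b _ ih => simp only [Alg.eval_app, List.map_append, List.map_cons, ih]

end Terms

section Closure

variable {Op K : Type} {F : Signature Op} {E : Set (Eqn Op K)}

theorem Signature.WF.flat_assoc {f : Op} (hf : f ∈ F.assoc) {xs ys zs : List (Term Op K)}
    (h : F.WF (Term.app f (xs ++ Term.app f ys :: zs))) : F.WF (Term.app f (xs ++ ys ++ zs)) := by
  have hys := h.arg
  simp only [Signature.wf_app_iff, Signature.arityOK_iff_two_le hf, List.length_append,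
    List.length_cons, List.forall_mem_append, List.forall_mem_cons] at h hys ⊢
  exact ⟨by omega, ⟨h.2.1, hys.2⟩, h.2.2.2⟩

theorem CC.wf (hE : ∀ e ∈ E, ∀ t ∈ e, F.WF t) {s t : Term Op K} (h : CC F E s t) :
    F.WF s ∧ F.WF t := by
  induction h with
  | base s t h => exact ⟨hE _ h _ (by simp), hE _ h _ (by simp)⟩
  | assoc f xs ys zs hf hl => exact ⟨hl, hl.flat_assoc hf⟩
  | refl s h => exact ⟨h, h⟩
  | symm s t _ ih => exact ih.symm
  | trans s t u _ _ ih₁ ih₂ => exact ⟨ih₁.1, ih₂.2⟩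
  | congr g ss ts har hlen _ ih =>
    refine ⟨.app _ _ har fun t ht => ?_, .app _ _ (hlen ▸ har) fun t ht => ?_⟩
    · obtain ⟨i, hi, rfl⟩ := List.mem_iff_getElem.1 ht
      exact (ih i hi).1
    · obtain ⟨i, hi, rfl⟩ := List.mem_iff_getElem.1 ht
      exact (ih i (hlen ▸ hi)).2

theorem CC.congr_forall₂ {g : Op} {ss ts : List (Term Op K)} (har : F.ArityOK g ss.length)
    (h : List.Forall₂ (CC F E) ss ts) : CC F E (Term.app g ss) (Term.app g ts) :=
  .congr g ss ts har h.length_eq fun _ hi => h.get hi (h.length_eq ▸ hi)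

theorem CC.congr_map {α : Type} {g : Op} {l : List α} {x y : α → Term Op K}
    (har : F.ArityOK g l.length) (h : ∀ a ∈ l, CC F E (x a) (y a)) :
    CC F E (Term.app g (l.map x)) (Term.app g (l.map y)) := by
  refine CC.congr_forall₂ (by rwa [List.length_map]) ?_
  rw [List.forall₂_map_left_iff, List.forall₂_map_right_iff, List.forall₂_same]
  exact h

theorem CC.congr_arg {g : Op} {xs ys : List (Term Op K)} {a b : Term Op K} (h : CC F E a b)
    (hwf : F.WF (Term.app g (xs ++ a :: ys))) :
    CC F E (Term.app g (xs ++ a :: ys)) (Term.app g (xs ++ b :: ys)) := by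
  simp only [Signature.wf_app_iff, List.forall_mem_append, List.forall_mem_cons] at hwf
  obtain ⟨har, hxs, -, hys⟩ := hwf
  have refl_list : ∀ l : List (Term Op K), (∀ t ∈ l, F.WF t) → List.Forall₂ (CC F E) l l :=
    fun l hl => List.forall₂_same.2 fun t ht => .refl t (hl t ht)
  exact CC.congr_forall₂ har (List.rel_append (refl_list xs hxs) (.cons h (refl_list ys hys)))

theorem CC.replace {u v s s' : Term Op K} (h : Term.Replace u v s s') (huv : CC F E u v)
    (hs : F.WF s) : CC F E s s' := by
  induction h with
  | top => exact huv
  | arg g xs ys a b _ ih => exact CC.congr_arg (ih hs.arg) hs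

theorem CC.of_base {E' : Set (Eqn Op K)} (h : ∀ p q, s(p, q) ∈ E → CC F E' p q)
    {s t : Term Op K} (hst : CC F E s t) : CC F E' s t := by
  induction hst with
  | base s t hs => exact h s t hs
  | assoc f xs ys zs hf hl => exact .assoc f xs ys zs hf hl
  | refl s hs => exact .refl s hs
  | symm s t _ ih => exact .symm _ _ ih
  | trans s t u _ _ ih₁ ih₂ => exact .trans _ _ _ ih₁ ih₂
  | congr g ss ts har hlen _ ih => exact .congr g ss ts har hlen ih

theorem EqA.wf {s t : Term Op K} (h : EqA F s t) : F.WF s ∧ F.WF t := CC.wf (by simp) h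

theorem EqA.refl {s : Term Op K} (h : F.WF s) : EqA F s s := CC.refl _ h

theorem EqA.symm {s t : Term Op K} (h : EqA F s t) : EqA F t s := CC.symm _ _ h

theorem EqA.trans {s t u : Term Op K} (h : EqA F s t) (h' : EqA F t u) : EqA F s u :=
  CC.trans _ _ _ h h'

theorem EqA.cc {s t : Term Op K} (h : EqA F s t) : CC F E s t := CC.of_base (by simp) h

theorem EqA.splice_args (g : Op) (us xs : List (Term Op K)) (h : F.WF (Term.app g (xs ++ us))) :
    EqA F (Term.app g (xs ++ us)) (Term.app g (xs ++ us.flatMap (Term.splice F g))) := by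
  induction us generalizing xs with
  | nil => exact EqA.refl h
  | cons u us ih =>
    have keep (hu : Term.splice F g u = [u]) : EqA F (Term.app g (xs ++ u :: us))
        (Term.app g (xs ++ (u :: us).flatMap (Term.splice F g))) := by
      simpa [hu] using ih (xs ++ [u]) (by simpa using h)
    cases u with
    | const c => exact keep rfl
    | app g' ys =>
      by_cases hg : g' = g ∧ g ∈ F.assoc
      · obtain ⟨rfl, hassoc⟩ := hg
        have merge : EqA F (Term.app g' (xs ++ Term.app g' ys :: us))
            (Term.app g' (xs ++ ys ++ us)) := CC.assoc g' xs ys us hassoc h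
        refine merge.trans ?_
        simpa [Term.splice, hassoc] using ih (xs ++ ys) merge.wf.2
      · exact keep (by simp [Term.splice, hg])

theorem Signature.WF.eqA_flatten {t : Term Op K} (ht : F.WF t) : EqA F t (t.flatten F) := by
  induction t using Term.induction with
  | const c => exact EqA.refl ht
  | app g ts ih =>
    rw [Signature.wf_app_iff] at ht
    have flatten_args : EqA F (Term.app g ts) (Term.app g (ts.map (Term.flatten F))) := by
      simpa [EqA] using CC.congr_map (x := id) ht.1 fun t htm => ih t htm (ht.2 t htm)
    refine flatten_args.trans ?_
    rw [Term.flatten, Term.flattenArgs_eq_flatMap]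
    simpa [List.flatMap_map] using EqA.splice_args g (ts.map (Term.flatten F)) [] flatten_args.wf.2

theorem CC.eval_eq {s t : Term Op K} (h : CC F E s t) {M : Alg Op K} (hM : M.ModelsA F)
    (hE : ∀ p q : Term Op K, s(p, q) ∈ E → M.eval p = M.eval q) : M.eval s = M.eval t := by
  induction h with
  | base s t h => exact hE _ _ h
  | assoc f xs ys zs hf hl =>
    have hys := hl.arg
    rw [Signature.wf_app_iff, Signature.arityOK_iff_two_le hf] at hl hys
    have hlen := hl.1
    rw [List.length_append, List.length_cons] at hlen
    simpa [Alg.eval_app] using hM f hf (xs.map M.eval) (ys.map M.eval) (zs.map M.eval)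
      (by simpa using hys.1) (by simp only [List.length_map]; omega)
  | refl s _ => rfl
  | symm s t _ ih => exact ih.symm
  | trans s t u _ _ ih₁ ih₂ => exact ih₁.trans ih₂
  | congr g ss ts _ hlen _ ih =>
    rw [Alg.eval_app, Alg.eval_app]
    congr 1
    refine List.ext_getElem (by simpa using hlen) fun i hi _ => ?_
    simpa using ih i (by simpa using hi)

theorem EqA.eval_eq {s t : Term Op K} (h : EqA F s t) {M : Alg Op K} (hM : M.ModelsA F) :
    M.eval s = M.eval t :=
  CC.eval_eq h hM (by simp)

end Closure

section TermAlgebra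

variable {Op K : Type} {F : Signature Op} {E : Set (Eqn Op K)}

/-- Congruence modulo `CC F E` on the ground terms. -/
def termSetoid (F : Signature Op) (E : Set (Eqn Op K)) : Setoid {t : Term Op K // F.WF t} where
  r s t := CC F E s.1 t.1
  iseqv := ⟨fun s => .refl _ s.2, fun h => .symm _ _ h, fun h h' => .trans _ _ _ h h'⟩

theorem Signature.wf_app_val {g : Op} {l : List {t : Term Op K // F.WF t}}
    (h : F.ArityOK g l.length) : F.WF (Term.app g (l.map Subtype.val)) := by
  rw [Signature.wf_app_iff, List.length_map, List.forall_mem_map]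
  exact ⟨h, fun t _ => t.2⟩

open Classical in
/-- The algebra of ground terms modulo `CC F E`; `d` is the value of ill-formed applications. -/
noncomputable def termAlg (F : Signature Op) (E : Set (Eqn Op K))
    (d : {t : Term Op K // F.WF t}) : Alg Op K where
  carrier := Quotient (termSetoid F E)
  cst c := Quotient.mk _ ⟨Term.const c, .const c⟩
  op g l := Quotient.mk _ <| if h : F.ArityOK g l.length then
    ⟨Term.app g ((l.map Quotient.out).map Subtype.val),
      Signature.wf_app_val (by rwa [List.length_map])⟩
    else d

/-- The element of the term algebra that a ground term represents. -/
def termClass (F : Signature Op) (E : Set (Eqn Op K)) (d t : {t : Term Op K // F.WF t}) :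
    (termAlg F E d).carrier :=
  Quotient.mk (termSetoid F E) t

theorem termClass_eq_iff {d s t : {t : Term Op K // F.WF t}} :
    termClass F E d s = termClass F E d t ↔ CC F E s.1 t.1 :=
  Quotient.eq (r := termSetoid F E)

theorem termClass_surjective (d : {t : Term Op K // F.WF t}) :
    Function.Surjective (termClass F E d) :=
  Quotient.exists_rep

theorem termAlg_op_map (d : {t : Term Op K // F.WF t}) {g : Op}
    {l : List {t : Term Op K // F.WF t}} (h : F.ArityOK g l.length) :
    (termAlg F E d).op g (l.map (termClass F E d)) =
      termClass F E d ⟨Term.app g (l.map Subtype.val), Signature.wf_app_val h⟩ := by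
  have har : F.ArityOK g (l.map (termClass F E d)).length := by rwa [List.length_map]
  refine (congrArg (Quotient.mk _) (dif_pos har)).trans
    (Quotient.sound (s := termSetoid F E) ?_)
  change CC F E (Term.app g (((l.map (Quotient.mk (termSetoid F E))).map Quotient.out).map
    Subtype.val)) (Term.app g (l.map Subtype.val))
  rw [List.map_map, List.map_map]
  exact CC.congr_map h fun t _ => Quotient.mk_out (s := termSetoid F E) t

theorem termAlg_eval (d : {t : Term Op K // F.WF t}) (t : Term Op K) (ht : F.WF t) :
    (termAlg F E d).eval t = termClass F E d ⟨t, ht⟩ := by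
  induction t using Term.induction with
  | const c => rfl
  | app g ts ih =>
    obtain ⟨har, hts⟩ := Signature.wf_app_iff.1 ht
    lift ts to List {t : Term Op K // F.WF t} using hts
    rw [Alg.eval_app, ← termAlg_op_map d (by simpa using har), List.map_map]
    refine congrArg _ (List.map_congr_left fun t htm => ?_)
    exact ih t.1 (List.mem_map_of_mem htm) t.2

theorem termAlg_modelsA (d : {t : Term Op K // F.WF t}) : (termAlg F E d).ModelsA F := by
  intro f hf xs ys zs hy hx
  obtain ⟨xs, rfl⟩ := List.map_surjective_iff.2 (termClass_surjective d) xs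
  obtain ⟨ys, rfl⟩ := List.map_surjective_iff.2 (termClass_surjective d) ys
  obtain ⟨zs, rfl⟩ := List.map_surjective_iff.2 (termClass_surjective d) zs
  simp only [List.length_map] at hy hx
  have har {n : ℕ} (hn : 2 ≤ n) : F.ArityOK f n := (Signature.arityOK_iff_two_le hf).2 hn
  set y : {t : Term Op K // F.WF t} := ⟨_, Signature.wf_app_val (har hy)⟩
  have hnested : F.ArityOK f (xs ++ y :: zs).length := har (by simp; omega)
  have hflat : F.ArityOK f (xs ++ ys ++ zs).length := har (by simp; omega)
  rw [termAlg_op_map d (har hy), ← List.map_cons, ← List.map_append, ← List.map_append,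
    ← List.map_append, termAlg_op_map d hnested, termAlg_op_map d hflat, termClass_eq_iff]
  have hwf := Signature.wf_app_val hnested
  simp only [List.map_append, List.map_cons] at hwf ⊢
  exact CC.assoc f _ _ _ hf hwf

theorem follows_iff_cc (hE : ∀ e ∈ E, ∀ t ∈ e, F.WF t) {s t : Term Op K} (hs : F.WF s)
    (ht : F.WF t) : Follows F E s t ↔ CC F E s t := by
  refine ⟨fun h => ?_, fun h M hM hME => h.eval_eq hM hME⟩
  have eval_eq := h (termAlg F E ⟨s, hs⟩) (termAlg_modelsA _) fun p q hpq => by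
    rw [termAlg_eval _ p (hE _ hpq _ (by simp)), termAlg_eval _ q (hE _ hpq _ (by simp)),
      termClass_eq_iff]
    exact CC.base p q hpq
  rwa [termAlg_eval _ s hs, termAlg_eval _ t ht, termClass_eq_iff] at eval_eq

end TermAlgebra

/-! ### Terms modulo associativity as tagged words -/

/-- The letters of the words that encode terms modulo associativity: a constant or an opening
symbol, each tagged with the symbol above it (`none` at the root), and a closing bracket. -/
abbrev Letter (Op K : Type) : Type := Option (Option Op × (K ⊕ Op))

namespace Letter

variable {Op K : Type}

/-- The constant `c` as an argument of the symbol `τ`. -/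
abbrev cst (τ : Option Op) (c : K) : Letter Op K := some (τ, Sum.inl c)

/-- The beginning of a term headed by `g` that is an argument of the symbol `τ`. -/
abbrev opn (τ : Option Op) (g : Op) : Letter Op K := some (τ, Sum.inr g)

/-- The closing bracket. -/
abbrev cls : Letter Op K := none

end Letter

open Classical in
mutual
/-- The word of a term that is an argument of the symbol `τ`.  Nested associative symbols are
merged, so that terms equal modulo associativity have the same word. -/
noncomputable def Term.enc {Op K : Type} (F : Signature Op) :
    Option Op → Term Op K → List (Letter Op K)
  | τ, Term.const c => [Letter.cst τ c]
  | τ, Term.app g ts => if g ∈ F.assoc ∧ τ = some g then Term.encArgs F g ts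
      else Letter.opn τ g :: (Term.encArgs F g ts ++ [Letter.cls])
/-- The word of a list of arguments of the symbol `g`. -/
noncomputable def Term.encArgs {Op K : Type} (F : Signature Op) (g : Op) :
    List (Term Op K) → List (Letter Op K)
  | [] => []
  | t :: ts => Term.enc F (some g) t ++ Term.encArgs F g ts
end

section Encoding

variable {Op K : Type} {F : Signature Op}

theorem Term.encArgs_eq_flatMap (g : Op) (ts : List (Term Op K)) :
    Term.encArgs F g ts = ts.flatMap (Term.enc F (some g)) := by
  induction ts with
  | nil => simp [Term.encArgs]
  | cons t ts ih => simp [Term.encArgs, ih]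

theorem Term.enc_const (τ : Option Op) (c : K) :
    (Term.const c).enc F τ = [Letter.cst τ c] := by
  rw [Term.enc]

theorem Term.enc_app_self {f : Op} (hf : f ∈ F.assoc) (ts : List (Term Op K)) :
    (Term.app f ts).enc F (some f) = ts.flatMap (Term.enc F (some f)) := by
  rw [Term.enc, if_pos ⟨hf, rfl⟩, Term.encArgs_eq_flatMap]

theorem Term.enc_app {g : Op} {τ : Option Op} (h : ¬ (g ∈ F.assoc ∧ τ = some g))
    (ts : List (Term Op K)) : (Term.app g ts).enc F τ =
      Letter.opn τ g :: (ts.flatMap (Term.enc F (some g)) ++ [Letter.cls]) := by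
  rw [Term.enc, if_neg h, Term.encArgs_eq_flatMap]

theorem Term.exists_enc_app_eq (F : Signature Op) (g : Op) (τ : Option Op) :
    ∃ A B : List (Letter Op K), ∀ ts,
      (Term.app g ts).enc F τ = A ++ ts.flatMap (Term.enc F (some g)) ++ B := by
  by_cases h : g ∈ F.assoc ∧ τ = some g
  · obtain ⟨h, rfl⟩ := h
    exact ⟨[], [], fun ts => by simp [Term.enc_app_self h]⟩
  · exact ⟨[Letter.opn τ g], [Letter.cls], fun ts => by simp [Term.enc_app h]⟩

theorem Term.flatMap_enc_const (τ : Option Op) (u : List K) :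
    (u.map Term.const).flatMap (Term.enc F τ) = u.map (Letter.cst τ) := by
  rw [List.flatMap_map, List.map_eq_flatMap,
    List.flatMap_congr fun c _ => Term.enc_const τ c]

theorem Term.Replace.exists_enc_eq {u v s s' : Term Op K} (h : Term.Replace u v s s')
    (τ : Option Op) :
    ∃ τ' A B, s.enc F τ = A ++ u.enc F τ' ++ B ∧ s'.enc F τ = A ++ v.enc F τ' ++ B := by
  induction h generalizing τ with
  | top => exact ⟨τ, [], [], by simp, by simp⟩
  | arg g xs ys a b _ ih =>
    obtain ⟨τ', A, B, ha, hb⟩ := ih (some g)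
    obtain ⟨A', B', hAB⟩ := Term.exists_enc_app_eq (K := K) F g τ
    refine ⟨τ', A' ++ xs.flatMap (Term.enc F (some g)) ++ A,
      B ++ ys.flatMap (Term.enc F (some g)) ++ B', ?_, ?_⟩ <;> simp [hAB, ha, hb]

theorem flatMap_related {α β : Type*} {r : List α → List α → Prop} (hr : Equivalence r)
    (hctx : ∀ a b x y, r x y → r (a ++ x ++ b) (a ++ y ++ b)) {f : β → List α} {l l' : List β}
    (h : List.Forall₂ (fun x y => r (f x) (f y)) l l') : r (l.flatMap f) (l'.flatMap f) := by
  induction h with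
  | nil => exact hr.refl _
  | @cons x y l l' h _ ih =>
    have head := hctx [] (l.flatMap f) _ _ h
    have tail := hctx (f y) [] _ _ ih
    simp only [List.nil_append, List.append_nil] at head tail
    exact hr.trans head tail

theorem CC.enc {E : Set (Eqn Op K)} {r : List (Letter Op K) → List (Letter Op K) → Prop}
    (hr : Equivalence r) (hctx : ∀ a b x y, r x y → r (a ++ x ++ b) (a ++ y ++ b))
    (hbase : ∀ p q : Term Op K, s(p, q) ∈ E → ∀ τ, r (p.enc F τ) (q.enc F τ))
    {s t : Term Op K} (h : CC F E s t) (τ : Option Op) : r (s.enc F τ) (t.enc F τ) := by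
  induction h generalizing τ with
  | base s t h => exact hbase s t h τ
  | assoc f xs ys zs hf _ =>
    obtain ⟨A, B, hAB⟩ := Term.exists_enc_app_eq (K := K) F f τ
    rw [hAB, hAB]
    simpa [Term.enc_app_self hf] using hr.refl _
  | refl s _ => exact hr.refl _
  | symm s t _ ih => exact hr.symm (ih τ)
  | trans s t u _ _ ih₁ ih₂ => exact hr.trans (ih₁ τ) (ih₂ τ)
  | congr g ss ts _ hlen _ ih =>
    obtain ⟨A, B, hAB⟩ := Term.exists_enc_app_eq (K := K) F g τ
    rw [hAB, hAB]
    apply hctx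
    exact flatMap_related hr hctx
      (List.forall₂_iff_get.2 ⟨hlen, fun i hi _ => ih i hi (some g)⟩)

theorem EqA.enc_eq {s t : Term Op K} (h : EqA F s t) (τ : Option Op) : s.enc F τ = t.enc F τ :=
  CC.enc (r := Eq) eq_equivalence (fun _ _ _ _ h => h ▸ rfl) (by simp) h τ

end Encoding

/-- The stack of a decoder of tagged words.  Each entry holds a symbol whose bracket is still open
and those of its arguments that have been read; the bottom entry belongs to the root. -/
abbrev DecodeStack (Op K : Type) : Type := List (Option Op × List (Term Op K))

/-- `Decodes σ w σ'`: reading the word `w` takes the decoder from the stack `σ` to `σ'`. -/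
inductive Decodes {Op K : Type} :
    DecodeStack Op K → List (Letter Op K) → DecodeStack Op K → Prop
  | nil {σ} : Decodes σ [] σ
  | cst {τ ts σ c w σ'} (h : Decodes ((τ, ts ++ [Term.const c]) :: σ) w σ') :
      Decodes ((τ, ts) :: σ) (Letter.cst τ c :: w) σ'
  | opn {τ ts σ g w σ'} (h : Decodes ((some g, []) :: (τ, ts) :: σ) w σ') :
      Decodes ((τ, ts) :: σ) (Letter.opn τ g :: w) σ'
  | cls {τ ts g us σ w σ'} (h : Decodes ((τ, ts ++ [Term.app g us]) :: σ) w σ') :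
      Decodes ((some g, us) :: (τ, ts) :: σ) (Letter.cls :: w) σ'

/-- `Subterm s t`: the term `s` is a subterm of `t`. -/
inductive Subterm {Op K : Type} (s : Term Op K) : Term Op K → Prop
  | refl : Subterm s s
  | arg (g : Op) (ts : List (Term Op K)) (t : Term Op K) (ht : t ∈ ts) (h : Subterm s t) :
      Subterm s (Term.app g ts)

/-- The term `s` is a subterm of one of the arguments on the stack `σ`. -/
def DecodeStack.Holds {Op K : Type} (σ : DecodeStack Op K) (s : Term Op K) : Prop :=
  ∃ e ∈ σ, ∃ t ∈ e.2, Subterm s t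

/-- The argument list that a flattened term contributes below the symbol `τ`, or at the root. -/
noncomputable def spliceBelow {Op K : Type} (F : Signature Op) :
    Option Op → Term Op K → List (Term Op K)
  | none, t => [t]
  | some g, t => Term.splice F g t

section Decoding

variable {Op K : Type} {F : Signature Op}

theorem Decodes.append {σ σ' σ'' : DecodeStack Op K} {w w' : List (Letter Op K)}
    (h : Decodes σ w σ') (h' : Decodes σ' w' σ'') : Decodes σ (w ++ w') σ'' := by
  induction h with
  | nil => exact h'
  | cst _ ih => exact .cst (ih h')
  | opn _ ih => exact .opn (ih h')
  | cls _ ih => exact .cls (ih h')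

theorem Decodes.split {w w' : List (Letter Op K)} {σ σ'' : DecodeStack Op K}
    (h : Decodes σ (w ++ w') σ'') : ∃ σ', Decodes σ w σ' ∧ Decodes σ' w' σ'' := by
  induction w generalizing σ with
  | nil => exact ⟨σ, .nil, h⟩
  | cons a w ih =>
    rw [List.cons_append] at h
    cases h with
    | cst h => exact (ih h).imp fun _ h => ⟨.cst h.1, h.2⟩
    | opn h => exact (ih h).imp fun _ h => ⟨.opn h.1, h.2⟩
    | cls h => exact (ih h).imp fun _ h => ⟨.cls h.1, h.2⟩

theorem Decodes.unique {w : List (Letter Op K)} {σ σ₁ σ₂ : DecodeStack Op K}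
    (h₁ : Decodes σ w σ₁) (h₂ : Decodes σ w σ₂) : σ₁ = σ₂ := by
  induction h₁ with
  | nil => cases h₂; rfl
  | cst _ ih => cases h₂ with | cst h => exact ih h
  | opn _ ih => cases h₂ with | opn h => exact ih h
  | cls _ ih => cases h₂ with | cls h => exact ih h

theorem spliceBelow_app {g : Op} {τ : Option Op} (h : ¬ (g ∈ F.assoc ∧ τ = some g))
    (ts : List (Term Op K)) : spliceBelow F τ (Term.app g ts) = [Term.app g ts] := by
  cases τ with
  | none => rfl
  | some f =>
    refine if_neg ?_
    rintro ⟨rfl, hg⟩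
    exact h ⟨hg, rfl⟩

theorem decodes_flatMap_enc {g : Op} {us : List (Term Op K)}
    (h : ∀ u ∈ us, ∀ ts σ, Decodes ((some g, ts) :: σ) (u.enc F (some g))
      ((some g, ts ++ Term.splice F g (u.flatten F)) :: σ))
    (ts : List (Term Op K)) (σ : DecodeStack Op K) :
    Decodes ((some g, ts) :: σ) (us.flatMap (Term.enc F (some g)))
      ((some g, ts ++ us.flatMap fun u => Term.splice F g (u.flatten F)) :: σ) := by
  induction us generalizing ts with
  | nil => simpa using .nil
  | cons u us ih =>
    obtain ⟨hu, hus⟩ := List.forall_mem_cons.1 h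
    simpa using (hu ts σ).append (ih hus _)

theorem Term.decodes_enc (F : Signature Op) (t : Term Op K) (τ : Option Op)
    (ts : List (Term Op K)) (σ : DecodeStack Op K) :
    Decodes ((τ, ts) :: σ) (t.enc F τ) ((τ, ts ++ spliceBelow F τ (t.flatten F)) :: σ) := by
  induction t using Term.induction generalizing τ ts σ with
  | const c =>
    rw [Term.enc_const]
    cases τ <;> exact .cst .nil
  | app g us ih =>
    have decodes_args := decodes_flatMap_enc fun u hu ts σ => ih u hu (some g) ts σ
    rw [Term.flatten, Term.flattenArgs_eq_flatMap]
    by_cases h : g ∈ F.assoc ∧ τ = some g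
    · obtain ⟨hg, rfl⟩ := h
      rw [Term.enc_app_self hg]
      simpa [spliceBelow, Term.splice, hg] using decodes_args ts σ
    · rw [Term.enc_app h, spliceBelow_app h]
      exact .opn ((decodes_args [] _).append (.cls .nil))

theorem eqA_of_enc_eq {s t : Term Op K} (hs : F.WF s) (ht : F.WF t)
    (h : s.enc F none = t.enc F none) : EqA F s t := by
  have hdec := s.decodes_enc F none [] []
  rw [h] at hdec
  have flatten_eq : s.flatten F = t.flatten F := by
    simpa [spliceBelow] using hdec.unique (t.decodes_enc F none [] [])
  exact hs.eqA_flatten.trans (flatten_eq ▸ ht.eqA_flatten.symm)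

theorem Subterm.wf {s t : Term Op K} (h : Subterm s t) (ht : F.WF t) : F.WF s := by
  induction h with
  | refl => exact ht
  | arg g ts t htm _ ih => exact ih ((Signature.wf_app_iff.1 ht).2 t htm)

theorem DecodeStack.holds_cons {τ : Option Op} {ts : List (Term Op K)} {σ : DecodeStack Op K}
    {s : Term Op K} :
    DecodeStack.Holds ((τ, ts) :: σ) s ↔ (∃ t ∈ ts, Subterm s t) ∨ DecodeStack.Holds σ s := by
  simp [DecodeStack.Holds]

theorem DecodeStack.holds_push {τ : Option Op} {ts : List (Term Op K)} {σ : DecodeStack Op K}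
    {s t : Term Op K} : DecodeStack.Holds ((τ, ts ++ [t]) :: σ) s ↔
      Subterm s t ∨ DecodeStack.Holds ((τ, ts) :: σ) s := by
  simp only [DecodeStack.holds_cons, List.mem_append, List.mem_singleton, or_and_right, exists_or,
    exists_eq_left]
  rw [or_assoc, or_left_comm]

theorem Decodes.holds {s : Term Op K} {w : List (Letter Op K)} {σ σ' : DecodeStack Op K}
    (h : Decodes σ w σ') (hs : σ.Holds s) : σ'.Holds s := by
  induction h with
  | nil => exact hs
  | cst _ ih => exact ih (DecodeStack.holds_push.2 (.inr hs))
  | opn _ ih => exact ih (DecodeStack.holds_cons.2 (.inr hs))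
  | cls _ ih =>
    refine ih (DecodeStack.holds_push.2 ?_)
    rcases DecodeStack.holds_cons.1 hs with ⟨t, ht, hst⟩ | hs
    · exact .inl (.arg _ _ t ht hst)
    · exact .inr hs

theorem Decodes.entry {g : Op} {args : List (Term Op K)} {w : List (Letter Op K)}
    {σ σ' : DecodeStack Op K} (h : Decodes σ w σ') (hs : ∃ more, (some g, args ++ more) ∈ σ) :
    ∃ more, (some g, args ++ more) ∈ σ' ∨ σ'.Holds (Term.app g (args ++ more)) := by
  have push {τ : Option Op} {ts : List (Term Op K)} {σ : DecodeStack Op K} (t : Term Op K)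
      (h : ∃ more, (some g, args ++ more) ∈ (τ, ts) :: σ) :
      ∃ more, (some g, args ++ more) ∈ (τ, ts ++ [t]) :: σ := by
    obtain ⟨more, hmem⟩ := h
    rcases List.mem_cons.1 hmem with heq | hmem
    · obtain ⟨rfl, rfl⟩ := Prod.mk.inj heq
      exact ⟨more ++ [t], by simp⟩
    · exact ⟨more, List.mem_cons_of_mem _ hmem⟩
  induction h with
  | nil => exact hs.imp fun _ => .inl
  | cst _ ih => exact ih (push _ hs)
  | opn _ ih => exact ih (hs.imp fun _ => List.mem_cons_of_mem _)
  | cls h ih =>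
    obtain ⟨more, hmem⟩ := hs
    rcases List.mem_cons.1 hmem with heq | hmem
    · obtain ⟨hg, rfl⟩ := Prod.mk.inj heq
      obtain rfl := Option.some.inj hg
      exact ⟨more, .inr (h.holds (DecodeStack.holds_push.2 (.inl .refl)))⟩
    · exact ih (push _ ⟨more, hmem⟩)

theorem Decodes.constants {τ : Option Op} {u : List K} (hu : u ≠ []) {σ σ' : DecodeStack Op K}
    (h : Decodes σ (u.map (Letter.cst τ)) σ') :
    ∃ ts σ₁, σ = (τ, ts) :: σ₁ ∧ σ' = (τ, ts ++ u.map Term.const) :: σ₁ := by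
  induction u generalizing σ with
  | nil => exact absurd rfl hu
  | cons c u ih =>
    rw [List.map_cons] at h
    cases h with
    | @cst _ ts σ _ _ _ h =>
      refine ⟨ts, σ, rfl, ?_⟩
      rcases eq_or_ne u [] with rfl | hu
      · cases h
        rfl
      · obtain ⟨ts', σ₁, heq, rfl⟩ := ih hu h
        obtain ⟨hts, rfl⟩ := List.cons.inj heq
        rw [← (Prod.mk.inj hts).2, List.append_assoc]
        rfl

theorem exists_decodes_of_enc_eq {t : Term Op K} {a w b : List (Letter Op K)}
    (h : t.enc F none = a ++ w ++ b) :
    ∃ σ σ', Decodes σ w σ' ∧ Decodes σ' b [(none, [t.flatten F])] := by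
  have hdec := t.decodes_enc F none [] []
  rw [h] at hdec
  obtain ⟨σ', hdec, hb⟩ := hdec.split
  obtain ⟨σ, -, hw⟩ := hdec.split
  exact ⟨σ, σ', hw, hb⟩

theorem DecodeStack.holds_singleton {τ : Option Op} {s t : Term Op K} :
    DecodeStack.Holds [(τ, [t])] s ↔ Subterm s t := by
  simp [DecodeStack.Holds]

theorem exists_subterm_of_enc_string {t : Term Op K} {f : Op} {u : List K} (hu : u ≠ [])
    {a b : List (Letter Op K)} (h : t.enc F none = a ++ u.map (Letter.cst (some f)) ++ b) :
    ∃ xs ys, Subterm (Term.app f (xs ++ u.map Term.const ++ ys)) (t.flatten F) := by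
  obtain ⟨_, _, hw, hb⟩ := exists_decodes_of_enc_eq h
  obtain ⟨ts, σ, rfl, rfl⟩ := hw.constants hu
  obtain ⟨more, hmem | hs⟩ := hb.entry (g := f) (args := ts ++ u.map Term.const) ⟨[], by simp⟩
  · simp at hmem
  · exact ⟨ts, more, DecodeStack.holds_singleton.1 hs⟩

theorem subterm_of_enc_const {t : Term Op K} {τ : Option Op} {c : K}
    {a b : List (Letter Op K)} (h : t.enc F none = a ++ [Letter.cst τ c] ++ b) :
    Subterm (Term.const c) (t.flatten F) := by
  obtain ⟨_, _, hw, hb⟩ := exists_decodes_of_enc_eq h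
  obtain ⟨ts, σ, rfl, rfl⟩ := hw.constants (u := [c]) (by simp)
  exact DecodeStack.holds_singleton.1 (hb.holds (DecodeStack.holds_push.2 (.inl .refl)))

theorem subterm_of_enc_bracket {t : Term Op K} {τ : Option Op} {g : Op} {u : List K}
    (hu : u ≠ []) {a b : List (Letter Op K)} (h : t.enc F none =
      a ++ (Letter.opn τ g :: (u.map (Letter.cst (some g)) ++ [Letter.cls])) ++ b) :
    Subterm (Term.ofString g u) (t.flatten F) := by
  obtain ⟨_, _, hw, hb⟩ := exists_decodes_of_enc_eq h
  cases hw with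
  | opn hw =>
    obtain ⟨_, hw, hcls⟩ := hw.split
    obtain ⟨ts, σ, heq, rfl⟩ := hw.constants hu
    obtain ⟨hts, rfl⟩ := List.cons.inj heq
    obtain rfl := (Prod.mk.inj hts).2
    cases hcls with
    | cls hcls =>
      cases hcls
      exact DecodeStack.holds_singleton.1 (hb.holds (DecodeStack.holds_push.2 (.inl .refl)))

end Decoding

/-! ### Weights of strings -/

/-- Weight functions on strings that are compatible with concatenation and increase along the
length-lexicographic ordering whose comparison of letters is `r`. -/
structure LexWeight {α : Type} (r : α → α → Prop) (μ : List α → ℕ) : Prop where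
  context_le (a b : List α) {x y : List α} : μ x ≤ μ y → μ (a ++ x ++ b) ≤ μ (a ++ y ++ b)
  context_lt (a b : List α) {x y : List α} : μ x < μ y → μ (a ++ x ++ b) < μ (a ++ y ++ b)
  lt_of_length_lt {x y : List α} : x.length < y.length → μ x < μ y
  lt_of_lex {x y : List α} : x.length = y.length → List.Lex r x y → μ x < μ y

section Numeral

variable {α : Type} {B : ℕ} {d : α → ℕ}

/-- The number with the digits `d a`, for the letters `a` of the string, in base `B`; the first
letter is the most significant one. -/
def numeral (B : ℕ) (d : α → ℕ) (w : List α) : ℕ := Nat.ofDigits B (w.map d).reverse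

theorem numeral_append (x y : List α) :
    numeral B d (x ++ y) = numeral B d y + B ^ y.length * numeral B d x := by
  simp [numeral, Nat.ofDigits_append]

theorem numeral_cons (a : α) (w : List α) :
    numeral B d (a :: w) = numeral B d w + B ^ w.length * d a := by
  simpa [numeral] using numeral_append (B := B) (d := d) [a] w

theorem numeral_lt_pow (hd : ∀ a, d a < B) (w : List α) : numeral B d w < B ^ w.length := by
  induction w with
  | nil => simp [numeral]
  | cons a w ih =>
    calc numeral B d (a :: w) < B ^ w.length + B ^ w.length * d a := by
          rw [numeral_cons]; omega
      _ = B ^ w.length * (d a + 1) := by ring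
      _ ≤ B ^ w.length * B := Nat.mul_le_mul_left _ (hd a)
      _ = B ^ (a :: w).length := by rw [List.length_cons, pow_succ]

theorem numeral_lt_of_length_lt (hd : ∀ a, d a < B) (hd₀ : ∀ a, 0 < d a) {x y : List α}
    (h : x.length < y.length) : numeral B d x < numeral B d y := by
  cases y with
  | nil => simp at h
  | cons a y =>
    calc numeral B d x < B ^ x.length := numeral_lt_pow hd x
      _ ≤ B ^ y.length :=
        Nat.pow_le_pow_right ((hd₀ a).trans (hd a)) (Nat.lt_succ_iff.1 (by simpa using h))
      _ ≤ B ^ y.length * d a := Nat.le_mul_of_pos_right _ (hd₀ a)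
      _ ≤ numeral B d (a :: y) := by rw [numeral_cons]; omega

theorem numeral_lt_of_lex {r : α → α → Prop} (hd : ∀ a, d a < B)
    (hr : ∀ a b, r a b → d a < d b) {x y : List α} (hlen : x.length = y.length)
    (h : List.Lex r x y) : numeral B d x < numeral B d y := by
  induction h with
  | nil => simp at hlen
  | @rel a x b y hab =>
    obtain hlen : x.length = y.length := by simpa using hlen
    calc numeral B d (a :: x) < B ^ x.length + B ^ x.length * d a := by
          rw [numeral_cons]; have := numeral_lt_pow hd x; omega
      _ = B ^ y.length * (d a + 1) := by rw [hlen]; ring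
      _ ≤ B ^ y.length * d b := Nat.mul_le_mul_left _ (hr a b hab)
      _ ≤ numeral B d (b :: y) := by rw [numeral_cons]; omega
  | @cons a x y _ ih =>
    obtain hlen : x.length = y.length := by simpa using hlen
    simpa [numeral_cons, hlen] using ih hlen

theorem numeral_context_le (hB : 0 < B) (a b : List α) {x y : List α}
    (hlen : x.length ≤ y.length) (h : numeral B d x ≤ numeral B d y) :
    numeral B d (a ++ x ++ b) ≤ numeral B d (a ++ y ++ b) := by
  simp only [numeral_append]
  gcongr

theorem numeral_context_lt (hB : 0 < B) (a b : List α) {x y : List α}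
    (hlen : x.length ≤ y.length) (h : numeral B d x < numeral B d y) :
    numeral B d (a ++ x ++ b) < numeral B d (a ++ y ++ b) := by
  have hprefix : B ^ x.length * numeral B d a ≤ B ^ y.length * numeral B d a := by
    gcongr
  have := Nat.mul_lt_mul_of_pos_left (add_lt_add_of_lt_of_le h hprefix) (pow_pos hB b.length)
  simp only [numeral_append]
  omega

theorem lexWeight_numeral {r : α → α → Prop} (hB : 0 < B) (hd : ∀ a, d a < B)
    (hd₀ : ∀ a, 0 < d a) (hr : ∀ a b, r a b → d a < d b) : LexWeight r (numeral B d) := by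
  have length_le {x y : List α} (h : numeral B d x ≤ numeral B d y) : x.length ≤ y.length :=
    not_lt.1 fun hlt => (numeral_lt_of_length_lt hd hd₀ hlt).not_ge h
  exact
    { context_le := fun a b _ _ h => numeral_context_le hB a b (length_le h) h
      context_lt := fun a b _ _ h => numeral_context_lt hB a b (length_le h.le) h
      lt_of_length_lt := numeral_lt_of_length_lt hd hd₀
      lt_of_lex := numeral_lt_of_lex hd hr }

end Numeral

theorem exists_lexWeight {α : Type} {r : α → α → Prop} {N : ℕ} {d : α → ℕ}
    (hd : ∀ a, d a ≤ N) (hr : ∀ a b, r a b → d a < d b) :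
    ∃ B, ∃ μ : List α → ℕ, LexWeight r μ ∧ ∀ w, μ w < B ^ w.length :=
  have hlt (a : α) : d a + 1 < N + 2 := by have := hd a; omega
  ⟨N + 2, numeral (N + 2) fun a => d a + 1,
    lexWeight_numeral (by omega) hlt (by simp) fun a b h => Nat.succ_lt_succ (hr a b h),
    numeral_lt_pow hlt⟩

/-! ### Normal forms of decreasing relations -/

section Confluence

variable {W : Type} {Q : W → W → Prop} {μ : W → ℕ}

/-- The elements `x` and `y` are equivalent modulo `Q` through elements of weight less than `m`. -/
def LinkedBelow (Q : W → W → Prop) (μ : W → ℕ) (m : ℕ) : W → W → Prop :=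
  Relation.ReflTransGen fun x y => (Q x y ∨ Q y x) ∧ μ x < m ∧ μ y < m

theorem LinkedBelow.trans {m : ℕ} {x y z : W} (h : LinkedBelow Q μ m x y)
    (h' : LinkedBelow Q μ m y z) : LinkedBelow Q μ m x z :=
  Relation.ReflTransGen.trans h h'

theorem LinkedBelow.symm {m : ℕ} {x y : W} (h : LinkedBelow Q μ m x y) :
    LinkedBelow Q μ m y x := by
  induction h with
  | refl => exact .refl
  | tail _ h ih => exact .head ⟨h.1.symm, h.2.2, h.2.1⟩ ih

theorem LinkedBelow.of_rel {m : ℕ} {x y : W} (h : Q x y) (hx : μ x < m) (hy : μ y < m) :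
    LinkedBelow Q μ m x y :=
  .single ⟨.inl h, hx, hy⟩

theorem LinkedBelow.map {m m' : ℕ} (φ : W → W) (hφ : ∀ x y, Q x y → Q (φ x) (φ y))
    (hμ : ∀ x, μ x < m → μ (φ x) < m') {x y : W} (h : LinkedBelow Q μ m x y) :
    LinkedBelow Q μ m' (φ x) (φ y) := by
  induction h with
  | refl => exact .refl
  | tail _ h ih => exact .tail ih ⟨h.1.imp (hφ _ _) (hφ _ _), hμ _ h.2.1, hμ _ h.2.2⟩

theorem LinkedBelow.eqvGen {m : ℕ} {x y : W} (h : LinkedBelow Q μ m x y) :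
    Relation.EqvGen Q x y := by
  induction h with
  | refl => exact .refl _
  | tail _ h ih => exact ih.trans _ _ _ (h.1.elim (.rel _ _) fun h => .symm _ _ (.rel _ _ h))

/-- The elements `x` and `y` are equivalent modulo `Q` through elements that are not heavier than
both of them. -/
def BoundedProof (Q : W → W → Prop) (μ : W → ℕ) (x y : W) : Prop :=
  ∀ m, μ x < m → μ y < m → LinkedBelow Q μ m x y

theorem BoundedProof.refl (x : W) : BoundedProof Q μ x x := fun _ _ _ => .refl

theorem BoundedProof.of_rel {x y : W} (h : Q x y) : BoundedProof Q μ x y :=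
  fun _ hx hy => .of_rel h hx hy

theorem BoundedProof.symm {x y : W} (h : BoundedProof Q μ x y) : BoundedProof Q μ y x :=
  fun m hy hx => (h m hx hy).symm

theorem BoundedProof.trans {x y z : W} (hxy : BoundedProof Q μ x y)
    (hyz : BoundedProof Q μ y z) (h : μ y ≤ μ x ∨ μ y ≤ μ z) : BoundedProof Q μ x z :=
  fun m hx hz =>
    have hy : μ y < m := h.elim (·.trans_lt hx) (·.trans_lt hz)
    (hxy m hx hy).trans (hyz m hy hz)

theorem BoundedProof.eqvGen {x y : W} (h : BoundedProof Q μ x y) : Relation.EqvGen Q x y :=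
  (h (μ x + μ y + 1) (by omega) (by omega)).eqvGen

/-- `n` is a normal form of `x` for the relation `Q`. -/
def HasNormalForm (Q : W → W → Prop) (x n : W) : Prop :=
  Relation.ReflTransGen Q x n ∧ ∀ y, ¬ Q n y

theorem HasNormalForm.head {x y n : W} (h : Q x y) (hn : HasNormalForm Q y n) :
    HasNormalForm Q x n :=
  ⟨.head h hn.1, hn.2⟩

theorem HasNormalForm.eq_or_exists {x n : W} (h : HasNormalForm Q x n) :
    (x = n ∧ ∀ y, ¬ Q x y) ∨ ∃ y, Q x y ∧ HasNormalForm Q y n := by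
  rcases h.1.cases_head with rfl | ⟨y, hxy, hy⟩
  · exact .inl ⟨rfl, h.2⟩
  · exact .inr ⟨y, hxy, hy, h.2⟩

theorem exists_hasNormalForm (hdec : ∀ x y, Q x y → μ y < μ x) (x : W) :
    ∃ n, HasNormalForm Q x n := by
  induction h : μ x using Nat.strong_induction_on generalizing x with
  | _ k ih =>
    by_cases hx : ∃ y, Q x y
    · obtain ⟨y, hy⟩ := hx
      obtain ⟨n, hn⟩ := ih _ (h ▸ hdec x y hy) y rfl
      exact ⟨n, hn.head hy⟩
    · exact ⟨x, .refl, not_exists.1 hx⟩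

theorem HasNormalForm.eq_of_linkedBelow (hdec : ∀ x y, Q x y → μ y < μ x) {m : ℕ}
    (hunique : ∀ x n n', μ x < m → HasNormalForm Q x n → HasNormalForm Q x n' → n = n')
    {x y : W} (h : LinkedBelow Q μ m x y) (hx : μ x < m) {n n' : W} (hn : HasNormalForm Q x n)
    (hn' : HasNormalForm Q y n') : n = n' := by
  induction h generalizing n' with
  | refl => exact hunique _ _ _ hx hn hn'
  | @tail y z _ hyz ih =>
    obtain ⟨hyz | hzy, -, hz⟩ := hyz
    · exact ih (hn'.head hyz)
    · obtain ⟨p, hp⟩ := exists_hasNormalForm hdec y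
      exact (ih hp).trans (hunique _ _ _ hz (hp.head hzy) hn')

theorem HasNormalForm.unique (hdec : ∀ x y, Q x y → μ y < μ x)
    (hpeak : ∀ x y z, Q x y → Q x z → LinkedBelow Q μ (μ x) y z) {x n n' : W}
    (hn : HasNormalForm Q x n) (hn' : HasNormalForm Q x n') : n = n' := by
  induction h : μ x using Nat.strong_induction_on generalizing x n n' with
  | _ k ih =>
    subst h
    rcases hn.eq_or_exists with ⟨rfl, hx⟩ | ⟨y, hxy, hy⟩ <;>
      rcases hn'.eq_or_exists with ⟨rfl, hx'⟩ | ⟨z, hxz, hz⟩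
    · rfl
    · exact absurd hxz (hx z)
    · exact absurd hxy (hx' y)
    · exact hy.eq_of_linkedBelow hdec (fun _ _ _ hw h h' => ih _ hw h h' rfl)
        (hpeak x y z hxy hxz) (hdec x y hxy) hz

theorem HasNormalForm.eq_of_eqvGen (hdec : ∀ x y, Q x y → μ y < μ x)
    (hpeak : ∀ x y z, Q x y → Q x z → LinkedBelow Q μ (μ x) y z) {x y n n' : W}
    (h : Relation.EqvGen Q x y) (hn : HasNormalForm Q x n) (hn' : HasNormalForm Q y n') :
    n = n' := by
  induction h generalizing n n' with
  | rel x y h => exact hn.unique hdec hpeak (hn'.head h)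
  | refl x => exact hn.unique hdec hpeak hn'
  | symm x y _ ih => exact (ih hn' hn).symm
  | trans x y z _ _ ih₁ ih₂ =>
    obtain ⟨p, hp⟩ := exists_hasNormalForm hdec y
    exact (ih₁ hn hp).trans (ih₂ hp hn')

end Confluence

/-! ### String rewriting -/

section StringRewriting

variable {α : Type} {R : List α → List α → Prop} {μ : List α → ℕ}

/-- One step of rewriting a string with the rules in `R`. -/
inductive StringStep (R : List α → List α → Prop) : List α → List α → Prop
  | intro (a b l r : List α) (h : R l r) : StringStep R (a ++ l ++ b) (a ++ r ++ b)

theorem StringStep.of_rule {l r : List α} (h : R l r) : StringStep R l r := by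
  simpa using StringStep.intro [] [] l r h

theorem StringStep.context (a b : List α) {x y : List α} (h : StringStep R x y) :
    StringStep R (a ++ x ++ b) (a ++ y ++ b) := by
  obtain ⟨a', b', l, r, h⟩ := h
  simpa using StringStep.intro (a ++ a') (b' ++ b) l r h

theorem eqvGen_context (a b : List α) {x y : List α} (h : Relation.EqvGen (StringStep R) x y) :
    Relation.EqvGen (StringStep R) (a ++ x ++ b) (a ++ y ++ b) := by
  induction h with
  | rel x y h => exact .rel _ _ (h.context a b)
  | refl x => exact .refl _
  | symm x y _ ih => exact ih.symm
  | trans x y z _ _ ih₁ ih₂ => exact ih₁.trans _ _ _ ih₂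

theorem BoundedProof.context
    (hμ : ∀ a b {x y}, μ x ≤ μ y → μ (a ++ x ++ b) ≤ μ (a ++ y ++ b)) (a b : List α)
    {x y : List α} (h : BoundedProof (StringStep R) μ x y) :
    BoundedProof (StringStep R) μ (a ++ x ++ b) (a ++ y ++ b) := fun m hx hy =>
  (h (max (μ x) (μ y) + 1) (by omega) (by omega)).map (fun w => a ++ w ++ b)
    (fun _ _ h => h.context a b) fun w hw =>
      (le_max_iff.1 (Nat.lt_succ_iff.1 hw)).elim (fun h => (hμ a b h).trans_lt hx)
        fun h => (hμ a b h).trans_lt hy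

theorem StringStep.weight_lt (hμ : ∀ a b {x y}, μ x < μ y → μ (a ++ x ++ b) < μ (a ++ y ++ b))
    (hR : ∀ l r, R l r → μ r < μ l) {x y : List α} (h : StringStep R x y) : μ y < μ x := by
  obtain ⟨a, b, l, r, h⟩ := h
  exact hμ a b (hR _ _ h)

theorem LinkedBelow.context (hμ : ∀ a b {x y}, μ x < μ y → μ (a ++ x ++ b) < μ (a ++ y ++ b))
    (a b : List α) {w x y : List α} (h : LinkedBelow (StringStep R) μ (μ w) x y) :
    LinkedBelow (StringStep R) μ (μ (a ++ w ++ b)) (a ++ x ++ b) (a ++ y ++ b) :=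
  h.map (fun w => a ++ w ++ b) (fun _ _ h => h.context a b) fun _ hw => hμ a b hw

theorem linkedBelow_of_disjoint
    (hμ : ∀ a b {x y}, μ x < μ y → μ (a ++ x ++ b) < μ (a ++ y ++ b))
    (hR : ∀ l r, R l r → μ r < μ l) {l r l' r' : List α} (m : List α) (h : R l r)
    (h' : R l' r') :
    LinkedBelow (StringStep R) μ (μ (l ++ m ++ l')) (r ++ m ++ l') (l ++ m ++ r') := by
  have hleft (w : List α) : StringStep R (l ++ m ++ w) (r ++ m ++ w) := by
    simpa using StringStep.intro [] (m ++ w) l r h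
  have hright (w : List α) : StringStep R (w ++ m ++ l') (w ++ m ++ r') := by
    simpa using StringStep.intro (w ++ m) [] l' r' h'
  have hlt {x y : List α} (h : StringStep R x y) : μ y < μ x := h.weight_lt hμ hR
  have hrl := hlt (hleft l')
  have hlr := hlt (hright l)
  exact (LinkedBelow.of_rel (hright r) hrl ((hlt (hright r)).trans hrl)).trans
    (LinkedBelow.of_rel (hleft r') hlr ((hlt (hleft r')).trans hlr)).symm

variable (hμ : ∀ a b {x y}, μ x < μ y → μ (a ++ x ++ b) < μ (a ++ y ++ b))
  (hR : ∀ l r, R l r → μ r < μ l)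
  (hincl : ∀ l' r r' a b, R (a ++ l' ++ b) r → R l' r' →
    LinkedBelow (StringStep R) μ (μ (a ++ l' ++ b)) r (a ++ r' ++ b))
  (hover : ∀ l₁ l₂ l₃ r r', l₁ ≠ [] → l₂ ≠ [] → l₃ ≠ [] → R (l₁ ++ l₂) r → R (l₂ ++ l₃) r' →
    LinkedBelow (StringStep R) μ (μ (l₁ ++ l₂ ++ l₃)) (r ++ l₃) (l₁ ++ r'))

include hμ hR hincl hover

theorem linkedBelow_of_append_eq {l r l' r' a b b' : List α} (h : R l r) (h' : R l' r')
    (heq : l ++ b = a ++ (l' ++ b')) :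
    LinkedBelow (StringStep R) μ (μ (l ++ b)) (r ++ b) (a ++ r' ++ b') := by
  rcases List.append_eq_append_iff.1 heq with ⟨m, rfl, rfl⟩ | ⟨l₂, rfl, heq'⟩
  · simpa using (linkedBelow_of_disjoint hμ hR m h h').context hμ [] b'
  rcases List.append_eq_append_iff.1 heq' with ⟨m, rfl, rfl⟩ | ⟨l₃, rfl, rfl⟩
  · simpa using (hincl l' r r' a m (by simpa using h) h').context hμ [] b
  rcases eq_or_ne a [] with rfl | ha
  · simpa using ((hincl l₂ r' r [] l₃ h' h).context hμ [] b').symm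
  rcases eq_or_ne l₂ [] with rfl | hl₂
  · simpa using (linkedBelow_of_disjoint hμ hR [] h h').context hμ [] b'
  rcases eq_or_ne l₃ [] with rfl | hl₃
  · simpa using (hincl l₂ r r' a [] (by simpa using h) (by simpa using h')).context hμ [] b'
  · simpa using (hover a l₂ l₃ r r' ha hl₂ hl₃ h h').context hμ [] b'

theorem linkedBelow_of_criticalPairs {x y z : List α} (hy : StringStep R x y)
    (hz : StringStep R x z) : LinkedBelow (StringStep R) μ (μ x) y z := by
  obtain ⟨a, b, l, r, h⟩ := hy
  generalize hx : a ++ l ++ b = x at hz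
  obtain ⟨a', b', l', r', h'⟩ := hz
  wlog hlen : a.length ≤ a'.length generalizing a b l r a' b' l' r' with H
  · exact hx ▸ (H a' b' l' r' h' a b l r h hx.symm (by omega)).symm
  have heq : a ++ (l ++ b) = a' ++ (l' ++ b') := by simpa using hx
  obtain ⟨k, rfl⟩ : a <+: a' :=
    List.prefix_of_prefix_length_le ⟨l ++ b, heq⟩ ⟨l' ++ b', rfl⟩ hlen
  rw [List.append_assoc, List.append_cancel_left_eq] at heq
  rw [← hx]
  simpa using (linkedBelow_of_append_eq hμ hR hincl hover h h' heq).context hμ a []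

end StringRewriting

/-! ### Flat equations -/

section Flat

variable {Op K : Type} {F : Signature Op} {Z : Set K}

/-- Flat ground terms over the constants in `Z`. -/
inductive FlatTerm (F : Signature Op) (Z : Set K) : Term Op K → Prop
  | const (c : K) (hc : c ∈ Z) : FlatTerm F Z (Term.const c)
  | app (g : Op) (u : List K) (har : F.ArityOK g u.length) (hu : ∀ c ∈ u, c ∈ Z) :
      FlatTerm F Z (Term.ofString g u)

/-- Two terms one of which is a constant, or which are headed by the same associative symbol. -/
inductive SameSort (F : Signature Op) : Term Op K → Term Op K → Prop
  | left (c : K) (t : Term Op K) : SameSort F (Term.const c) t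
  | right (t : Term Op K) (c : K) : SameSort F t (Term.const c)
  | app (f : Op) (us vs : List (Term Op K)) (hf : f ∈ F.assoc) :
      SameSort F (Term.app f us) (Term.app f vs)

/-- The equation `p ≈ q` is constant, `D`-flat or `A`-flat, with constants from `Z`. -/
structure FlatPair (F : Signature Op) (Z : Set K) (p q : Term Op K) : Prop where
  left : FlatTerm F Z p
  right : FlatTerm F Z q
  sameSort : SameSort F p q

/-- All equations in the set are constant, `D`-flat or `A`-flat, with constants from `Z`. -/
def FlatSet (F : Signature Op) (Z : Set K) (S : Set (Eqn Op K)) : Prop :=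
  ∀ p q : Term Op K, s(p, q) ∈ S → FlatPair F Z p q

theorem SameSort.symm {p q : Term Op K} (h : SameSort F p q) : SameSort F q p := by
  cases h with
  | left c t => exact .right _ _
  | right t c => exact .left _ _
  | app f us vs hf => exact .app _ _ _ hf

theorem SameSort.head_eq {g g' : Op} {us vs : List (Term Op K)}
    (h : SameSort F (Term.app g us) (Term.app g' vs)) : g' = g ∧ g ∈ F.assoc := by
  cases h with
  | app f us vs hf => exact ⟨rfl, hf⟩

theorem SameSort.change_args {g : Op} {us : List (Term Op K)} {t : Term Op K}
    (h : SameSort F (Term.app g us) t) (us' : List (Term Op K)) :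
    SameSort F (Term.app g us') t := by
  cases h with
  | right t c => exact .right _ _
  | app f us vs hf => exact .app _ _ _ hf

theorem FlatPair.symm {p q : Term Op K} (h : FlatPair F Z p q) : FlatPair F Z q p :=
  ⟨h.right, h.left, h.sameSort.symm⟩

theorem FlatSet.mono {S S' : Set (Eqn Op K)} (h : FlatSet F Z S) (h' : S' ⊆ S) :
    FlatSet F Z S' := fun p q hpq => h p q (h' hpq)

theorem flatSet_singleton {p q : Term Op K} (h : FlatPair F Z p q) :
    FlatSet F Z {s(p, q)} := by
  intro p' q' hpq
  rcases Sym2.eq_iff.1 (Set.mem_singleton_iff.1 hpq) with ⟨rfl, rfl⟩ | ⟨rfl, rfl⟩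
  · exact h
  · exact h.symm

theorem FlatSet.of_pair {p q p' q' : Term Op K} (h : FlatSet F Z {s(p, q), s(p', q')}) :
    FlatPair F Z p q ∧ FlatPair F Z p' q' :=
  ⟨h _ _ (.inl rfl), h _ _ (.inr rfl)⟩

theorem flatTerm_const {c : K} : FlatTerm (Op := Op) F Z (Term.const c) ↔ c ∈ Z := by
  refine ⟨fun h => ?_, fun h => .const c h⟩
  generalize ht : Term.const c = t at h
  cases h with
  | const c' hc => exact Term.const.inj ht ▸ hc
  | app => exact nomatch ht

theorem exists_ofString_of_flatTerm_app {g : Op} {ts : List (Term Op K)}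
    (h : FlatTerm F Z (Term.app g ts)) :
    ∃ u, Term.app g ts = Term.ofString g u ∧ F.ArityOK g u.length ∧ ∀ c ∈ u, c ∈ Z := by
  generalize ht : Term.app g ts = t at h
  cases h with
  | const => exact nomatch ht
  | app g' u har hu =>
    obtain rfl := (Term.app.inj ht).1
    exact ⟨u, rfl, har, hu⟩

theorem Term.ofString_injective (g : Op) : Function.Injective (Term.ofString (K := K) g) :=
  fun _ _ h => List.map_injective_iff.2 (fun _ _ => Term.const.inj) (Term.app.inj h).2

theorem flatTerm_ofString {g : Op} {u : List K} :
    FlatTerm F Z (Term.ofString g u) ↔ F.ArityOK g u.length ∧ ∀ c ∈ u, c ∈ Z := by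
  refine ⟨fun h => ?_, fun h => .app g u h.1 h.2⟩
  obtain ⟨v, hv, h⟩ := exists_ofString_of_flatTerm_app h
  exact Term.ofString_injective g hv ▸ h

theorem flatTerm_ofString_assoc {f : Op} (hf : f ∈ F.assoc) {u : List K} :
    FlatTerm F Z (Term.ofString f u) ↔ 2 ≤ u.length ∧ ∀ c ∈ u, c ∈ Z := by
  rw [flatTerm_ofString, Signature.arityOK_iff_two_le hf]

theorem Term.ofStringBar_of_two_le (f : Op) {u : List K} (h : 2 ≤ u.length) :
    Term.ofStringBar f u = Term.ofString f u := by
  match u, h with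
  | a :: b :: u, _ => rfl

theorem Term.ofStringBar_cases (f : Op) {u : List K} (hu : u ≠ []) :
    (∃ c, u = [c] ∧ Term.ofStringBar f u = Term.const c) ∨
      2 ≤ u.length ∧ Term.ofStringBar f u = Term.ofString f u := by
  match u, hu with
  | [c], _ => exact .inl ⟨c, rfl, rfl⟩
  | a :: b :: u, _ => exact .inr ⟨by simp, rfl⟩

theorem flatTerm_ofStringBar {f : Op} (hf : f ∈ F.assoc) {u : List K} (hu : u ≠ []) :
    FlatTerm F Z (Term.ofStringBar f u) ↔ ∀ c ∈ u, c ∈ Z := by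
  rcases Term.ofStringBar_cases f hu with ⟨c, rfl, h⟩ | ⟨hlen, h⟩
  · rw [h, flatTerm_const, List.forall_mem_singleton]
  · rw [h, flatTerm_ofString_assoc hf, and_iff_right hlen]

theorem sameSort_ofStringBar {f : Op} (hf : f ∈ F.assoc) {u v : List K} (hu : u ≠ [])
    (hv : v ≠ []) : SameSort F (Term.ofStringBar f u) (Term.ofStringBar f v) := by
  rcases Term.ofStringBar_cases f hu with ⟨c, -, h⟩ | ⟨-, h⟩
  · exact h ▸ .left _ _
  rcases Term.ofStringBar_cases f hv with ⟨c, -, h'⟩ | ⟨-, h'⟩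
  · exact h' ▸ .right _ _
  · exact h ▸ h' ▸ .app _ _ _ hf

theorem FlatPair.exists_ofStringBar {f : Op} (hf : f ∈ F.assoc) {us : List (Term Op K)}
    {t : Term Op K} (h : FlatPair F Z (Term.app f us) t) :
    ∃ v, v ≠ [] ∧ t = Term.ofStringBar f v := by
  cases h.right with
  | const c hc => exact ⟨[c], by simp, rfl⟩
  | app g v har hv =>
    obtain rfl := h.sameSort.head_eq.1
    have hlen := (Signature.arityOK_iff_two_le hf).1 har
    exact ⟨v, by rintro rfl; simp at hlen, (Term.ofStringBar_of_two_le g hlen).symm⟩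

theorem FlatTerm.replace_cases {s s' u v : Term Op K} (hs : FlatTerm F Z s)
    (h : Term.Replace u v s s') : (s = u ∧ s' = v) ∨
      ∃ g xs c ys, u = Term.const c ∧ s = Term.ofString g (xs ++ c :: ys) ∧
        s' = Term.app g (xs.map Term.const ++ v :: ys.map Term.const) := by
  cases h with
  | top => exact .inl ⟨rfl, rfl⟩
  | arg g xs ys a b h =>
    obtain ⟨w, hw, -⟩ := exists_ofString_of_flatTerm_app hs
    obtain ⟨w₁, w', rfl, rfl, h₂⟩ := List.map_eq_append_iff.1 (Term.app.inj hw).2.symm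
    obtain ⟨c, w₂, rfl, rfl, rfl⟩ := List.map_eq_cons_iff.1 h₂
    cases h with
    | top => exact .inr ⟨g, w₁, c, w₂, rfl, hw, rfl⟩

theorem FlatPair.deduce {f : Op} (hf : f ∈ F.assoc) {u₁ u₂ u₃ v w : List K} (h₁ : u₁ ≠ [])
    (h₃ : u₃ ≠ []) (hv : v ≠ []) (hw : w ≠ [])
    (h : FlatPair F Z (Term.ofString f (u₁ ++ u₂)) (Term.ofStringBar f w))
    (h' : FlatPair F Z (Term.ofString f (u₂ ++ u₃)) (Term.ofStringBar f v)) :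
    FlatPair F Z (Term.ofString f (u₁ ++ v)) (Term.ofString f (w ++ u₃)) := by
  have hu₁₂ := ((flatTerm_ofString_assoc hf).1 h.left).2
  have hu₂₃ := ((flatTerm_ofString_assoc hf).1 h'.left).2
  have hwZ := (flatTerm_ofStringBar hf hw).1 h.right
  have hvZ := (flatTerm_ofStringBar hf hv).1 h'.right
  rw [List.forall_mem_append] at hu₁₂ hu₂₃
  rw [← List.length_pos_iff] at h₁ h₃ hv hw
  refine ⟨(flatTerm_ofString_assoc hf).2 ⟨?_, List.forall_mem_append.2 ⟨hu₁₂.1, hvZ⟩⟩,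
    (flatTerm_ofString_assoc hf).2 ⟨?_, List.forall_mem_append.2 ⟨hwZ, hu₂₃.2⟩⟩, .app _ _ _ hf⟩
  · rw [List.length_append]; omega
  · rw [List.length_append]; omega

theorem FlatPair.simplify {f : Op} (hf : f ∈ F.assoc) {u₁ u₂ u₃ v : List K} {s : Term Op K}
    (hv : v ≠ []) (h : FlatPair F Z (Term.ofString f (u₁ ++ u₂ ++ u₃)) s)
    (h' : FlatTerm F Z (Term.ofStringBar f v)) :
    FlatPair F Z (Term.ofStringBar f (u₁ ++ v ++ u₃)) s := by
  have hne : u₁ ++ v ++ u₃ ≠ [] := by simp [hv]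
  obtain ⟨w, hw, rfl⟩ := h.exists_ofStringBar hf
  have hu := ((flatTerm_ofString_assoc hf).1 h.left).2
  rw [flatTerm_ofStringBar hf hv] at h'
  simp only [List.forall_mem_append] at hu
  refine ⟨(flatTerm_ofStringBar hf hne).2 ?_, h.right, sameSort_ofStringBar hf hne hw⟩
  simp only [List.forall_mem_append]
  exact ⟨⟨hu.1.1, h'⟩, hu.2⟩

theorem FlatPair.collapse {s s' t u : Term Op K} {d : K} (hd : d ∈ Z)
    (hs : Term.Replace u (Term.const d) s s') (h : FlatPair F Z s t) : FlatPair F Z s' t := by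
  rcases h.left.replace_cases hs with ⟨rfl, rfl⟩ | ⟨g, xs, c, ys, rfl, rfl, rfl⟩
  · exact ⟨.const d hd, h.right, .left _ _⟩
  · refine ⟨?_, h.right, h.sameSort.change_args _⟩
    have hxs := flatTerm_ofString.1 h.left
    rw [← List.map_cons, ← List.map_append, ← Term.ofString, flatTerm_ofString]
    simp only [List.forall_mem_append, List.forall_mem_cons] at hxs ⊢
    exact ⟨by simpa using hxs.1, hxs.2.1, hd, hxs.2.2.2⟩

variable [LinearOrder K]

theorem Inference.flatSet {P D N : Set (Eqn Op K)} (h : Inference F P D N)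
    (hP : FlatSet F Z P) : FlatSet F Z N := by
  cases h with
  | deduce f u₁ u₂ u₃ v w hf h₁ h₂ h₃ hv hw hgt₁ hgt₂ =>
    obtain ⟨h, h'⟩ := hP.of_pair
    exact flatSet_singleton (.deduce hf h₁ h₃ hv hw h h')
  | simplify f u₁ u₂ u₃ v s hf h₂ hv hgt htop =>
    obtain ⟨h, h'⟩ := hP.of_pair
    exact flatSet_singleton (h.simplify hf hv h'.right)
  | collapse s s' t u d hs hgt₁ hgt₂ hu htop =>
    obtain ⟨h, h'⟩ := hP.of_pair
    exact flatSet_singleton (h.collapse (flatTerm_const.1 h'.right) hs)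
  | compose t c d hgt₁ hgt₂ =>
    obtain ⟨h, h'⟩ := hP.of_pair
    exact flatSet_singleton ⟨h.left, h'.right, .right _ _⟩
  | delete s => exact fun _ _ h => h.elim

theorem IsDerivation.flatSet {S : ℕ → Set (Eqn Op K)} (hder : IsDerivation F S)
    (h₀ : FlatSet F Z (S 0)) (i : ℕ) : FlatSet F Z (S i) := by
  induction i with
  | zero => exact h₀
  | succ i ih =>
    rcases hder i with h | ⟨P, D, N, hinf, hP, h⟩
    · exact h ▸ ih
    · rw [h]
      rintro p q (hpq | hpq)
      · exact ih p q hpq.1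
      · exact hinf.flatSet (ih.mono hP) p q hpq

theorem FlatPair.termGT_trichotomy {p q : Term Op K} (h : FlatPair F Z p q) :
    TermGT F p q ∨ p = q ∨ TermGT F q p := by
  obtain ⟨hp, hq, h⟩ := h
  cases hp with
  | const c hc =>
    cases hq with
    | const d hd =>
      rcases lt_trichotomy c d with h | rfl | h
      · exact .inr (.inr (.const _ _ h))
      · exact .inr (.inl rfl)
      · exact .inl (.const _ _ h)
    | app g v har hv => exact .inr (.inr (.app _ _ _))
  | app g u har hu =>
    cases hq with
    | const d hd => exact .inl (.app _ _ _)
    | app g' v har' hv =>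
      obtain ⟨rfl, hf⟩ := SameSort.head_eq h
      rw [Signature.arityOK_iff_two_le hf] at har har'
      rcases lt_trichotomy u.length v.length with hl | hl | hl
      · exact .inr (.inr (.string _ _ _ hf har' har (.inl hl)))
      · rcases lt_trichotomy u v with h' | rfl | h'
        · exact .inr (.inr (.string _ _ _ hf har' har (.inr ⟨hl, h'⟩)))
        · exact .inr (.inl rfl)
        · exact .inl (.string _ _ _ hf har har' (.inr ⟨hl.symm, h'⟩))
      · exact .inl (.string _ _ _ hf har har' (.inl hl))

end Flat

/-! ### Words of flat terms -/

section FlatWords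

variable {Op K : Type} {F : Signature Op} {Z : Set K}

/-- The symbol `τ` may stand above an equation with the side `t`: if `t` is headed by an
associative symbol, that symbol is `τ`. -/
def Fits (F : Signature Op) (τ : Option Op) (t : Term Op K) : Prop :=
  ∀ f ∈ F.assoc, ∀ ts, t = Term.app f ts → τ = some f

theorem fits_const (τ : Option Op) (c : K) : Fits F τ (Term.const c) := by simp [Fits]

theorem fits_app {g : Op} {τ : Option Op} {ts : List (Term Op K)} :
    Fits F τ (Term.app g ts) ↔ (g ∈ F.assoc → τ = some g) := by
  refine ⟨fun h hg => h g hg ts rfl, fun h f hf us hfu => ?_⟩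
  obtain rfl := (Term.app.inj hfu).1
  exact h hf

theorem fits_ofString (f : Op) (u : List K) : Fits F (some f) (Term.ofString f u) :=
  fits_app.2 fun _ => rfl

theorem fits_ofStringBar (f : Op) {u : List K} (hu : u ≠ []) :
    Fits F (some f) (Term.ofStringBar f u) := by
  rcases Term.ofStringBar_cases f hu with ⟨c, -, h⟩ | ⟨-, h⟩
  · exact h ▸ fits_const _ _
  · exact h ▸ fits_ofString f u

theorem enc_ofString_assoc {f : Op} (hf : f ∈ F.assoc) (u : List K) :
    (Term.ofString f u).enc F (some f) = u.map (Letter.cst (some f)) := by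
  rw [Term.ofString, Term.enc_app_self hf, Term.flatMap_enc_const]

theorem enc_ofStringBar {f : Op} (hf : f ∈ F.assoc) {u : List K} (hu : u ≠ []) :
    (Term.ofStringBar f u).enc F (some f) = u.map (Letter.cst (some f)) := by
  rcases Term.ofStringBar_cases f hu with ⟨c, rfl, h⟩ | ⟨-, h⟩
  · rw [h, Term.enc_const, List.map_singleton]
  · rw [h, enc_ofString_assoc hf]

theorem enc_ofString {g : Op} {τ : Option Op} (hg : ¬ (g ∈ F.assoc ∧ τ = some g))
    (u : List K) : (Term.ofString g u).enc F τ =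
      Letter.opn τ g :: (u.map (Letter.cst (some g)) ++ [Letter.cls]) := by
  rw [Term.ofString, Term.enc_app hg, Term.flatMap_enc_const]

theorem exists_enc_ofString_eq (F : Signature Op) (g : Op) (τ : Option Op) :
    ∃ A B : List (Letter Op K), ∀ u : List K,
      (Term.ofString g u).enc F τ = A ++ u.map (Letter.cst (some g)) ++ B := by
  obtain ⟨A, B, h⟩ := Term.exists_enc_app_eq (K := K) F g τ
  exact ⟨A, B, fun u => by rw [Term.ofString, h, Term.flatMap_enc_const]⟩

theorem FlatTerm.two_le_length_enc {g : Op} {ts : List (Term Op K)}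
    (h : FlatTerm F Z (Term.app g ts)) (τ : Option Op) :
    2 ≤ ((Term.app g ts).enc F τ).length := by
  obtain ⟨u, hu, har, -⟩ := exists_ofString_of_flatTerm_app h
  rw [hu]
  by_cases hg : g ∈ F.assoc ∧ τ = some g
  · obtain ⟨hg, rfl⟩ := hg
    rw [enc_ofString_assoc hg, List.length_map]
    exact (Signature.arityOK_iff_two_le hg).1 har
  · simp [enc_ofString hg]

/-- The order of the constants in `Z`, read as an order of the letters that stand for them below
the same symbol. -/
inductive LetterLT [LT K] (Z : Set K) : Letter Op K → Letter Op K → Prop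
  | cst (τ : Option Op) (c d : K) (hc : c ∈ Z) (hd : d ∈ Z) (h : c < d) :
      LetterLT Z (Letter.cst τ c) (Letter.cst τ d)

theorem lex_letterLT_map [LT K] {u v : List K} (hu : ∀ c ∈ u, c ∈ Z) (hv : ∀ c ∈ v, c ∈ Z)
    (h : List.Lex (· < ·) u v) (τ : Option Op) :
    List.Lex (LetterLT Z) (u.map (Letter.cst τ)) (v.map (Letter.cst τ)) := by
  induction h with
  | nil => exact .nil
  | rel h => exact .rel (.cst _ _ _ (hu _ (by simp)) (hv _ (by simp)) h)
  | cons _ ih =>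
    rw [List.forall_mem_cons] at hu hv
    exact .cons (ih hu.2 hv.2)

theorem TermGT.weight_lt [LinearOrder K] {μ : List (Letter Op K) → ℕ}
    (hμ : LexWeight (LetterLT Z) μ) {p q : Term Op K} (h : TermGT F p q)
    (hp : FlatTerm F Z p) (hq : FlatTerm F Z q) {τ : Option Op} (hfit : Fits F τ p) :
    μ (q.enc F τ) < μ (p.enc F τ) := by
  cases h with
  | const c d h =>
    rw [flatTerm_const] at hp hq
    rw [Term.enc_const, Term.enc_const]
    exact hμ.lt_of_lex rfl (.rel (.cst _ _ _ hq hp h))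
  | app g ts c =>
    refine hμ.lt_of_length_lt ?_
    rw [Term.enc_const]
    exact hp.two_le_length_enc τ
  | string f u v hf hu hv h =>
    obtain rfl : τ = some f := fits_app.1 hfit hf
    rw [flatTerm_ofString] at hp hq
    rw [enc_ofString_assoc hf, enc_ofString_assoc hf]
    rcases h with h | ⟨hlen, h⟩
    · exact hμ.lt_of_length_lt (by simpa using h)
    · exact hμ.lt_of_lex (by simpa using hlen) (lex_letterLT_map hq.2 hp.2 h _)

end FlatWords

/-! ### The string rewriting system of a set of flat rules -/

section WordRules

variable {Op K : Type} {F : Signature Op} {Z : Set K}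

/-- The rules on words that correspond to the flat rules in `R`, and those that remove the brackets
around a single constant.  The latter turn a word `f(c)`, which rewriting in the argument string of
an associative `f` may produce although it encodes no term, into `c`. -/
inductive WordRule (F : Signature Op) (Z : Set K) (R : Set (Term Op K × Term Op K)) :
    List (Letter Op K) → List (Letter Op K) → Prop
  | const (c d : K) (τ : Option Op) (h : (Term.const c, Term.const d) ∈ R) :
      WordRule F Z R [Letter.cst τ c] [Letter.cst τ d]
  | app (g : Op) (u : List K) (d : K) (τ : Option Op) (hg : g ∉ F.assoc) (hu : u ≠ [])
      (h : (Term.ofString g u, Term.const d) ∈ R) :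
      WordRule F Z R (Letter.opn τ g :: (u.map (Letter.cst (some g)) ++ [Letter.cls]))
        [Letter.cst τ d]
  | string (f : Op) (u v : List K) (hf : f ∈ F.assoc) (hu : 2 ≤ u.length) (hv : v ≠ [])
      (h : (Term.ofString f u, Term.ofStringBar f v) ∈ R) :
      WordRule F Z R (u.map (Letter.cst (some f))) (v.map (Letter.cst (some f)))
  | bracket (f : Op) (c : K) (τ : Option Op) (hf : f ∈ F.assoc) (hc : c ∈ Z) :
      WordRule F Z R (Letter.opn τ f :: ([c].map (Letter.cst (some f)) ++ [Letter.cls]))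
        [Letter.cst τ c]

theorem FlatTerm.string_ne_nil {g : Op} {u : List K} (h : FlatTerm F Z (Term.ofString g u)) :
    u ≠ [] := by
  rintro rfl
  rcases (flatTerm_ofString.1 h).1 with ⟨-, h⟩ | ⟨-, h⟩
  · simp at h
  · exact (F.arity_pos g).ne h

variable [LinearOrder K] {R : Set (Eqn Op K)}

theorem FlatTerm.wordRule {p q : Term Op K} (hp : FlatTerm F Z p) (h : (p, q) ∈ orient F R)
    {τ : Option Op} (hfit : Fits F τ p) :
    WordRule F Z (orient F R) (p.enc F τ) (q.enc F τ) := by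
  have hgt : TermGT F p q := h.2
  cases hgt with
  | const c d _ =>
    rw [Term.enc_const, Term.enc_const]
    exact .const c d τ h
  | string f u v hf hu hv _ =>
    obtain rfl : τ = some f := fits_app.1 hfit hf
    rw [enc_ofString_assoc hf, enc_ofString_assoc hf]
    rw [← Term.ofStringBar_of_two_le f hv] at h
    exact .string f u v hf hu (by rintro rfl; simp at hv) h
  | app g ts c =>
    obtain ⟨u, hu, har, -⟩ := exists_ofString_of_flatTerm_app hp
    rw [hu] at h hp ⊢
    rw [Term.enc_const]
    by_cases hg : g ∈ F.assoc
    · obtain rfl : τ = some g := fits_app.1 hfit hg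
      rw [enc_ofString_assoc hg]
      exact .string g u [c] hg ((Signature.arityOK_iff_two_le hg).1 har) (by simp) h
    · rw [enc_ofString fun h => hg h.1]
      exact .app g u c τ hg hp.string_ne_nil h

theorem WordRule.weight_lt {μ : List (Letter Op K) → ℕ} (hμ : LexWeight (LetterLT Z) μ)
    (hR : FlatSet F Z R) {l r : List (Letter Op K)} (h : WordRule F Z (orient F R) l r) :
    μ r < μ l := by
  cases h with
  | const c d τ h =>
    obtain ⟨hc, hd, -⟩ := hR _ _ h.1
    simpa only [Term.enc_const] using h.2.weight_lt hμ hc hd (fits_const τ c)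
  | string f u v hf hu hv h =>
    obtain ⟨hu, hv', -⟩ := hR _ _ h.1
    simpa only [enc_ofString_assoc hf, enc_ofStringBar hf hv] using
      h.2.weight_lt hμ hu hv' (fits_ofString f u)
  | app | bracket => exact hμ.lt_of_length_lt (by simp)

end WordRules

/-! ### Proofs of equations from the persisting ones -/

section BoundedProofs

variable {Op K : Type} {F : Signature Op} {Z : Set K} {μ : List (Letter Op K) → ℕ}

/-- The weight of an equation below the symbol `τ`.  Sums of two powers of 2 refine the multiset
ordering of the pairs of exponents. -/
noncomputable def eqnWeight (F : Signature Op) (μ : List (Letter Op K) → ℕ) (τ : Option Op) :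
    Eqn Op K → ℕ :=
  Sym2.lift ⟨fun p q => 2 ^ μ (p.enc F τ) + 2 ^ μ (q.enc F τ), fun _ _ => add_comm _ _⟩

theorem eqnWeight_mk (p q : Term Op K) (τ : Option Op) :
    eqnWeight F μ τ s(p, q) = 2 ^ μ (p.enc F τ) + 2 ^ μ (q.enc F τ) := rfl

theorem eqnWeight_lt_left {p p' : Term Op K} (q : Term Op K) {τ : Option Op}
    (h : μ (p'.enc F τ) < μ (p.enc F τ)) :
    eqnWeight F μ τ s(p', q) < eqnWeight F μ τ s(p, q) := by
  rw [eqnWeight_mk, eqnWeight_mk]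
  gcongr
  exact one_lt_two

theorem eqnWeight_lt_right (p : Term Op K) {q q' : Term Op K} {τ : Option Op}
    (h : μ (q'.enc F τ) < μ (q.enc F τ)) :
    eqnWeight F μ τ s(p, q') < eqnWeight F μ τ s(p, q) := by
  rw [eqnWeight_mk, eqnWeight_mk]
  gcongr
  exact one_lt_two

theorem eqnWeight_lt_of_lt {p q p' q' : Term Op K} {τ τ' : Option Op}
    (hp : μ (p'.enc F τ') < μ (p.enc F τ)) (hq : μ (q'.enc F τ') < μ (p.enc F τ)) :
    eqnWeight F μ τ' s(p', q') < eqnWeight F μ τ s(p, q) := by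
  have double {m n : ℕ} (h : m < n) : 2 * 2 ^ m ≤ 2 ^ n :=
    pow_succ' 2 m ▸ Nat.pow_le_pow_right two_pos h
  have := double hp
  have := double hq
  have : 0 < 2 ^ μ (q.enc F τ) := by positivity
  rw [eqnWeight_mk, eqnWeight_mk]
  omega

variable [LinearOrder K] {R : Set (Eqn Op K)}

/-- The words of the sides of the equation `e` are linked, modulo the rules obtained from `R`, by
words that are not heavier than both of them. -/
def HasProof (F : Signature Op) (Z : Set K) (μ : List (Letter Op K) → ℕ) (R : Set (Eqn Op K))
    (τ : Option Op) (e : Eqn Op K) : Prop :=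
  ∀ p ∈ e, ∀ q ∈ e,
    BoundedProof (StringStep (WordRule F Z (orient F R))) μ (p.enc F τ) (q.enc F τ)

theorem hasProof_mk {p q : Term Op K} {τ : Option Op} : HasProof F Z μ R τ s(p, q) ↔
    BoundedProof (StringStep (WordRule F Z (orient F R))) μ (p.enc F τ) (q.enc F τ) := by
  refine ⟨fun h => h p (Sym2.mem_mk_left p q) q (Sym2.mem_mk_right p q), fun h => ?_⟩
  simp only [HasProof, Sym2.mem_iff, forall_eq_or_imp, forall_eq]
  exact ⟨⟨.refl _, h⟩, h.symm, .refl _⟩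

theorem HasProof.of_mem (hR : FlatSet F Z R) {e : Eqn Op K} (he : e ∈ R) {τ : Option Op}
    (hfit : ∀ t ∈ e, Fits F τ t) : HasProof F Z μ R τ e := by
  obtain ⟨p, q⟩ := e
  change HasProof F Z μ R τ s(p, q)
  rw [hasProof_mk]
  have hpq := hR p q he
  rcases hpq.termGT_trichotomy with h | rfl | h
  · exact .of_rel (.of_rule (hpq.left.wordRule ⟨he, h⟩ (hfit p (by simp))))
  · exact .refl _
  · exact (BoundedProof.of_rel (.of_rule
      (hpq.right.wordRule ⟨Sym2.eq_swap ▸ he, h⟩ (hfit q (by simp))))).symm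

variable (hμ : LexWeight (LetterLT Z) μ)
include hμ

theorem HasProof.simplify {f : Op} (hf : f ∈ F.assoc) {u₁ u₂ u₃ v : List K} {s : Term Op K}
    (hv : v ≠ []) (h : FlatPair F Z (Term.ofString f (u₁ ++ u₂ ++ u₃)) s)
    (h' : FlatPair F Z (Term.ofString f u₂) (Term.ofStringBar f v))
    (hgt : TermGT F (Term.ofString f u₂) (Term.ofStringBar f v))
    (htop : u₁ ++ u₃ = [] → TermGT F s (Term.ofStringBar f v)) (hs : Fits F (some f) s)
    (ih₁ : eqnWeight F μ (some f) s(Term.ofString f u₂, Term.ofStringBar f v) <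
        eqnWeight F μ (some f) s(Term.ofString f (u₁ ++ u₂ ++ u₃), s) →
      HasProof F Z μ R (some f) s(Term.ofString f u₂, Term.ofStringBar f v))
    (ih₂ : eqnWeight F μ (some f) s(Term.ofStringBar f (u₁ ++ v ++ u₃), s) <
        eqnWeight F μ (some f) s(Term.ofString f (u₁ ++ u₂ ++ u₃), s) →
      HasProof F Z μ R (some f) s(Term.ofStringBar f (u₁ ++ v ++ u₃), s)) :
    HasProof F Z μ R (some f) s(Term.ofString f (u₁ ++ u₂ ++ u₃), s) := by
  have hne : u₁ ++ v ++ u₃ ≠ [] := by simp [hv]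
  have hvu := hgt.weight_lt hμ h'.left h'.right (fits_ofString f u₂)
  have premise := ih₁ <| by
    by_cases htop' : u₁ ++ u₃ = []
    · obtain ⟨rfl, rfl⟩ := List.append_eq_nil_iff.1 htop'
      rw [List.nil_append, List.append_nil]
      exact eqnWeight_lt_right _ ((htop rfl).weight_lt hμ h.right h'.right hs)
    · have hu₂ : μ ((Term.ofString f u₂).enc F (some f)) <
          μ ((Term.ofString f (u₁ ++ u₂ ++ u₃)).enc F (some f)) := by
        rw [enc_ofString_assoc hf, enc_ofString_assoc hf]
        refine hμ.lt_of_length_lt ?_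
        have := List.length_pos_iff.2 htop'
        simp only [List.length_map, List.length_append] at this ⊢
        omega
      exact eqnWeight_lt_of_lt hu₂ (hvu.trans hu₂)
  simp only [hasProof_mk, enc_ofString_assoc hf, enc_ofStringBar hf hv, enc_ofStringBar hf hne,
    List.map_append] at hvu premise ih₂ ⊢
  have hlt := hμ.context_lt (u₁.map (Letter.cst (some f))) (u₃.map (Letter.cst (some f))) hvu
  refine (premise.context hμ.context_le _ _).trans (ih₂ ?_) (.inl hlt.le)
  refine eqnWeight_lt_left s ?_
  simpa only [enc_ofString_assoc hf, enc_ofStringBar hf hne, List.map_append] using hlt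

theorem HasProof.collapse {s s' t u : Term Op K} {d : K} {τ : Option Op}
    (hs : Term.Replace u (Term.const d) s s') (h : FlatPair F Z s t)
    (h' : FlatPair F Z u (Term.const d)) (hgt : TermGT F u (Term.const d))
    (hu : ∀ τ', Fits F τ' u) (htop : s = u → TermGT F t (Term.const d)) (hsτ : Fits F τ s)
    (ht : Fits F τ t)
    (ih₁ : ∀ τ', eqnWeight F μ τ' s(u, Term.const d) < eqnWeight F μ τ s(s, t) →
      HasProof F Z μ R τ' s(u, Term.const d))
    (ih₂ : Fits F τ s' → eqnWeight F μ τ s(s', t) < eqnWeight F μ τ s(s, t) →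
      HasProof F Z μ R τ s(s', t)) :
    HasProof F Z μ R τ s(s, t) := by
  have hdu (τ' : Option Op) : μ ((Term.const d).enc F τ') < μ (u.enc F τ') :=
    hgt.weight_lt hμ h'.left h'.right (hu τ')
  simp only [hasProof_mk] at ih₁ ih₂ ⊢
  rcases h.left.replace_cases hs with ⟨rfl, rfl⟩ | ⟨g, xs, c, ys, rfl, rfl, rfl⟩
  · have hdt := (htop rfl).weight_lt hμ h.right h'.right ht
    exact (ih₁ τ (eqnWeight_lt_right s hdt)).trans
      (ih₂ (fits_const τ d) (eqnWeight_lt_left t (hdu τ))) (.inl (hdu τ).le)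
  rw [← List.map_cons, ← List.map_append, ← Term.ofString] at ih₂
  obtain ⟨A, B, hg⟩ := exists_enc_ofString_eq (K := K) F g τ
  have enc_eq (c : K) : (Term.ofString g (xs ++ c :: ys)).enc F τ =
      (A ++ xs.map (Letter.cst (some g))) ++ (Term.const c).enc F (some g) ++
        (ys.map (Letter.cst (some g)) ++ B) := by
    simp [hg, Term.enc_const]
  have hcs : μ ((Term.const c).enc F (some g)) <
      μ ((Term.ofString g (xs ++ c :: ys)).enc F τ) := by
    refine hμ.lt_of_length_lt ?_
    rw [Term.enc_const]
    exact h.left.two_le_length_enc τ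
  have hlt : μ ((Term.ofString g (xs ++ d :: ys)).enc F τ) <
      μ ((Term.ofString g (xs ++ c :: ys)).enc F τ) := by
    rw [enc_eq, enc_eq]
    exact hμ.context_lt _ _ (hdu (some g))
  have argument := ih₁ (some g) (eqnWeight_lt_of_lt hcs ((hdu _).trans hcs))
  refine .trans ?_ (ih₂ (fits_app.2 (fits_app.1 hsτ)) (eqnWeight_lt_left t hlt)) (.inl hlt.le)
  rw [enc_eq, enc_eq]
  exact argument.context hμ.context_le _ _

theorem HasProof.compose {t : Term Op K} {c d : K} {τ : Option Op}
    (h : FlatPair F Z t (Term.const c)) (h' : FlatPair F Z (Term.const c) (Term.const d))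
    (hgt₁ : TermGT F t (Term.const c)) (hgt₂ : TermGT F (Term.const c : Term Op K) (Term.const d))
    (ht : Fits F τ t)
    (ih₁ : eqnWeight F μ τ s(Term.const c, Term.const d) < eqnWeight F μ τ s(t, Term.const c) →
      HasProof F Z μ R τ s(Term.const c, Term.const d))
    (ih₂ : eqnWeight F μ τ s(t, Term.const d) < eqnWeight F μ τ s(t, Term.const c) →
      HasProof F Z μ R τ s(t, Term.const d)) :
    HasProof F Z μ R τ s(t, Term.const c) := by
  have hct := hgt₁.weight_lt hμ h.left h.right ht
  have hdc := hgt₂.weight_lt hμ h'.left h'.right (fits_const τ c)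
  simp only [hasProof_mk] at ih₁ ih₂ ⊢
  exact (ih₂ (eqnWeight_lt_right t hdc)).trans
    (ih₁ (eqnWeight_lt_of_lt hct (hdc.trans hct))).symm (.inr hdc.le)

theorem Inference.hasProof {P D N : Set (Eqn Op K)} (hinf : Inference F P D N)
    (hP : FlatSet F Z P) {e : Eqn Op K} {τ : Option Op} (he : e ∈ D)
    (hfit : ∀ t ∈ e, Fits F τ t)
    (ih : ∀ e' ∈ P ∪ N, ∀ τ', (∀ t ∈ e', Fits F τ' t) →
      eqnWeight F μ τ' e' < eqnWeight F μ τ e → HasProof F Z μ R τ' e') :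
    HasProof F Z μ R τ e := by
  have ih_pair {p q : Term Op K} (hpq : s(p, q) ∈ P ∪ N) {τ' : Option Op} (hp : Fits F τ' p)
      (hq : Fits F τ' q) := ih _ hpq τ' (by simp [hp, hq])
  cases hinf with
  | deduce => exact he.elim
  | simplify f u₁ u₂ u₃ v s hf h₂ hv hgt htop =>
    obtain rfl := he
    obtain ⟨h, h'⟩ := hP.of_pair
    obtain rfl : τ = some f := fits_app.1 (hfit _ (Sym2.mem_mk_left _ _)) hf
    have hs := hfit _ (Sym2.mem_mk_right _ _)
    exact .simplify hμ hf hv h h' hgt htop hs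
      (ih_pair (by simp) (fits_ofString f u₂) (fits_ofStringBar f hv))
      (ih_pair (by simp) (fits_ofStringBar f (by simp [hv])) hs)
  | collapse s s' t u d hs hgt₁ hgt₂ hu htop =>
    obtain rfl := he
    obtain ⟨h, h'⟩ := hP.of_pair
    have hfu (τ' : Option Op) : Fits F τ' u := fun f hf ts h => absurd h (hu f hf ts)
    have ht := hfit t (Sym2.mem_mk_right _ _)
    exact .collapse hμ hs h h' hgt₂ hfu htop (hfit s (Sym2.mem_mk_left _ _)) ht
      (fun τ' => ih_pair (by simp) (hfu τ') (fits_const τ' d))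
      fun hs' => ih_pair (by simp) hs' ht
  | compose t c d hgt₁ hgt₂ =>
    obtain rfl := he
    obtain ⟨h, h'⟩ := hP.of_pair
    have ht := hfit t (Sym2.mem_mk_left _ _)
    exact .compose hμ h h' hgt₁ hgt₂ ht
      (ih_pair (by simp) (fits_const τ c) (fits_const τ d))
      (ih_pair (by simp) ht (fits_const τ d))
  | delete s =>
    obtain rfl := he
    exact hasProof_mk.2 (.refl _)

end BoundedProofs

section Persisting

variable {Op K : Type} {F : Signature Op} {Z : Set K} {S : ℕ → Set (Eqn Op K)}

theorem persisting_flatSet (hflat : ∀ i, FlatSet F Z (S i)) : FlatSet F Z (persisting S) := by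
  rintro p q ⟨i, hi⟩
  exact hflat i p q (hi i le_rfl)

theorem exists_pair_subset {e e' : Eqn Op K} (he : e ∈ persisting S)
    (he' : e' ∈ persisting S) : ∃ i, ∀ j ≥ i, ({e, e'} : Set (Eqn Op K)) ⊆ S j := by
  obtain ⟨i, hi⟩ := he
  obtain ⟨i', hi'⟩ := he'
  exact ⟨max i i', fun j hj => Set.insert_subset (hi j (le_of_max_le_left hj))
    (Set.singleton_subset_iff.2 (hi' j (le_of_max_le_right hj)))⟩

theorem exists_deleted_of_notMem_persisting {e : Eqn Op K} {i : ℕ} (he : e ∈ S i)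
    (h : e ∉ persisting S) : ∃ j, e ∈ S j ∧ e ∉ S (j + 1) := by
  by_contra! hcon
  exact h ⟨i, fun j hj => Nat.le_induction he (fun j _ => hcon j) j hj⟩

variable [LinearOrder K]

theorem IsDerivation.hasProof {μ : List (Letter Op K) → ℕ} (hμ : LexWeight (LetterLT Z) μ)
    (hder : IsDerivation F S) (hflat : ∀ i, FlatSet F Z (S i)) {e : Eqn Op K} {i : ℕ}
    (he : e ∈ S i) {τ : Option Op} (hfit : ∀ t ∈ e, Fits F τ t) :
    HasProof F Z μ (persisting S) τ e := by
  induction hn : eqnWeight F μ τ e using Nat.strong_induction_on generalizing e τ i with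
  | _ n ih =>
    subst hn
    by_cases hpers : e ∈ persisting S
    · exact .of_mem (persisting_flatSet hflat) hpers hfit
    obtain ⟨j, hj, hj'⟩ := exists_deleted_of_notMem_persisting he hpers
    rcases hder j with h | ⟨P, D, N, hinf, hP, h⟩
    · exact absurd (h ▸ hj) hj'
    · have hD : e ∈ D := by_contra fun hD => hj' (h ▸ .inl ⟨hj, hD⟩)
      refine hinf.hasProof hμ ((hflat j).mono hP) hD hfit ?_
      rintro e' (he' | he') τ' hfit' hlt
      · exact ih _ hlt (hP he') hfit' rfl
      · exact ih _ hlt (i := j + 1) (h ▸ .inr he') hfit' rfl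

theorem IsFair.exists_mem (hfair : IsFair F S) {P D N : Set (Eqn Op K)}
    (hinf : Inference F P D N) (hP : ∃ i, ∀ j ≥ i, P ⊆ S j) {e : Eqn Op K} (he : e ∈ N) :
    ∃ j, e ∈ S j := by
  obtain ⟨i, hi⟩ := hP
  by_cases! h : ∃ j ≥ i, S j \ D ∪ N = S j
  · obtain ⟨j, -, h⟩ := h
    exact ⟨j, h ▸ .inr he⟩
  · obtain ⟨j, -, h'⟩ := hfair P D N hinf ⟨i, fun j hj => ⟨hi j hj, h j hj⟩⟩
    exact ⟨j + 1, h' ▸ .inr he⟩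

end Persisting

/-! ### Critical pairs of the persisting rules -/

section Infixes

variable {Op K : Type}

theorem Letter.cst_injective (σ : Option Op) :
    Function.Injective (Letter.cst σ : K → Letter Op K) := fun c d h => by simpa using h

theorem Letter.map_cst_inj {σ σ' : Option Op} {u u' : List K} (hu : u ≠ []) :
    u.map (Letter.cst σ) = u'.map (Letter.cst σ') ↔ σ = σ' ∧ u = u' := by
  refine ⟨fun h => ?_, by rintro ⟨rfl, rfl⟩; rfl⟩
  obtain ⟨c, u, rfl⟩ := List.exists_cons_of_ne_nil hu
  obtain ⟨c', u', rfl⟩ := List.exists_cons_of_ne_nil (l := u') (by rintro rfl; simp at h)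
  obtain rfl : σ = σ' := by
    simp only [List.map_cons, List.cons.injEq, Option.some.injEq, Prod.mk.injEq] at h
    exact h.1.1
  exact ⟨rfl, (Letter.cst_injective σ).list_map h⟩

theorem string_eq_append {σ σ' : Option Op} {u u' : List K} {a b : List (Letter Op K)}
    (hu' : u' ≠ []) (h : u.map (Letter.cst σ) = a ++ u'.map (Letter.cst σ') ++ b) :
    σ = σ' ∧ ∃ u₁ u₃, u = u₁ ++ u' ++ u₃ ∧ a = u₁.map (Letter.cst σ) ∧
      b = u₃.map (Letter.cst σ) := by
  obtain ⟨w, u₃, rfl, h₁, rfl⟩ := List.map_eq_append_iff.1 h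
  obtain ⟨u₁, u₂, rfl, rfl, h₂⟩ := List.map_eq_append_iff.1 h₁
  obtain ⟨rfl, rfl⟩ := (Letter.map_cst_inj hu').1 h₂.symm
  exact ⟨rfl, u₁, u₃, rfl, rfl, rfl⟩

theorem opn_notMem_string {σ τ : Option Op} {u : List K} {g : Op} :
    Letter.opn τ g ∉ u.map (Letter.cst σ) := by simp

theorem bracket_eq_append_string {σ σ' τ : Option Op} {g : Op} {u u' : List K}
    {a b : List (Letter Op K)} (hu' : u' ≠ [])
    (h : Letter.opn τ g :: (u.map (Letter.cst σ) ++ [Letter.cls]) =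
      a ++ u'.map (Letter.cst σ') ++ b) :
    σ = σ' ∧ ∃ u₁ u₃, u = u₁ ++ u' ++ u₃ ∧ a = Letter.opn τ g :: u₁.map (Letter.cst σ) ∧
      b = u₃.map (Letter.cst σ) ++ [Letter.cls] := by
  rcases a with _ | ⟨x, a⟩
  · obtain ⟨c, u', rfl⟩ := List.exists_cons_of_ne_nil hu'
    simp at h
  rw [List.cons_append, List.cons_append] at h
  obtain ⟨rfl, htail⟩ := List.cons.inj h
  rcases List.eq_nil_or_concat b with rfl | ⟨b, y, rfl⟩
  · obtain ⟨u', y, rfl⟩ := (List.eq_nil_or_concat u').resolve_left hu'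
    rw [List.concat_eq_append, List.map_append, List.append_nil, ← List.append_assoc] at htail
    have hlast := (List.append_inj' htail rfl).2
    simp at hlast
  · rw [List.concat_eq_append, ← List.append_assoc] at htail
    obtain ⟨hinit, hlast⟩ := List.append_inj' htail rfl
    obtain ⟨rfl, u₁, u₃, rfl, rfl, rfl⟩ := string_eq_append hu' hinit
    exact ⟨rfl, u₁, u₃, rfl, rfl, by rw [List.concat_eq_append, hlast]⟩

theorem bracket_eq_append_bracket {σ σ' τ τ' : Option Op} {g g' : Op} {u u' : List K}
    {a b : List (Letter Op K)}
    (h : Letter.opn τ g :: (u.map (Letter.cst σ) ++ [Letter.cls]) =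
      a ++ Letter.opn τ' g' :: (u'.map (Letter.cst σ') ++ [Letter.cls]) ++ b) :
    a = [] ∧ b = [] ∧ τ = τ' ∧ g = g' ∧ u.map (Letter.cst σ) = u'.map (Letter.cst σ') := by
  rcases a with _ | ⟨x, a⟩
  · simp only [List.nil_append, List.cons_append, List.cons.injEq, Option.some.injEq,
      Prod.mk.injEq, Sum.inr.injEq] at h
    obtain ⟨⟨rfl, rfl⟩, h⟩ := h
    rcases List.eq_nil_or_concat b with rfl | ⟨b, y, rfl⟩
    · rw [List.append_nil] at h
      exact ⟨rfl, rfl, rfl, rfl, (List.append_inj' h rfl).1⟩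
    · rw [List.concat_eq_append, ← List.append_assoc] at h
      have hcls : (Letter.cls : Letter Op K) ∈ u.map (Letter.cst σ) := by
        rw [(List.append_inj' h rfl).1]
        simp
      simp at hcls
  · have hopn : Letter.opn τ' g' ∈ u.map (Letter.cst σ) ++ [Letter.cls] := by
      rw [(List.cons.inj h).2]
      simp
    simp at hopn

theorem singleton_eq_append {α : Type} {x : α} {a l b : List α} (hl : l ≠ [])
    (h : [x] = a ++ l ++ b) : a = [] ∧ b = [] ∧ l = [x] := by
  have hlen := congrArg List.length h
  have := List.length_pos_iff.2 hl
  simp only [List.length_append, List.length_singleton] at hlen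
  obtain rfl := List.eq_nil_of_length_eq_zero (show a.length = 0 by omega)
  obtain rfl := List.eq_nil_of_length_eq_zero (show b.length = 0 by omega)
  exact ⟨rfl, rfl, by simpa using h.symm⟩

variable {F : Signature Op} {Z : Set K} {R : Set (Term Op K × Term Op K)}

theorem WordRule.lhs_cases {l r : List (Letter Op K)} (h : WordRule F Z R l r) :
    (∃ (σ : Option Op) (u : List K), l = u.map (Letter.cst σ)) ∨
      ∃ (τ : Option Op) (g : Op) (σ : Option Op) (u : List K),
        l = Letter.opn τ g :: (u.map (Letter.cst σ) ++ [Letter.cls]) := by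
  cases h with
  | const c d τ h => exact .inl ⟨τ, [c], rfl⟩
  | string f u v hf hu hv h => exact .inl ⟨_, u, rfl⟩
  | app | bracket => exact .inr ⟨_, _, _, _, rfl⟩

theorem WordRule.string_cases {σ : Option Op} {u : List K} {r : List (Letter Op K)}
    (h : WordRule F Z R (u.map (Letter.cst σ)) r) (hu : 2 ≤ u.length) :
    ∃ f v, f ∈ F.assoc ∧ σ = some f ∧ v ≠ [] ∧ r = v.map (Letter.cst (some f)) ∧
      (Term.ofString f u, Term.ofStringBar f v) ∈ R := by
  generalize hl : u.map (Letter.cst σ) = l at h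
  cases h with
  | const =>
    have := congrArg List.length hl
    simp only [List.length_map, List.length_singleton] at this
    omega
  | string f w v hf hw hv h =>
    obtain ⟨rfl, rfl⟩ := (Letter.map_cst_inj (by rintro rfl; simp at hu)).1 hl
    exact ⟨f, v, hf, rfl, hv, rfl, h⟩
  | app | bracket => exact absurd (hl ▸ List.mem_cons_self) opn_notMem_string

theorem WordRule.eq_of_append_bracket {f : Op} {c : K} {τ : Option Op}
    {a b r : List (Letter Op K)} (h : WordRule F Z R
      (a ++ Letter.opn τ f :: ([c].map (Letter.cst (some f)) ++ [Letter.cls]) ++ b) r)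
    (hf : f ∈ F.assoc) :
    r = a ++ [Letter.cst τ c] ++ b := by
  generalize hl : a ++ Letter.opn τ f :: ([c].map (Letter.cst (some f)) ++ [Letter.cls]) ++ b = l
    at h
  symm at hl
  cases h with
  | const c' d' τ' h =>
    obtain ⟨-, -, hc⟩ := singleton_eq_append (by simp) hl
    simp at hc
  | app g u d τ' hg hu h =>
    obtain ⟨-, -, -, rfl, -⟩ := bracket_eq_append_bracket hl
    exact absurd hf hg
  | string f' u v hf' hu hv h =>
    exact absurd (hl ▸ by simp) (opn_notMem_string (σ := some f') (τ := τ) (u := u) (g := f))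
  | bracket f' c' τ' hf' hc' =>
    obtain ⟨rfl, rfl, rfl, rfl, hcc⟩ := bracket_eq_append_bracket hl
    obtain rfl := List.singleton_inj.1 ((Letter.cst_injective _).list_map hcc)
    rfl

theorem WordRule.exists_string_of_overlap {l₁ l₂ l₃ r r' : List (Letter Op K)} (h₁ : l₁ ≠ [])
    (h₂ : l₂ ≠ []) (h : WordRule F Z R (l₁ ++ l₂) r) (h' : WordRule F Z R (l₂ ++ l₃) r') :
    ∃ (σ : Option Op) (u₁ u₂ u₃ : List K), l₁ = u₁.map (Letter.cst σ) ∧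
      l₂ = u₂.map (Letter.cst σ) ∧ l₃ = u₃.map (Letter.cst σ) := by
  rcases h'.lhs_cases with ⟨σ, u, hu⟩ | ⟨τ, g, σ, u, hu⟩
  · obtain ⟨u₂, u₃, rfl, rfl, rfl⟩ := List.map_eq_append_iff.1 hu.symm
    have hu₂ : u₂ ≠ [] := by simpa using h₂
    rcases h.lhs_cases with ⟨σ', w, hw⟩ | ⟨τ', g, σ', w, hw⟩
    · obtain ⟨rfl, u₁, -, -, rfl, -⟩ := string_eq_append (b := []) hu₂ (by simpa using hw.symm)
      exact ⟨_, u₁, u₂, u₃, rfl, rfl, rfl⟩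
    · obtain ⟨-, -, w₃, -, -, hb⟩ :=
        bracket_eq_append_string (b := []) hu₂ (by simpa using hw.symm)
      simp at hb
  · obtain ⟨x, l₁, rfl⟩ := List.exists_cons_of_ne_nil h₁
    obtain ⟨y, l₂, rfl⟩ := List.exists_cons_of_ne_nil h₂
    obtain ⟨rfl, -⟩ := List.cons.inj hu
    rcases h.lhs_cases with ⟨σ', w, hw⟩ | ⟨τ', g', σ', w, hw⟩
    · exact absurd (hw ▸ by simp) (opn_notMem_string (σ := σ') (τ := τ) (u := w) (g := g))
    · have hopn : Letter.opn τ g ∈ w.map (Letter.cst σ') ++ [Letter.cls] := by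
        rw [← (List.cons.inj hw).2]
        simp
      simp at hopn

end Infixes

section CriticalPairs

variable {Op K : Type} {F : Signature Op} {Z : Set K} [LinearOrder K]
  {μ : List (Letter Op K) → ℕ} {S : ℕ → Set (Eqn Op K)}

variable (hμ : LexWeight (LetterLT Z) μ) (hder : IsDerivation F S) (hfair : IsFair F S)
  (hflat : ∀ i, FlatSet F Z (S i))
include hμ hder hfair hflat

theorem Inference.boundedProof {e e' : Eqn Op K} {p q : Term Op K} {D : Set (Eqn Op K)}
    (hinf : Inference F {e, e'} D {s(p, q)}) (he : e ∈ persisting S) (he' : e' ∈ persisting S)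
    {τ : Option Op} (hp : Fits F τ p) (hq : Fits F τ q) :
    BoundedProof (StringStep (WordRule F Z (orient F (persisting S)))) μ
      (p.enc F τ) (q.enc F τ) := by
  obtain ⟨i, hi⟩ := hfair.exists_mem hinf (exists_pair_subset he he') (Set.mem_singleton _)
  exact hasProof_mk.1 (hder.hasProof hμ hflat hi (by simp [hp, hq]))

theorem criticalPair_sameLhs {u : Term Op K} {d d' : K}
    (hu : ∀ f ∈ F.assoc, ∀ ts, u ≠ Term.app f ts)
    (h : (u, Term.const d) ∈ orient F (persisting S))
    (h' : (u, Term.const d') ∈ orient F (persisting S)) (τ : Option Op) :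
    BoundedProof (StringStep (WordRule F Z (orient F (persisting S)))) μ
      [Letter.cst τ d] [Letter.cst τ d'] := by
  wlog hlt : d' < d generalizing d d' with H
  · rcases (not_lt.1 hlt).lt_or_eq with hlt | rfl
    · exact (H h' h hlt).symm
    · exact .refl _
  have hinf := Inference.collapse u (Term.const d') (Term.const d) u d' .top h.2 h'.2 hu
    fun _ => .const _ _ hlt
  simpa only [Term.enc_const] using
    (hinf.boundedProof hμ hder hfair hflat h.1 h'.1 (fits_const τ _) (fits_const τ _)).symm

theorem criticalPair_collapse {g : Op} {xs ys : List K} {c d : K} {t : Term Op K}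
    (h : (Term.ofString g (xs ++ [c] ++ ys), t) ∈ orient F (persisting S))
    (h' : (Term.const c, Term.const d) ∈ orient F (persisting S)) {τ : Option Op}
    (hg : g ∈ F.assoc → τ = some g) (ht : Fits F τ t) :
    BoundedProof (StringStep (WordRule F Z (orient F (persisting S)))) μ
      (t.enc F τ) ((Term.ofString g (xs ++ [d] ++ ys)).enc F τ) := by
  have ofString_eq (c : K) : Term.ofString g (xs ++ [c] ++ ys) =
      Term.app g (xs.map Term.const ++ Term.const c :: ys.map Term.const) := by
    simp [Term.ofString]
  have hreplace : Term.Replace (Term.const c) (Term.const d) (Term.ofString g (xs ++ [c] ++ ys))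
      (Term.ofString g (xs ++ [d] ++ ys)) := by
    rw [ofString_eq, ofString_eq]
    exact .arg _ _ _ _ _ .top
  have hinf := Inference.collapse _ _ t _ d hreplace h.2 h'.2 (fun _ _ _ => nofun)
    fun h => nomatch (ofString_eq c).symm.trans h
  exact (hinf.boundedProof hμ hder hfair hflat h.1 h'.1 (fits_app.2 hg) ht).symm

theorem criticalPair_simplify {f : Op} (hf : f ∈ F.assoc) {u₁ u₂ u₃ v w : List K}
    (hu : 2 ≤ u₂.length) (hv : v ≠ []) (hw : w ≠ [])
    (h : (Term.ofString f (u₁ ++ u₂ ++ u₃), Term.ofStringBar f w) ∈ orient F (persisting S))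
    (h' : (Term.ofString f u₂, Term.ofStringBar f v) ∈ orient F (persisting S)) :
    BoundedProof (StringStep (WordRule F Z (orient F (persisting S)))) μ
      (w.map (Letter.cst (some f))) ((u₁ ++ v ++ u₃).map (Letter.cst (some f))) := by
  have main {u₁ u₃ v w : List K} (hv : v ≠ []) (hw : w ≠ [])
      (h : (Term.ofString f (u₁ ++ u₂ ++ u₃), Term.ofStringBar f w) ∈ orient F (persisting S))
      (h' : (Term.ofString f u₂, Term.ofStringBar f v) ∈ orient F (persisting S))
      (htop : u₁ ++ u₃ = [] → TermGT F (Term.ofStringBar f w) (Term.ofStringBar f v)) :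
      BoundedProof (StringStep (WordRule F Z (orient F (persisting S)))) μ
        (w.map (Letter.cst (some f))) ((u₁ ++ v ++ u₃).map (Letter.cst (some f))) := by
    have hne : u₁ ++ v ++ u₃ ≠ [] := by simp [hv]
    have hinf := Inference.simplify f u₁ u₂ u₃ v (Term.ofStringBar f w) hf hu hv h'.2 htop
    simpa only [enc_ofStringBar hf hw, enc_ofStringBar hf hne] using
      (hinf.boundedProof hμ hder hfair hflat h.1 h'.1 (fits_ofStringBar f hne)
        (fits_ofStringBar f hw)).symm
  by_cases! htop : u₁ ++ u₃ ≠ []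
  · exact main hv hw h h' fun h => absurd h htop
  obtain ⟨rfl, rfl⟩ := List.append_eq_nil_iff.1 htop
  have hwv : FlatPair F Z (Term.ofStringBar f w) (Term.ofStringBar f v) :=
    ⟨(persisting_flatSet hflat _ _ h.1).right, (persisting_flatSet hflat _ _ h'.1).right,
      sameSort_ofStringBar hf hw hv⟩
  rcases hwv.termGT_trichotomy with hgt | heq | hgt
  · exact main hv hw h h' fun _ => hgt
  · rw [List.nil_append, List.append_nil, ← enc_ofStringBar hf hw, heq, enc_ofStringBar hf hv]
    exact .refl _
  · rw [List.nil_append, List.append_nil] at h ⊢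
    simpa using (main (u₁ := []) (u₃ := []) hw hv (by simpa using h') h fun _ => hgt).symm

theorem criticalPair_const {c d : K} {τ : Option Op} {a b r : List (Letter Op K)}
    (h' : (Term.const c, Term.const d) ∈ orient F (persisting S))
    (h : WordRule F Z (orient F (persisting S)) (a ++ [Letter.cst τ c] ++ b) r) :
    BoundedProof (StringStep (WordRule F Z (orient F (persisting S)))) μ r
      (a ++ [Letter.cst τ d] ++ b) := by
  generalize hl : a ++ [Letter.cst τ c] ++ b = l at h
  replace hl : l = a ++ [c].map (Letter.cst τ) ++ b := hl.symm
  cases h with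
  | const c' d' τ' h =>
    obtain ⟨rfl, rfl, hc⟩ := singleton_eq_append (by simp) hl
    obtain ⟨rfl, hcc⟩ := (Letter.map_cst_inj (u' := [c']) (by simp)).1 hc
    obtain rfl := List.singleton_inj.1 hcc
    exact criticalPair_sameLhs hμ hder hfair hflat (by simp) h h' τ
  | app g u d' τ' hg hu h =>
    obtain ⟨rfl, xs, ys, rfl, rfl, rfl⟩ := bracket_eq_append_string (by simp) hl
    have := criticalPair_collapse hμ hder hfair hflat h h' (τ := τ') (fun h => absurd h hg)
      (fits_const τ' d')
    simpa [Term.enc_const, enc_ofString fun h => hg h.1] using this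
  | string f u v hf hu hv h =>
    obtain ⟨rfl, xs, ys, rfl, rfl, rfl⟩ := string_eq_append (by simp) hl
    have := criticalPair_collapse hμ hder hfair hflat h h' (fun _ => rfl) (fits_ofStringBar f hv)
    simpa [enc_ofStringBar hf hv, enc_ofString_assoc hf] using this
  | bracket f c' τ' hf hc =>
    obtain ⟨rfl, xs, ys, hxy, rfl, rfl⟩ := bracket_eq_append_string (by simp) hl
    obtain ⟨rfl, rfl, hcc⟩ := singleton_eq_append (by simp) hxy
    obtain rfl := List.singleton_inj.1 hcc
    have hd : d ∈ Z := flatTerm_const.1 (persisting_flatSet hflat _ _ h'.1).right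
    have hconst := BoundedProof.of_rel (μ := μ)
      (StringStep.of_rule (WordRule.const (F := F) (Z := Z) c d τ' h'))
    have hbracket := BoundedProof.of_rel (μ := μ) (StringStep.of_rule
      (WordRule.bracket (R := orient F (persisting S)) f d τ' hf hd))
    exact hconst.trans hbracket.symm (.inr (hμ.lt_of_length_lt (by simp)).le)

theorem criticalPair_app {g : Op} {u : List K} {d : K} {τ : Option Op}
    {a b r : List (Letter Op K)} (hg : g ∉ F.assoc)
    (h' : (Term.ofString g u, Term.const d) ∈ orient F (persisting S))
    (h : WordRule F Z (orient F (persisting S))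
      (a ++ Letter.opn τ g :: (u.map (Letter.cst (some g)) ++ [Letter.cls]) ++ b) r) :
    BoundedProof (StringStep (WordRule F Z (orient F (persisting S)))) μ r
      (a ++ [Letter.cst τ d] ++ b) := by
  generalize hl : a ++ Letter.opn τ g :: (u.map (Letter.cst (some g)) ++ [Letter.cls]) ++ b = l
    at h
  symm at hl
  cases h with
  | const c' d' τ' h =>
    obtain ⟨-, -, hc⟩ := singleton_eq_append (by simp) hl
    simp at hc
  | app g' u' d' τ' hg' hu' h =>
    obtain ⟨rfl, rfl, rfl, rfl, hu⟩ := bracket_eq_append_bracket hl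
    obtain rfl := (Letter.cst_injective _).list_map hu
    refine criticalPair_sameLhs hμ hder hfair hflat (fun f hf ts hts => hg ?_) h h' τ'
    exact (Term.app.inj hts).1 ▸ hf
  | string f u' v' hf hu' hv' h =>
    exact absurd (hl ▸ by simp) (opn_notMem_string (σ := some f) (τ := τ) (u := u') (g := g))
  | bracket f c τ' hf hc =>
    obtain ⟨-, -, -, rfl, -⟩ := bracket_eq_append_bracket hl
    exact absurd hf hg

theorem criticalPair_string {f : Op} {u v : List K} {a b r : List (Letter Op K)}
    (hf : f ∈ F.assoc) (hu : 2 ≤ u.length) (hv : v ≠ [])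
    (h' : (Term.ofString f u, Term.ofStringBar f v) ∈ orient F (persisting S))
    (h : WordRule F Z (orient F (persisting S)) (a ++ u.map (Letter.cst (some f)) ++ b) r) :
    BoundedProof (StringStep (WordRule F Z (orient F (persisting S)))) μ r
      (a ++ v.map (Letter.cst (some f)) ++ b) := by
  generalize hl : a ++ u.map (Letter.cst (some f)) ++ b = l at h
  symm at hl
  have hne : u ≠ [] := by rintro rfl; simp at hu
  cases h with
  | const c' d' τ' h =>
    obtain ⟨-, -, hc⟩ := singleton_eq_append (by simpa using hne) hl
    have := congrArg List.length hc
    simp only [List.length_map, List.length_singleton] at this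
    omega
  | app g u' d' τ' hg hu' h =>
    obtain ⟨hgf, -⟩ := bracket_eq_append_string hne hl
    exact absurd (Option.some.inj hgf ▸ hf) hg
  | string f' u' v' hf' hu' hv' h =>
    obtain ⟨hff, xs, ys, rfl, rfl, rfl⟩ := string_eq_append hne hl
    obtain rfl := Option.some.inj hff
    rw [← List.map_append, ← List.map_append]
    exact criticalPair_simplify hμ hder hfair hflat hf hu hv hv' h h'
  | bracket f' c τ' hf' hc =>
    obtain ⟨-, xs, ys, hxy, -⟩ := bracket_eq_append_string hne hl
    have := congrArg List.length hxy
    simp only [List.length_append, List.length_singleton] at this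
    omega

theorem boundedProof_of_inclusion {l' r r' a b : List (Letter Op K)}
    (h : WordRule F Z (orient F (persisting S)) (a ++ l' ++ b) r)
    (h' : WordRule F Z (orient F (persisting S)) l' r') :
    BoundedProof (StringStep (WordRule F Z (orient F (persisting S)))) μ r (a ++ r' ++ b) := by
  cases h' with
  | const c d τ h' => exact criticalPair_const hμ hder hfair hflat h' h
  | app g u d τ hg hu h' => exact criticalPair_app hμ hder hfair hflat hg h' h
  | string f u v hf hu hv h' => exact criticalPair_string hμ hder hfair hflat hf hu hv h' h
  | bracket f c τ hf hc => exact h.eq_of_append_bracket hf ▸ .refl _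

theorem boundedProof_of_overlap {l₁ l₂ l₃ r r' : List (Letter Op K)} (h₁ : l₁ ≠ [])
    (h₂ : l₂ ≠ []) (h₃ : l₃ ≠ []) (h : WordRule F Z (orient F (persisting S)) (l₁ ++ l₂) r)
    (h' : WordRule F Z (orient F (persisting S)) (l₂ ++ l₃) r') :
    BoundedProof (StringStep (WordRule F Z (orient F (persisting S)))) μ (r ++ l₃)
      (l₁ ++ r') := by
  obtain ⟨σ, u₁, u₂, u₃, rfl, rfl, rfl⟩ := h.exists_string_of_overlap h₁ h₂ h'
  replace h₁ : u₁ ≠ [] := by simpa using h₁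
  replace h₂ : u₂ ≠ [] := by simpa using h₂
  replace h₃ : u₃ ≠ [] := by simpa using h₃
  have hlen {x y : List K} (hx : x ≠ []) (hy : y ≠ []) : 2 ≤ (x ++ y).length := by
    have := List.length_pos_iff.2 hx
    have := List.length_pos_iff.2 hy
    grind
  rw [← List.map_append] at h h'
  obtain ⟨f, w, hf, rfl, hw, rfl, hr⟩ := h.string_cases (hlen h₁ h₂)
  obtain ⟨f', v, -, hff, hv, rfl, hr'⟩ := h'.string_cases (hlen h₂ h₃)
  obtain rfl := Option.some.inj hff
  have hinf := Inference.deduce f u₁ u₂ u₃ v w hf h₁ h₂ h₃ hv hw hr.2 hr'.2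
  simpa only [enc_ofString_assoc hf, List.map_append] using
    (hinf.boundedProof hμ hder hfair hflat hr.1 hr'.1 (fits_ofString f _)
      (fits_ofString f _)).symm

theorem linkedBelow_of_peak {x y z : List (Letter Op K)}
    (hy : StringStep (WordRule F Z (orient F (persisting S))) x y)
    (hz : StringStep (WordRule F Z (orient F (persisting S))) x z) :
    LinkedBelow (StringStep (WordRule F Z (orient F (persisting S)))) μ (μ x) y z := by
  have hrule (l r : List (Letter Op K)) (h : WordRule F Z (orient F (persisting S)) l r) :
      μ r < μ l := h.weight_lt hμ (persisting_flatSet hflat)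
  have hlt (a b : List (Letter Op K)) {l r : List (Letter Op K)}
      (h : WordRule F Z (orient F (persisting S)) l r) : μ (a ++ r ++ b) < μ (a ++ l ++ b) :=
    hμ.context_lt a b (hrule l r h)
  refine linkedBelow_of_criticalPairs hμ.context_lt hrule ?_ ?_ hy hz
  · intro l' r r' a b h h'
    exact boundedProof_of_inclusion hμ hder hfair hflat h h' _ (hrule _ _ h) (hlt a b h')
  · intro l₁ l₂ l₃ r r' h₁ h₂ h₃ h h'
    exact boundedProof_of_overlap hμ hder hfair hflat h₁ h₂ h₃ h h' _
      (by simpa using hlt [] l₃ h) (by simpa using hlt l₁ [] h')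

end CriticalPairs

/-! ### Soundness in models -/

section Soundness

variable {Op K K' : Type} {F : Signature Op}

/-- The algebra with the carrier and the operations of `M` in which the constants, possibly of
another type, have the values `a`. -/
def Alg.withCst (M : Alg Op K) (a : K' → M.carrier) : Alg Op K' where
  carrier := M.carrier
  cst := a
  op := M.op

theorem Alg.ModelsA.withCst {M : Alg Op K} (hM : M.ModelsA F) (a : K' → M.carrier) :
    (M.withCst a).ModelsA F := hM

theorem Alg.eval_withCst_map (M : Alg Op K) {a : K' → M.carrier} {h : K → K'}
    (ha : ∀ c, a (h c) = M.cst c) (t : Term Op K) :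
    (M.withCst a).eval (t.map h) = M.eval t := by
  induction t using Term.induction with
  | const c => exact ha c
  | app g ts ih =>
    rw [Term.map, Term.mapArgs_eq_map, Alg.eval_app, Alg.eval_app, List.map_map]
    exact congrArg (M.op g) (List.map_congr_left ih)

theorem Alg.eval_withCst_congr (M : Alg Op K) {a b : K' → M.carrier} {t : Term Op K'}
    (h : ∀ c, Term.HasConst c t → a c = b c) :
    (M.withCst a).eval t = (M.withCst b).eval t := by
  induction t using Term.induction with
  | const c => exact h c .here
  | app g ts ih =>
    rw [Alg.eval_app, Alg.eval_app]
    exact congrArg (M.op g) (List.map_congr_left fun t ht => ih t ht fun c hc =>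
      h c (.arg g ts t ht hc))

/-- The equations in `S` hold in `M`. -/
def Alg.Models (M : Alg Op K) (S : Set (Eqn Op K)) : Prop :=
  ∀ p q : Term Op K, s(p, q) ∈ S → M.eval p = M.eval q

variable {M : Alg Op K} {S S' : Set (Eqn Op K)} {p q : Term Op K}

theorem Alg.models_singleton : M.Models {s(p, q)} ↔ M.eval p = M.eval q := by
  refine ⟨fun h => h p q rfl, fun h p' q' h' => ?_⟩
  rcases Sym2.eq_iff.1 (Set.mem_singleton_iff.1 h') with ⟨rfl, rfl⟩ | ⟨rfl, rfl⟩
  · exact h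
  · exact h.symm

theorem Alg.models_union : M.Models (S ∪ S') ↔ M.Models S ∧ M.Models S' :=
  ⟨fun h => ⟨fun p q h' => h p q (.inl h'), fun p q h' => h p q (.inr h')⟩,
    fun h p q h' => h'.elim (h.1 p q) (h.2 p q)⟩

theorem Alg.models_pair {e : Eqn Op K} :
    M.Models {s(p, q), e} ↔ M.eval p = M.eval q ∧ M.Models {e} := by
  rw [← Set.singleton_union, Alg.models_union, Alg.models_singleton]

theorem Alg.Models.mono (h : M.Models S) (h' : S' ⊆ S) : M.Models S' :=
  fun p q hpq => h p q (h' hpq)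

theorem Alg.ModelsA.op_eval_ofStringBar (hM : M.ModelsA F) {f : Op} (hf : f ∈ F.assoc)
    {v : List K} (hv : v ≠ []) {xs zs : List M.carrier} (h : xs ++ zs ≠ []) :
    M.op f (xs ++ M.eval (Term.ofStringBar f v) :: zs) = M.op f (xs ++ v.map M.cst ++ zs) := by
  rcases Term.ofStringBar_cases f hv with ⟨c, rfl, hbar⟩ | ⟨hlen, hbar⟩
  · rw [hbar, List.map_singleton, List.append_assoc]
    rfl
  · have := List.length_pos_iff.2 h
    rw [List.length_append] at this
    rw [hbar, Alg.eval_ofString]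
    exact hM f hf xs _ zs (by rwa [List.length_map]) (by lia)

theorem Alg.ModelsA.eval_simplify (hM : M.ModelsA F) {f : Op} (hf : f ∈ F.assoc)
    {u₁ u₂ u₃ v : List K} (h₂ : 2 ≤ u₂.length) (hv : v ≠ [])
    (h : M.eval (Term.ofString f u₂) = M.eval (Term.ofStringBar f v)) :
    M.eval (Term.ofString f (u₁ ++ u₂ ++ u₃)) =
      M.eval (Term.ofStringBar f (u₁ ++ v ++ u₃)) := by
  by_cases hnil : u₁ ++ u₃ = []
  · obtain ⟨rfl, rfl⟩ := List.append_eq_nil_iff.1 hnil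
    simpa only [List.nil_append, List.append_nil] using h
  · have hlen₁ := List.length_pos_iff.2 hnil
    have hlen₂ := List.length_pos_iff.2 hv
    have hmap : u₁.map M.cst ++ u₃.map M.cst ≠ [] := by simpa using hnil
    have hu₂ : u₂ ≠ [] := List.length_pos_iff.1 (by lia)
    rw [← Term.ofStringBar_of_two_le f h₂] at h
    rw [Term.ofStringBar_of_two_le f (by grind), Alg.eval_ofString, Alg.eval_ofString]
    simp only [List.map_append]
    rw [← hM.op_eval_ofStringBar hf hu₂ hmap, h, hM.op_eval_ofStringBar hf hv hmap]

theorem Alg.ModelsA.eval_deduce (hM : M.ModelsA F) {f : Op} (hf : f ∈ F.assoc)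
    {u₁ u₂ u₃ v w : List K} (h₁ : u₁ ≠ []) (h₂ : u₂ ≠ []) (h₃ : u₃ ≠ []) (hv : v ≠ [])
    (hw : w ≠ []) (h : M.eval (Term.ofString f (u₁ ++ u₂)) = M.eval (Term.ofStringBar f w))
    (h' : M.eval (Term.ofString f (u₂ ++ u₃)) = M.eval (Term.ofStringBar f v)) :
    M.eval (Term.ofString f (u₁ ++ v)) = M.eval (Term.ofString f (w ++ u₃)) := by
  have hlen {x y : List K} (hx : x ≠ []) (hy : y ≠ []) : 2 ≤ (x ++ y).length := by
    have := List.length_pos_iff.2 hx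
    have := List.length_pos_iff.2 hy
    grind
  have hleft := hM.eval_simplify hf (u₁ := u₁) (u₃ := []) (hlen h₂ h₃) hv h'
  have hright := hM.eval_simplify hf (u₁ := []) (u₃ := u₃) (hlen h₁ h₂) hw h
  rw [List.append_nil, List.append_nil, Term.ofStringBar_of_two_le f (hlen h₁ hv)] at hleft
  rw [List.nil_append, List.nil_append, Term.ofStringBar_of_two_le f (hlen hw h₃),
    List.append_assoc] at hright
  exact hleft.symm.trans hright

theorem Inference.models [LinearOrder K] {P D N : Set (Eqn Op K)} (hinf : Inference F P D N)
    (hM : M.ModelsA F) (hP : M.Models P) : M.Models N := by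
  cases hinf with
  | deduce f u₁ u₂ u₃ v w hf h₁ h₂ h₃ hv hw _ _ =>
    rw [Alg.models_pair, Alg.models_singleton] at hP
    exact Alg.models_singleton.2 (hM.eval_deduce hf h₁ h₂ h₃ hv hw hP.1 hP.2)
  | simplify f u₁ u₂ u₃ v s hf h₂ hv _ _ =>
    rw [Alg.models_pair, Alg.models_singleton] at hP
    exact Alg.models_singleton.2 ((hM.eval_simplify hf h₂ hv hP.2).symm.trans hP.1)
  | collapse s s' t u d hs _ _ _ _ =>
    rw [Alg.models_pair, Alg.models_singleton] at hP
    exact Alg.models_singleton.2 ((hs.eval_eq hP.2).symm.trans hP.1)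
  | compose t c d _ _ =>
    rw [Alg.models_pair, Alg.models_singleton] at hP
    exact Alg.models_singleton.2 (hP.1.trans hP.2)
  | delete s => exact fun p q h => absurd h (Set.notMem_empty _)

theorem IsDerivation.models [LinearOrder K] {S : ℕ → Set (Eqn Op K)} (hder : IsDerivation F S)
    (hM : M.ModelsA F) (h₀ : M.Models (S 0)) (i : ℕ) : M.Models (S i) := by
  induction i with
  | zero => exact h₀
  | succ i ih =>
    rcases hder i with h | ⟨P, D, N, hinf, hP, h⟩
    · exact h ▸ ih
    · rw [h, Alg.models_union]
      exact ⟨ih.mono Set.sdiff_subset, hinf.models hM (ih.mono hP)⟩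

variable {R : Set (Term Op K × Term Op K)}

theorem RewriteModA.eval_eq (h : RewriteModA F R p q) (hM : M.ModelsA F)
    (hR : ∀ ρ ∈ R, M.eval ρ.1 = M.eval ρ.2) : M.eval p = M.eval q := by
  obtain ⟨s, t, hps, ⟨ρ, hρ, hst⟩, htq⟩ := h
  rw [hps.eval_eq hM, hst.eval_eq (hR ρ hρ), htq.eval_eq hM]

theorem SameNormalForm.eval_eq (h : SameNormalForm F R p q) (hM : M.ModelsA F)
    (hR : ∀ ρ ∈ R, M.eval ρ.1 = M.eval ρ.2) : M.eval p = M.eval q := by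
  have eval_eq {p q : Term Op K} (h : Relation.ReflTransGen (RewriteModA F R) p q) :
      M.eval p = M.eval q := by
    induction h with
    | refl => rfl
    | tail _ hstep ih => exact ih.trans (hstep.eval_eq hM hR)
  obtain ⟨⟨p', hp⟩, ⟨q', hq⟩, hpq⟩ := h
  rw [eval_eq hp.1, eval_eq hq.1, (hpq p' q' hp hq).eval_eq hM]

end Soundness

/-! ### Flattening -/

section Constants

variable {Op K K' : Type} {F : Signature Op}

/-- The set of the constants that occur in the equations of `S`. -/
def constants (S : Set (Eqn Op K)) : Set K :=
  {c | ∃ e ∈ S, ∃ t ∈ e, Term.HasConst c t}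

theorem constants_union (S S' : Set (Eqn Op K)) :
    constants (S ∪ S') = constants S ∪ constants S' := by
  ext c
  simp only [constants, Set.mem_ofPred_eq, Set.mem_union, or_and_right, exists_or]

theorem constants_mono {S S' : Set (Eqn Op K)} (h : S ⊆ S') : constants S ⊆ constants S' :=
  fun _ ⟨e, he, t, ht, hc⟩ => ⟨e, h he, t, ht, hc⟩

theorem Term.finite_setOf_hasConst (t : Term Op K) : {c | Term.HasConst c t}.Finite := by
  induction t using Term.induction with
  | const c =>
    refine (Set.finite_singleton c).subset fun d hd => ?_
    cases hd
    rfl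
  | app g ts ih =>
    refine (Set.Finite.biUnion ts.finite_toSet ih).subset fun c hc => ?_
    cases hc with
    | arg _ _ t ht hc => exact Set.mem_biUnion ht hc

theorem constants_finite {S : Set (Eqn Op K)} (hS : S.Finite) : (constants S).Finite := by
  have finite_mem (e : Eqn Op K) : {t | t ∈ e}.Finite := by
    induction e using Sym2.ind with
    | _ p q => exact (Set.toFinite {p, q}).subset fun t ht => Sym2.mem_iff.1 ht
  refine (hS.biUnion fun e _ =>
    (finite_mem e).biUnion fun t _ => t.finite_setOf_hasConst).subset ?_
  exact fun c ⟨e, he, t, ht, hc⟩ => Set.mem_biUnion he (Set.mem_biUnion ht hc)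

theorem Term.Replace.hasConst_of_subterm {u v s s' : Term Op K} (h : Term.Replace u v s s')
    {c : K} (hc : Term.HasConst c u) : Term.HasConst c s := by
  induction h with
  | top => exact hc
  | arg g xs ys a _ _ ih => exact .arg g _ a (by simp) ih

theorem Term.hasConst_map {h : K → K'} {t : Term Op K} {c : K'}
    (hc : Term.HasConst c (t.map h)) : ∃ d, Term.HasConst d t ∧ h d = c := by
  induction t using Term.induction with
  | const d =>
    rw [Term.map] at hc
    cases hc
    exact ⟨d, .here, rfl⟩
  | app g ts ih =>
    rw [Term.map, Term.mapArgs_eq_map] at hc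
    cases hc with
    | arg _ _ t ht hc =>
      obtain ⟨t', ht', rfl⟩ := List.mem_map.1 ht
      obtain ⟨d, hd, rfl⟩ := ih t' ht' hc
      exact ⟨d, .arg g ts t' ht' hd, rfl⟩

theorem Term.hasConst_of_mem_splice {g : Op} {s t : Term Op K} {c : K}
    (ht : t ∈ Term.splice F g s) (hc : Term.HasConst c t) : Term.HasConst c s := by
  cases s with
  | const d =>
    rw [Term.splice, List.mem_singleton] at ht
    exact ht ▸ hc
  | app g' us =>
    rw [Term.splice] at ht
    split_ifs at ht
    · exact .arg _ _ t ht hc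
    · exact List.mem_singleton.1 ht ▸ hc

theorem Term.hasConst_of_hasConst_flatten {t : Term Op K} {c : K}
    (hc : Term.HasConst c (t.flatten F)) : Term.HasConst c t := by
  induction t using Term.induction with
  | const d => rwa [Term.flatten] at hc
  | app g ts ih =>
    rw [Term.flatten, Term.flattenArgs_eq_flatMap] at hc
    cases hc with
    | arg _ _ t ht hc =>
      obtain ⟨t', ht', hmem⟩ := List.mem_flatMap.1 ht
      exact .arg g ts t' ht' (ih t' ht' (Term.hasConst_of_mem_splice hmem hc))

theorem flatTerm_constants {S : Set (Eqn Op K)} {e : Eqn Op K} (he : e ∈ S) {g : Op} {u : List K}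
    (hu : Term.ofString g u ∈ e) (hwf : F.WF (Term.ofString g u)) :
    FlatTerm F (constants S) (Term.ofString g u) :=
  .app g u (Signature.wf_ofString.1 hwf) fun c hc =>
    ⟨e, he, _, hu, .arg g _ (Term.const c) (List.mem_map_of_mem hc) .here⟩

theorem flatSet_constants {S : Set (Eqn Op K)} (hS : ∀ e ∈ S, ∀ t ∈ e, F.WF t)
    (hflat : ∀ e ∈ S, ConstEqn e ∨ DFlatEqn e ∨ AFlatEqn F e) :
    FlatSet F (constants S) S := by
  have flat_const (c : K) {e : Eqn Op K} (he : e ∈ S) (hc : Term.const c ∈ e) :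
      FlatTerm F (constants S) (Term.const c : Term Op K) := .const c ⟨e, he, _, hc, .here⟩
  have flat_string {g : Op} {u : List K} {e : Eqn Op K} (he : e ∈ S)
      (hu : Term.ofString g u ∈ e) : FlatTerm F (constants S) (Term.ofString g u) :=
    flatTerm_constants he hu (hS e he _ hu)
  intro p q hpq
  suffices h : FlatSet F (constants S) {s(p, q)} from h p q rfl
  rcases hflat _ hpq with ⟨c, d, h⟩ | ⟨g, u, c, h⟩ | ⟨f, hf, u, v, h⟩ <;> rw [h] at hpq ⊢
  · exact flatSet_singleton ⟨flat_const c hpq (by simp), flat_const d hpq (by simp), .left _ _⟩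
  · exact flatSet_singleton ⟨flat_string hpq (by simp), flat_const c hpq (by simp), .right _ _⟩
  · exact flatSet_singleton
      ⟨flat_string hpq (by simp), flat_string hpq (by simp), .app _ _ _ hf⟩

theorem CC.map {E : Set (Eqn Op K)} {E' : Set (Eqn Op K')} {s t : Term Op K} (hst : CC F E s t)
    (h : K → K') (hE : ∀ p q, s(p, q) ∈ E → CC F E' (p.map h) (q.map h)) :
    CC F E' (s.map h) (t.map h) := by
  induction hst with
  | base s t hs => exact hE s t hs
  | assoc f xs ys zs hf hl =>
    have hwf := hl.map h
    simp only [Term.map, Term.mapArgs_eq_map, List.map_append, List.map_cons] at hwf ⊢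
    exact .assoc f _ _ _ hf hwf
  | refl s hs => exact .refl _ (hs.map h)
  | symm s t _ ih => exact .symm _ _ ih
  | trans s t u _ _ ih₁ ih₂ => exact .trans _ _ _ ih₁ ih₂
  | congr g ss ts har hlen _ ih =>
    simp only [Term.map, Term.mapArgs_eq_map]
    refine .congr g _ _ (by simpa using har) (by simpa using hlen) fun i hi => ?_
    simpa using ih i (by simpa using hi)

end Constants

section Flattening

variable {Op C₀ : Type} {F : Signature Op} {S S' : Set (Eqn Op (Const C₀))}

theorem FlattenStep.exists_replace (h : FlattenStep F S S') :
    ∃ (p p' q : Term Op (Const C₀)) (g : Op) (u : List (Const C₀)) (i : ℕ), s(p, q) ∈ S ∧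
      Term.Replace (Term.ofString g u) (Term.const (newConst i)) p p' ∧
      S \ {s(p, q)} ⊆ S' ∧ {s(p', q), s(Term.ofString g u, Term.const (newConst i))} ⊆ S' ∧
      S' ⊆ S ∪ {s(p', q), s(Term.ofString g u, Term.const (newConst i))} := by
  cases h with
  | name p p' q g u i he _ _ hp =>
    exact ⟨p, p', q, g, u, i, he, hp, Set.subset_union_left, Set.subset_union_right,
      Set.union_subset_union_left _ Set.sdiff_subset⟩
  | reuse p p' q g u i he _ hmem hne hp =>
    refine ⟨p, p', q, g, u, i, he, hp, Set.subset_union_left, ?_,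
      Set.union_subset_union Set.sdiff_subset (by simp)⟩
    exact Set.insert_subset (.inr rfl) (Set.singleton_subset_iff.2 (.inl ⟨hmem, hne.symm⟩))

theorem FlattenStep.wf (h : FlattenStep F S S') (hS : ∀ e ∈ S, ∀ t ∈ e, F.WF t) :
    ∀ e ∈ S', ∀ t ∈ e, F.WF t := by
  obtain ⟨p, p', q, g, u, i, he, hp, -, -, hsub⟩ := h.exists_replace
  have hwf := hS _ he p (by simp)
  intro e he' t ht
  rcases hsub he' with he' | rfl | rfl
  · exact hS e he' t ht
  · rcases Sym2.mem_iff.1 ht with rfl | rfl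
    · exact hp.wf hwf (.const _)
    · exact hS _ he _ (by simp)
  · rcases Sym2.mem_iff.1 ht with rfl | rfl
    · exact hp.wf_subterm hwf
    · exact .const _

theorem FlattenStep.finite_constants (h : FlattenStep F S S') (hS : (constants S).Finite) :
    (constants S').Finite := by
  obtain ⟨p, p', q, g, u, i, -, -, -, -, hsub⟩ := h.exists_replace
  refine Set.Finite.subset ?_ (constants_mono hsub)
  rw [constants_union]
  exact hS.union (constants_finite (Set.toFinite _))

theorem FlattenStep.cc (h : FlattenStep F S S') (hS : ∀ e ∈ S, ∀ t ∈ e, F.WF t)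
    {s t : Term Op (Const C₀)} (hst : CC F S s t) : CC F S' s t := by
  obtain ⟨p, p', q, g, u, i, he, hp, hkeep, hnew, -⟩ := h.exists_replace
  have hpq : CC F S' p q :=
    .trans _ _ _ (.replace hp (.base _ _ (hnew (.inr rfl))) (hS _ he p (by simp)))
      (.base _ _ (hnew (.inl rfl)))
  refine hst.of_base fun a b hab => ?_
  by_cases hab' : s(a, b) = s(p, q)
  · rcases Sym2.eq_iff.1 hab' with ⟨rfl, rfl⟩ | ⟨rfl, rfl⟩
    · exact hpq
    · exact .symm _ _ hpq
  · exact .base _ _ (hkeep ⟨hab, hab'⟩)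

/-- Values of the new constants can be added to the algebra `M` in such a way that the equations
in `S` hold. -/
def Alg.HasExtension (M : Alg Op C₀) (S : Set (Eqn Op (Const C₀))) : Prop :=
  ∃ a : Const C₀ → M.carrier, (∀ c, a (Sum.inlₗ c) = M.cst c) ∧ (M.withCst a).Models S

theorem FlattenStep.hasExtension (h : FlattenStep F S S') {M : Alg Op C₀}
    (hS : M.HasExtension S) : M.HasExtension S' := by
  classical
  obtain ⟨a, ha, hS⟩ := hS
  cases h with
  | name p p' q g u i he _ hfresh hp =>
    let b := Function.update a (newConst i) ((M.withCst a).eval (Term.ofString g u))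
    have eval_eq (t : Term Op (Const C₀)) (ht : ¬ Term.HasConst (newConst i) t) :
        (M.withCst b).eval t = (M.withCst a).eval t :=
      M.eval_withCst_congr fun c hc => Function.update_of_ne (by rintro rfl; exact ht hc) _ _
    have hu : (M.withCst b).eval (Term.ofString g u) =
        (M.withCst b).eval (Term.const (newConst i)) := by
      rw [eval_eq _ fun hc => hfresh _ he p (by simp) (hp.hasConst_of_subterm hc)]
      exact (Function.update_self (newConst i) _ a).symm
    have hS' : (M.withCst b).Models S := fun p q h => by
      rw [eval_eq p (hfresh _ h p (by simp)), eval_eq q (hfresh _ h q (by simp)), hS p q h]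
    refine ⟨b, fun c => ?_, ?_⟩
    · rw [← ha c]
      exact Function.update_of_ne (by simp [newConst]) _ _
    · rw [Alg.models_union, Alg.models_pair, Alg.models_singleton]
      exact ⟨hS'.mono Set.sdiff_subset, (hp.eval_eq hu).symm.trans (hS' p q he), hu⟩
  | reuse p p' q g u i he _ hmem _ hp =>
    refine ⟨a, ha, ?_⟩
    rw [Alg.models_union, Alg.models_singleton]
    exact ⟨hS.mono Set.sdiff_subset, (hp.eval_eq (hS _ _ hmem)).symm.trans (hS p q he)⟩

variable {E : Set (Eqn Op C₀)}

theorem Signature.WF.eqA_flatten_lift {t : Term Op C₀} (ht : F.WF t) :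
    EqA F (lift t) ((lift t).flatten F) := (ht.map _).eqA_flatten

theorem wf_of_mem_flatten_image (hE : ∀ e ∈ E, ∀ t ∈ e, F.WF t) :
    ∀ e ∈ Sym2.map (fun t : Term Op C₀ => (lift t).flatten F) '' E, ∀ t ∈ e, F.WF t := by
  rintro _ ⟨e, he, rfl⟩ t ht
  obtain ⟨t', ht', rfl⟩ := Sym2.mem_map.1 ht
  exact (hE e he t' ht').eqA_flatten_lift.wf.2

theorem FlatteningOf.wf (h : FlatteningOf F E S) (hE : ∀ e ∈ E, ∀ t ∈ e, F.WF t) :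
    ∀ e ∈ S, ∀ t ∈ e, F.WF t := by
  obtain ⟨hsteps, -⟩ := h
  induction hsteps with
  | refl => exact wf_of_mem_flatten_image hE
  | tail _ hstep ih => exact hstep.wf ih

theorem FlatteningOf.finite_constants (h : FlatteningOf F E S) (hE : (constants E).Finite) :
    (constants S).Finite := by
  obtain ⟨hsteps, -⟩ := h
  induction hsteps with
  | refl =>
    refine (hE.image Sum.inlₗ).subset ?_
    rintro c ⟨_, ⟨e, he, rfl⟩, t, ht, hc⟩
    obtain ⟨t', ht', rfl⟩ := Sym2.mem_map.1 ht
    obtain ⟨d, hd, rfl⟩ := Term.hasConst_map (Term.hasConst_of_hasConst_flatten hc)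
    exact ⟨d, ⟨e, he, t', ht', hd⟩, rfl⟩
  | tail _ hstep ih => exact hstep.finite_constants ih

theorem FlatteningOf.cc (h : FlatteningOf F E S) (hE : ∀ e ∈ E, ∀ t ∈ e, F.WF t)
    {s t : Term Op C₀} (hst : CC F E s t) : CC F S (lift s) (lift t) := by
  suffices hS : (∀ e ∈ S, ∀ t ∈ e, F.WF t) ∧ CC F S (lift s) (lift t) from hS.2
  obtain ⟨hsteps, -⟩ := h
  induction hsteps with
  | refl =>
    refine ⟨wf_of_mem_flatten_image hE, hst.map _ fun p q hpq => ?_⟩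
    have hp := (hE _ hpq p (by simp)).eqA_flatten_lift
    have hq := (hE _ hpq q (by simp)).eqA_flatten_lift
    exact .trans _ _ _ hp.cc (.trans _ _ _ (.base _ _ ⟨s(p, q), hpq, rfl⟩) hq.symm.cc)
  | tail _ hstep ih => exact ⟨hstep.wf ih.1, hstep.cc ih.1 ih.2⟩

theorem FlatteningOf.hasExtension (h : FlatteningOf F E S) (hE : ∀ e ∈ E, ∀ t ∈ e, F.WF t)
    {M : Alg Op C₀} [Nonempty M.carrier] (hM : M.ModelsA F) (hME : M.Models E) :
    M.HasExtension S := by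
  obtain ⟨hsteps, -⟩ := h
  induction hsteps with
  | refl =>
    let a (c : Const C₀) : M.carrier := Sum.elim M.cst (fun _ => Classical.ofNonempty) (ofLex c)
    have eval_eq {t : Term Op C₀} (ht : F.WF t) :
        (M.withCst a).eval ((lift t).flatten F) = M.eval t :=
      (ht.eqA_flatten_lift.eval_eq (hM.withCst a)).symm.trans
        (M.eval_withCst_map (h := Sum.inlₗ) (fun _ => rfl) t)
    refine ⟨a, fun _ => rfl, ?_⟩
    rintro p q ⟨e, he, heq⟩
    induction e using Sym2.ind with
    | _ p₀ q₀ =>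
      have hpq := hME p₀ q₀ he
      rw [← eval_eq (hE _ he p₀ (by simp)), ← eval_eq (hE _ he q₀ (by simp))] at hpq
      rcases Sym2.eq_iff.1 heq with ⟨rfl, rfl⟩ | ⟨rfl, rfl⟩
      · exact hpq
      · exact hpq.symm
  | tail _ hstep ih => exact hstep.hasExtension ih

end Flattening

/-! ### Rewriting modulo associativity and rewriting of words -/

section Correspondence

variable {Op K : Type} {F : Signature Op} {Z : Set K}

theorem FlatTerm.wf {t : Term Op K} (h : FlatTerm F Z t) : F.WF t := by
  cases h with
  | const c hc => exact .const c
  | app g u har hu => exact Signature.wf_ofString.2 har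

section Rewriting

variable {R : Set (Term Op K × Term Op K)}

theorem RewriteModA.arg {g : Op} {xs ys : List (Term Op K)} {a b : Term Op K}
    (h : RewriteModA F R a b) (hwf : F.WF (Term.app g (xs ++ a :: ys))) :
    RewriteModA F R (Term.app g (xs ++ a :: ys)) (Term.app g (xs ++ b :: ys)) := by
  obtain ⟨s, t, has, ⟨ρ, hρ, hst⟩, htb⟩ := h
  exact ⟨_, _, CC.congr_arg has hwf, ⟨ρ, hρ, .arg g xs ys s t hst⟩,
    CC.congr_arg htb (hwf.replace_arg htb.wf.1)⟩

theorem RewriteModA.eqA_left {p p' q : Term Op K} (hp : EqA F p p')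
    (h : RewriteModA F R p' q) : RewriteModA F R p q := by
  obtain ⟨s, t, hs, ht⟩ := h
  exact ⟨s, t, hp.trans hs, ht⟩

theorem Subterm.exists_rewriteModA {s s' t : Term Op K} (h : Subterm s t) (ht : F.WF t)
    (hs : RewriteModA F R s s') : ∃ t', RewriteModA F R t t' := by
  induction h with
  | refl => exact ⟨s', hs⟩
  | arg g ts t hmem _ ih =>
    obtain ⟨xs, ys, rfl⟩ := List.append_of_mem hmem
    obtain ⟨t', ht'⟩ := ih ht.arg
    exact ⟨_, ht'.arg ht⟩

theorem rewriteModA_of_mem {l r : Term Op K} (h : (l, r) ∈ R) (hl : F.WF l) (hr : F.WF r) :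
    RewriteModA F R l r :=
  ⟨l, r, .refl hl, ⟨(l, r), h, .top⟩, .refl hr⟩

theorem wf_of_reflTransGen {p q : Term Op K} (hp : F.WF p)
    (h : Relation.ReflTransGen (RewriteModA F R) p q) : F.WF q := by
  cases h with
  | refl => exact hp
  | tail _ h =>
    obtain ⟨_, _, -, -, hq⟩ := h
    exact hq.wf.2

/-- By associativity there is room for a rule `f(u) → r` inside a longer argument string. -/
theorem exists_rewriteModA_of_args {f : Op} (hf : f ∈ F.assoc) {us xs ys : List (Term Op K)}
    {r : Term Op K} (hus : F.WF (Term.app f us)) (h : RewriteModA F R (Term.app f us) r)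
    (hwf : F.WF (Term.app f (xs ++ us ++ ys))) :
    ∃ q, RewriteModA F R (Term.app f (xs ++ us ++ ys)) q := by
  by_cases hne : xs ++ ys = []
  · obtain ⟨rfl, rfl⟩ := List.append_eq_nil_iff.1 hne
    exact ⟨r, by simpa using h⟩
  · have hnested : F.WF (Term.app f (xs ++ Term.app f us :: ys)) := by
      have hpos := List.length_pos_of_ne_nil hne
      simp only [Signature.wf_app_iff, Signature.arityOK_iff_two_le hf, List.length_append,
        List.length_cons, List.forall_mem_append, List.forall_mem_cons] at hwf hpos hus ⊢
      exact ⟨by omega, hwf.2.1.1, hus, hwf.2.2⟩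
    exact ⟨_, (h.arg hnested).eqA_left (EqA.symm (CC.assoc f xs us ys hf hnested))⟩

theorem reflTransGen_bracket {f : Op} (hf : f ∈ F.assoc) {τ : Option Op} (hτ : τ ≠ some f)
    {u : List K} (hu : u ≠ []) (hflat : FlatTerm F Z (Term.ofStringBar f u)) :
    Relation.ReflTransGen (StringStep (WordRule F Z R))
      ([Letter.opn τ f] ++ (Term.ofStringBar f u).enc F (some f) ++ [Letter.cls])
      ((Term.ofStringBar f u).enc F τ) := by
  rw [enc_ofStringBar hf hu]
  rcases Term.ofStringBar_cases f hu with ⟨c, rfl, hbar⟩ | ⟨_, hbar⟩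
  · rw [hbar] at hflat ⊢
    rw [Term.enc_const]
    exact .single (.of_rule (.bracket f c τ hf (flatTerm_const.1 hflat)))
  · rw [hbar, enc_ofString fun h => hτ h.2]
    exact .refl

end Rewriting

theorem FlatPair.fits_or {p q : Term Op K} (h : FlatPair F Z p q) (τ : Option Op) :
    (Fits F τ p ∧ Fits F τ q) ∨ ∃ f ∈ F.assoc, τ ≠ some f ∧ ∃ u v, u ≠ [] ∧ v ≠ [] ∧
      p = Term.ofStringBar f u ∧ q = Term.ofStringBar f v := by
  have exists_strings {p q : Term Op K} (h : FlatPair F Z p q) (hp : ¬ Fits F τ p) :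
      ∃ f ∈ F.assoc, τ ≠ some f ∧ ∃ u v, u ≠ [] ∧ v ≠ [] ∧
        p = Term.ofStringBar f u ∧ q = Term.ofStringBar f v := by
    simp only [Fits, not_forall] at hp
    obtain ⟨f, hf, ts, rfl, hτ⟩ := hp
    obtain ⟨v, hv, hq⟩ := h.exists_ofStringBar hf
    obtain ⟨u, hu, hp⟩ :=
      FlatPair.exists_ofStringBar hf (us := ts) ⟨h.left, h.left, .app f ts ts hf⟩
    exact ⟨f, hf, hτ, u, v, hu, hv, hp, hq⟩
  by_cases hp : Fits F τ p
  · by_cases hq : Fits F τ q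
    · exact .inl ⟨hp, hq⟩
    · obtain ⟨f, hf, hτ, u, v, hu, hv, hq, hp⟩ := exists_strings h.symm hq
      exact .inr ⟨f, hf, hτ, v, u, hv, hu, hp, hq⟩
  · exact .inr (exists_strings h hp)

variable [LinearOrder K] {R : Set (Eqn Op K)}

theorem exists_rewriteModA_of_stringStep (hR : FlatSet F Z R) {q : Term Op K} (hq : F.WF q)
    {w : List (Letter Op K)} (h : StringStep (WordRule F Z (orient F R)) (q.enc F none) w) :
    ∃ q', RewriteModA F (orient F R) q q' := by
  suffices H : ∃ q', RewriteModA F (orient F R) (q.flatten F) q' by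
    obtain ⟨q', h⟩ := H
    exact ⟨q', h.eqA_left hq.eqA_flatten⟩
  have hwf := hq.eqA_flatten.wf.2
  have hrule {l r : Term Op K} (h : (l, r) ∈ orient F R) : RewriteModA F (orient F R) l r :=
    rewriteModA_of_mem h (hR _ _ h.1).left.wf (hR _ _ h.1).right.wf
  generalize henc : q.enc F none = w₀ at h
  obtain ⟨a, b, l, r, h⟩ := h
  cases h with
  | const c d τ h => exact (subterm_of_enc_const henc).exists_rewriteModA hwf (hrule h)
  | app g u d τ hg hu h => exact (subterm_of_enc_bracket hu henc).exists_rewriteModA hwf (hrule h)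
  | string f u v hf hu hv h =>
    have hne : u ≠ [] := by rintro rfl; simp at hu
    obtain ⟨xs, ys, hs⟩ := exists_subterm_of_enc_string hne henc
    obtain ⟨t, ht⟩ :=
      exists_rewriteModA_of_args hf (hR _ _ h.1).left.wf (hrule h) (hs.wf hwf)
    exact hs.exists_rewriteModA hwf ht
  | bracket f c τ hf hc =>
    have hs := (subterm_of_enc_bracket (by simp) henc).wf hwf
    exact absurd ((Signature.arityOK_iff_two_le hf).1 (Signature.wf_ofString.1 hs)) (by simp)

theorem transGen_of_rule (hR : FlatSet F Z R) {l r : Term Op K} (h : (l, r) ∈ orient F R)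
    (τ : Option Op) :
    Relation.TransGen (StringStep (WordRule F Z (orient F R))) (l.enc F τ) (r.enc F τ) := by
  have hflat := hR _ _ h.1
  rcases hflat.fits_or τ with ⟨hl, -⟩ | ⟨f, hf, hτ, u, v, hu, hv, hl, hr⟩
  · exact .single (.of_rule (hflat.left.wordRule h hl))
  dsimp only at hl hr hflat
  subst hl hr
  rcases Term.ofStringBar_cases f hu with ⟨c, -, hbar⟩ | ⟨-, hbar⟩
  · rw [hbar] at h hflat ⊢
    exact .single (.of_rule (hflat.left.wordRule h (fits_const τ c)))
  · have hstep := (StringStep.of_rule (hflat.left.wordRule h (fits_ofStringBar f hu))).context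
      [Letter.opn τ f] [Letter.cls]
    rw [hbar, enc_ofString_assoc hf] at hstep
    rw [hbar, enc_ofString fun h => hτ h.2]
    exact .trans_left (.single hstep) (reflTransGen_bracket hf hτ hv hflat.right)

theorem RewriteModA.transGen (hR : FlatSet F Z R) {p q : Term Op K}
    (h : RewriteModA F (orient F R) p q) :
    Relation.TransGen (StringStep (WordRule F Z (orient F R))) (p.enc F none)
      (q.enc F none) := by
  obtain ⟨s, t, hps, ⟨ρ, hρ, hst⟩, htq⟩ := h
  obtain ⟨τ, a, b, hs, ht⟩ := hst.exists_enc_eq (F := F) none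
  rw [hps.enc_eq, ← htq.enc_eq, hs, ht]
  exact (transGen_of_rule hR hρ τ).lift (fun w => a ++ w ++ b) fun _ _ h => h.context a b

theorem RewriteModA.weight_lt {μ : List (Letter Op K) → ℕ} (hμ : LexWeight (LetterLT Z) μ)
    (hR : FlatSet F Z R) {p q : Term Op K} (h : RewriteModA F (orient F R) p q) :
    μ (q.enc F none) < μ (p.enc F none) := by
  have hdec {x y : List (Letter Op K)} (h : StringStep (WordRule F Z (orient F R)) x y) :
      μ y < μ x := h.weight_lt hμ.context_lt fun _ _ h => h.weight_lt hμ hR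
  have := h.transGen hR
  generalize q.enc F none = w at this
  induction this with
  | single h => exact hdec h
  | tail _ h ih => exact (hdec h).trans ih

theorem IsNormalFormOf.hasNormalForm (hR : FlatSet F Z R) {p q : Term Op K} (hp : F.WF p)
    (h : IsNormalFormOf F (orient F R) p q) :
    HasNormalForm (StringStep (WordRule F Z (orient F R))) (p.enc F none) (q.enc F none) := by
  have hsteps : Relation.ReflTransGen (RewriteModA F (orient F R)) p q := h.1
  refine ⟨?_, fun w hw => ?_⟩
  · exact hsteps.lift' (Term.enc F none) fun _ _ h => (h.transGen hR).to_reflTransGen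
  · obtain ⟨q', hq'⟩ := exists_rewriteModA_of_stringStep hR (wf_of_reflTransGen hp hsteps) hw
    exact h.2 q' hq'

section Persisting

variable {S : ℕ → Set (Eqn Op K)} {μ : List (Letter Op K) → ℕ}

theorem sameNormalForm_iff_eqvGen (hμ : LexWeight (LetterLT Z) μ) (hder : IsDerivation F S)
    (hfair : IsFair F S) (hflat : ∀ i, FlatSet F Z (S i)) {p q : Term Op K} (hp : F.WF p)
    (hq : F.WF q) : SameNormalForm F (orient F (persisting S)) p q ↔
      Relation.EqvGen (StringStep (WordRule F Z (orient F (persisting S)))) (p.enc F none)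
        (q.enc F none) := by
  have hR := persisting_flatSet hflat
  constructor
  · rintro ⟨⟨p', hp'⟩, ⟨q', hq'⟩, heq⟩
    have hpw := (hp'.hasNormalForm hR hp).1
    have hqw := (hq'.hasNormalForm hR hq).1
    rw [← (heq p' q' hp' hq').enc_eq] at hqw
    exact .trans _ _ _ (Relation.EqvGen.reflTransGen_le_eqvGen _ _ _ hpw)
      (.symm _ _ (Relation.EqvGen.reflTransGen_le_eqvGen _ _ _ hqw))
  · intro h
    have hex (t : Term Op K) : ∃ t', IsNormalFormOf F (orient F (persisting S)) t t' :=
      exists_hasNormalForm (μ := fun t => μ (t.enc F none)) (fun _ _ h => h.weight_lt hμ hR) t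
    refine ⟨hex p, hex q, fun p' q' hp' hq' => ?_⟩
    refine eqA_of_enc_eq (wf_of_reflTransGen hp hp'.1) (wf_of_reflTransGen hq hq'.1) ?_
    exact HasNormalForm.eq_of_eqvGen
      (fun _ _ h => h.weight_lt hμ.context_lt fun _ _ h => h.weight_lt hμ hR)
      (fun _ _ _ => linkedBelow_of_peak hμ hder hfair hflat) h (hp'.hasNormalForm hR hp)
      (hq'.hasNormalForm hR hq)

theorem IsDerivation.eqvGen_of_mem (hμ : LexWeight (LetterLT Z) μ) (hder : IsDerivation F S)
    (hflat : ∀ i, FlatSet F Z (S i)) {p q : Term Op K} {i : ℕ} (h : s(p, q) ∈ S i)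
    (τ : Option Op) : Relation.EqvGen (StringStep (WordRule F Z (orient F (persisting S))))
      (p.enc F τ) (q.enc F τ) := by
  have eqvGen_of_fits {τ : Option Op} (hp : Fits F τ p) (hq : Fits F τ q) :
      Relation.EqvGen (StringStep (WordRule F Z (orient F (persisting S)))) (p.enc F τ)
        (q.enc F τ) :=
    (hasProof_mk.1 (hder.hasProof hμ hflat h (by simp [hp, hq]))).eqvGen
  obtain ⟨hpZ, hqZ, -⟩ := hflat i p q h
  rcases (hflat i p q h).fits_or τ with ⟨hp, hq⟩ | ⟨f, hf, hτ, u, v, hu, hv, rfl, rfl⟩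
  · exact eqvGen_of_fits hp hq
  · have hbracket {w : List K} (hw : w ≠ []) (hwZ : FlatTerm F Z (Term.ofStringBar f w)) :=
      Relation.EqvGen.reflTransGen_le_eqvGen _ _ _
        (reflTransGen_bracket (R := orient F (persisting S)) hf hτ hw hwZ)
    have hinner := eqvGen_of_fits (fits_ofStringBar f hu) (fits_ofStringBar f hv)
    exact .trans _ _ _ (.symm _ _ (hbracket hu hpZ))
      (.trans _ _ _ (eqvGen_context _ _ hinner) (hbracket hv hqZ))

theorem sameNormalForm_of_cc (hμ : LexWeight (LetterLT Z) μ) (hder : IsDerivation F S)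
    (hfair : IsFair F S) (hflat : ∀ i, FlatSet F Z (S i)) {p q : Term Op K} (hp : F.WF p)
    (hq : F.WF q) (h : CC F (S 0) p q) :
    SameNormalForm F (orient F (persisting S)) p q :=
  (sameNormalForm_iff_eqvGen hμ hder hfair hflat hp hq).2 <|
    CC.enc (Relation.EqvGen.is_equivalence _) (fun _ _ _ _ => eqvGen_context _ _)
      (fun _ _ h => hder.eqvGen_of_mem hμ hflat h) h none

end Persisting

theorem exists_lexWeight_letterLT (Op : Type) (hZ : Z.Finite) :
    ∃ B, ∃ μ : List (Letter Op K) → ℕ, LexWeight (LetterLT Z) μ ∧ ∀ w, μ w < B ^ w.length := by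
  let rank (c : K) : ℕ := {x ∈ hZ.toFinset | x < c}.card
  let digit : Letter Op K → ℕ
    | .cst _ c => rank c
    | _ => 0
  refine exists_lexWeight (N := hZ.toFinset.card) (d := digit) ?_ ?_
  · intro a
    dsimp only [digit]
    split
    · exact Finset.card_filter_le hZ.toFinset _
    · exact Nat.zero_le _
  · rintro _ _ ⟨τ, c, d, hc, hd, h⟩
    refine Finset.card_lt_card ((Finset.ssubset_iff_of_subset ?_).2 ⟨c, ?_, ?_⟩)
    · exact Finset.monotone_filter_right _ fun x _ hx => hx.trans h
    · simpa using ⟨hc, h⟩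
    · simp

end Correspondence

section Completion

variable {Op C₀ : Type} {F : Signature Op}

theorem Signature.ArityOK.pos {g : Op} {n : ℕ} (h : F.ArityOK g n) : 0 < n := by
  rcases h with ⟨-, h⟩ | ⟨-, rfl⟩
  · exact zero_lt_two.trans_le h
  · exact F.arity_pos g

theorem Signature.WF.nonempty_const {K : Type} {t : Term Op K} (ht : F.WF t) : Nonempty K := by
  induction t using Term.induction with
  | const c => exact ⟨c⟩
  | app g ts ih =>
    obtain ⟨har, hts⟩ := Signature.wf_app_iff.1 ht
    obtain ⟨t, h⟩ := List.exists_mem_of_length_pos (Signature.ArityOK.pos har)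
    exact ih t h (hts t h)

theorem cc_iff_sameNormalForm [LinearOrder C₀] {E : Set (Eqn Op C₀)}
    (hEfin : (constants E).Finite) (hE : ∀ e ∈ E, ∀ t ∈ e, F.WF t)
    {S : ℕ → Set (Eqn Op (Const C₀))} (hS₀ : FlatteningOf F E (S 0)) (hder : IsDerivation F S)
    (hfair : IsFair F S) {s t : Term Op C₀} (hs : F.WF s) (ht : F.WF t) :
    CC F E s t ↔ SameNormalForm F (orient F (persisting S)) (lift s) (lift t) := by
  constructor
  · intro h
    obtain ⟨_, μ, hμ, -⟩ := exists_lexWeight_letterLT Op (hS₀.finite_constants hEfin)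
    have hflat := hder.flatSet (flatSet_constants (hS₀.wf hE) hS₀.2)
    exact sameNormalForm_of_cc hμ hder hfair hflat (hs.map _) (ht.map _) (hS₀.cc hE h)
  · intro h
    rw [← follows_iff_cc hE hs ht]
    intro M hM hME
    have : Nonempty M.carrier := hs.nonempty_const.map M.cst
    obtain ⟨a, ha, haS⟩ := hS₀.hasExtension hE hM hME
    have hpersisting : (M.withCst a).Models (persisting S) := fun p q ⟨i, hi⟩ =>
      hder.models (hM.withCst a) haS i p q (hi i le_rfl)
    have heval := h.eval_eq (hM.withCst a) fun ρ hρ => hpersisting _ _ hρ.1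
    rwa [lift, lift, M.eval_withCst_map ha, M.eval_withCst_map ha] at heval

end Completion

/-! ### Computing normal forms of strings -/

section Rewriting

theorem hasNormalForm_iterate {W : Type} {Q : W → W → Prop} {μ : W → ℕ} {next : W → Option W}
    (hdec : ∀ x y, Q x y → μ y < μ x) (hsome : ∀ x y, next x = some y → Q x y)
    (hnone : ∀ x, next x = none → ∀ y, ¬ Q x y) (n : ℕ) (x : W) (hx : μ x ≤ n) :
    HasNormalForm Q x ((fun x => (next x).getD x)^[n] x) := by
  induction n generalizing x with
  | zero => exact ⟨.refl, fun y hy => absurd (hdec x y hy) (by omega)⟩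
  | succ n ih =>
    rw [Function.iterate_succ_apply]
    cases h : next x with
    | none =>
      rw [Option.getD_none, Function.iterate_fixed (by simp only [h, Option.getD_none])]
      exact ⟨.refl, hnone x h⟩
    | some y =>
      have hy := hdec x y (hsome x y h)
      exact (ih y (by omega)).head (hsome x y h)

variable {α : Type} [DecidableEq α]

/-- Rewriting a prefix of a string by the first rule in the list that applies. -/
def rewritePrefix : List (List α × List α) → List α → Option (List α)
  | [], _ => none
  | ρ :: L, w => if ρ.1 = w.take ρ.1.length then some (ρ.2 ++ w.drop ρ.1.length)
      else rewritePrefix L w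

/-- Rewriting a string at the first position where a rule in the list applies. -/
def rewriteOnce (L : List (List α × List α)) : List α → Option (List α)
  | [] => rewritePrefix L []
  | a :: w => rewritePrefix L (a :: w) <|> (rewriteOnce L w).map (List.cons a)

variable {L : List (List α × List α)}

theorem exists_of_rewritePrefix_eq_some {w w' : List α} (h : rewritePrefix L w = some w') :
    ∃ ρ ∈ L, ∃ b, w = ρ.1 ++ b ∧ w' = ρ.2 ++ b := by
  induction L with
  | nil => simp [rewritePrefix] at h
  | cons ρ L ih =>
    rw [rewritePrefix] at h
    split_ifs at h with hprefix
    · refine ⟨ρ, List.mem_cons_self, w.drop ρ.1.length, ?_, (Option.some.inj h).symm⟩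
      rw [← List.prefix_append_drop (List.prefix_iff_eq_take.2 hprefix)]
    · obtain ⟨ρ', hρ', h⟩ := ih h
      exact ⟨ρ', List.mem_cons_of_mem _ hρ', h⟩

theorem rewritePrefix_append_ne_none {ρ : List α × List α} (hρ : ρ ∈ L) (b : List α) :
    rewritePrefix L (ρ.1 ++ b) ≠ none := by
  induction L with
  | nil => simp at hρ
  | cons ρ' L ih =>
    rw [rewritePrefix]
    split_ifs with hprefix
    · exact Option.some_ne_none _
    · rcases List.mem_cons.1 hρ with rfl | hρ
      · simp at hprefix
      · exact ih hρ

theorem rewriteOnce_ne_none_of_rewritePrefix {w : List α} (h : rewritePrefix L w ≠ none) :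
    rewriteOnce L w ≠ none := by
  cases w with
  | nil => exact h
  | cons a w =>
    obtain ⟨x, hx⟩ := Option.ne_none_iff_exists'.1 h
    simp [rewriteOnce, hx]

theorem stringStep_of_rewriteOnce_eq_some {w w' : List α} (h : rewriteOnce L w = some w') :
    StringStep (fun l r => (l, r) ∈ L) w w' := by
  induction w generalizing w' with
  | nil =>
    obtain ⟨ρ, hρ, b, hw, rfl⟩ := exists_of_rewritePrefix_eq_some h
    exact hw ▸ .intro [] b ρ.1 ρ.2 hρ
  | cons a w ih =>
    rw [rewriteOnce] at h
    rcases (Option.orElse_eq_some _ _ _).1 h with h | ⟨-, h⟩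
    · obtain ⟨ρ, hρ, b, hw, rfl⟩ := exists_of_rewritePrefix_eq_some h
      exact hw ▸ .intro [] b ρ.1 ρ.2 hρ
    · obtain ⟨y, hy, rfl⟩ := Option.map_eq_some_iff.1 h
      simpa using (ih hy).context [a] []

theorem rewriteOnce_ne_none_of_stringStep {w w' : List α}
    (h : StringStep (fun l r => (l, r) ∈ L) w w') : rewriteOnce L w ≠ none := by
  obtain ⟨a, b, l, r, h⟩ := h
  induction a with
  | nil => exact rewriteOnce_ne_none_of_rewritePrefix (rewritePrefix_append_ne_none h b)
  | cons c a ih =>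
    obtain ⟨y, hy⟩ := Option.ne_none_iff_exists'.1 ih
    rw [List.cons_append, List.cons_append, rewriteOnce, hy]
    cases rewritePrefix L (c :: (a ++ l ++ b)) <;> simp

variable [Primcodable α]

theorem primrec_rewritePrefix (L : List (List α × List α)) : Primrec (rewritePrefix L) := by
  induction L with
  | nil => exact Primrec.const none
  | cons ρ L ih =>
    have hprefix : PrimrecPred fun w : List α => ρ.1 = w.take ρ.1.length :=
      Primrec.eq.comp (Primrec.const _) (Primrec.list_take.comp (Primrec.const _) .id)
    have hreplace : Primrec fun w : List α => some (ρ.2 ++ w.drop ρ.1.length) :=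
      Primrec.option_some.comp (Primrec.list_append.comp (Primrec.const _)
        (Primrec.list_drop.comp (Primrec.const _) .id))
    exact (Primrec.ite hprefix hreplace ih).of_eq fun w => by rw [rewritePrefix]

theorem primrec_rewriteOnce (L : List (List α × List α)) : Primrec (rewriteOnce L) := by
  have hhead : Primrec fun p : List α × α × List α × Option (List α) =>
      rewritePrefix L (p.2.1 :: p.2.2.1) :=
    (primrec_rewritePrefix L).comp (Primrec.list_cons.comp (Primrec.fst.comp Primrec.snd)
      (Primrec.fst.comp (Primrec.snd.comp Primrec.snd)))
  have htail : Primrec fun p : List α × α × List α × Option (List α) =>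
      p.2.2.2.map (List.cons p.2.1) :=
    Primrec.option_map (Primrec.snd.comp (Primrec.snd.comp Primrec.snd))
      (Primrec.list_cons.comp (Primrec.fst.comp (Primrec.snd.comp Primrec.fst)) Primrec.snd).to₂
  have hcons : Primrec₂ fun (_ : List α) (p : α × List α × Option (List α)) =>
      rewritePrefix L (p.1 :: p.2.1) <|> p.2.2.map (List.cons p.1) :=
    Primrec.option_orElse.comp hhead htail
  refine (Primrec.list_rec .id (Primrec.const (rewritePrefix L [])) hcons).of_eq fun w => ?_
  induction w with
  | nil => rfl
  | cons a w ih =>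
    rw [rewriteOnce, ← ih]
    rfl

end Rewriting

theorem exists_primrec_hasNormalForm {α : Type} [Primcodable α] {R : List α → List α → Prop}
    (hR : {ρ : List α × List α | R ρ.1 ρ.2}.Finite) {μ : List α → ℕ} {B : ℕ}
    (hdec : ∀ x y, StringStep R x y → μ y < μ x) (hB : ∀ w, μ w < B ^ w.length) :
    ∃ normalize : List α → List α, Primrec normalize ∧
      ∀ w, HasNormalForm (StringStep R) w (normalize w) := by
  classical
  obtain ⟨L, rfl⟩ : ∃ L : List (List α × List α), R = fun l r => (l, r) ∈ L :=
    ⟨hR.toFinset.toList, by ext l r; simp⟩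
  refine ⟨fun w => (fun w => (rewriteOnce L w).getD w)^[B ^ w.length] w, ?_, fun w => ?_⟩
  · refine Primrec.nat_iterate ?_ .id ?_
    · exact (Primrec₂.unpaired'.1 Nat.Primrec.pow).comp (Primrec.const B) Primrec.list_length
    · exact (Primrec.option_getD.comp ((primrec_rewriteOnce L).comp Primrec.snd) Primrec.snd).to₂
  · exact hasNormalForm_iterate hdec (fun _ _ => stringStep_of_rewriteOnce_eq_some)
      (fun _ h _ hstep => rewriteOnce_ne_none_of_stringStep hstep h) _ w (hB w).le

/-! ### Computing the word of a term -/

section Reading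

variable {Op C K : Type} (F : Signature Op) (ι : C → K)

open Classical in
/-- The letters that open a term headed by `g` as an argument of `τ`. -/
noncomputable def openLetters (τ : Option Op) (g : Op) : List (Letter Op K) :=
  if g ∈ F.assoc ∧ τ = some g then [] else [Letter.opn τ g]

open Classical in
/-- The letters that close a term headed by `σ` as an argument of `τ`. -/
noncomputable def closeLetters (σ τ : Option Op) : List (Letter Op K) :=
  if ∃ f ∈ F.assoc, σ = some f ∧ τ = some f then [] else [Letter.cls]

/-- Reading one letter of a term in prefix notation.  The state consists of the stack of the
symbols that are open and of the part of the encoding written so far. -/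
noncomputable def readLetter (s : List Op × List (Letter Op K)) :
    Op ⊕ C ⊕ Unit → List Op × List (Letter Op K)
  | Sum.inl g => (g :: s.1, s.2 ++ openLetters F s.1.head? g)
  | Sum.inr (Sum.inl c) => (s.1, s.2 ++ [Letter.cst s.1.head? (ι c)])
  | Sum.inr (Sum.inr ()) => (s.1.tail, s.2 ++ closeLetters F s.1.head? s.1.tail.head?)

/-- The encoding of a term modulo associativity, computed from its prefix notation. -/
noncomputable def readWord (w : List (Op ⊕ C ⊕ Unit)) : List (Letter Op K) :=
  (w.foldl (readLetter F ι) ([], [])).2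

variable {F} in
theorem Term.enc_app_eq_append (g : Op) (τ : Option Op) (ts : List (Term Op K)) :
    (Term.app g ts).enc F τ =
      openLetters F τ g ++ ts.flatMap (Term.enc F (some g)) ++ closeLetters F (some g) τ := by
  by_cases h : g ∈ F.assoc ∧ τ = some g
  · obtain ⟨hg, rfl⟩ := h
    simp [Term.enc_app_self hg, openLetters, closeLetters, hg]
  · have h' : ¬ ∃ f ∈ F.assoc, some g = some f ∧ τ = some f := by
      rintro ⟨f, hf, hgf, hτ⟩
      obtain rfl := Option.some.inj hgf
      exact h ⟨hf, hτ⟩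
    simp [Term.enc_app h, openLetters, closeLetters, if_neg h, if_neg h']

theorem foldl_readLetter (t : Term Op C) (stack : List Op) (out : List (Letter Op K)) :
    t.word.foldl (readLetter F ι) (stack, out) =
      (stack, out ++ (t.map ι).enc F stack.head?) := by
  induction t using Term.induction generalizing stack out with
  | const c => simp [Term.word, Term.map, Term.enc_const, readLetter]
  | app g ts ih =>
    have hargs (out : List (Letter Op K)) :
        (ts.flatMap Term.word).foldl (readLetter F ι) (g :: stack, out) =
          (g :: stack, out ++ (ts.map (Term.map ι)).flatMap (Term.enc F (some g))) := by
      induction ts generalizing out with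
      | nil => simp
      | cons t ts ih' =>
        rw [List.flatMap_cons, List.foldl_append, ih t List.mem_cons_self,
          ih' fun t ht => ih t (List.mem_cons_of_mem _ ht)]
        simp
    rw [Term.word, Term.wordArgs_eq_flatMap, Term.map, Term.mapArgs_eq_map, List.foldl_cons,
      List.foldl_append, Term.enc_app_eq_append]
    simp [readLetter, hargs]

theorem readWord_word (t : Term Op C) : readWord F ι t.word = (t.map ι).enc F none := by
  simp [readWord, foldl_readLetter]

variable [Primcodable Op] [Primcodable K]

variable {ι} in
theorem primrec_readLetter_const [Primcodable C] (hι : Primrec ι) :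
    Primrec₂ fun s c => readLetter F ι s (Sum.inr (Sum.inl c)) :=
  Primrec.pair (Primrec.fst.comp .fst) <| Primrec.list_append.comp (Primrec.snd.comp .fst) <|
    Primrec.list_cons.comp (Primrec.option_some.comp <|
      .pair (Primrec.list_head?.comp (Primrec.fst.comp .fst))
        (Primrec.sumInl.comp (hι.comp .snd))) (.const [])

variable [Finite Op]

theorem primrec_readLetter_open : Primrec₂ fun s g => readLetter F ι s (Sum.inl g) :=
  Primrec.pair (Primrec.list_cons.comp .snd (Primrec.fst.comp .fst)) <|
    Primrec.list_append.comp (Primrec.snd.comp .fst) <|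
      (Primrec.dom_finite fun p : Option Op × Op => openLetters F p.1 p.2).comp
        (.pair (Primrec.list_head?.comp (Primrec.fst.comp .fst)) .snd)

theorem primrec_readLetter_close :
    Primrec₂ fun s (_ : Unit) => readLetter F ι s (Sum.inr (Sum.inr ())) := by
  have hstack : Primrec fun p : (List Op × List (Letter Op K)) × Unit => p.1.1 :=
    Primrec.fst.comp .fst
  have htail := Primrec.list_tail.comp hstack
  exact Primrec.pair htail <| Primrec.list_append.comp (Primrec.snd.comp .fst) <|
    (Primrec.dom_finite fun p : Option Op × Option Op => closeLetters F p.1 p.2).comp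
      (.pair (Primrec.list_head?.comp hstack) (Primrec.list_head?.comp htail))

variable [Primcodable C] {ι}

theorem primrec_readLetter (hι : Primrec ι) : Primrec₂ (readLetter F ι) := by
  have hstate : Primrec fun p : (List Op × List (Letter Op K)) × (Op ⊕ C ⊕ Unit) => p.1 := .fst
  have hinr : Primrec₂ fun (p : (List Op × List (Letter Op K)) × (Op ⊕ C ⊕ Unit))
      (b : C ⊕ Unit) => readLetter F ι p.1 (Sum.inr b) :=
    (Primrec.sumCasesOn .snd
      ((primrec_readLetter_const F hι).comp (hstate.comp (.comp .fst .fst)) .snd).to₂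
      ((primrec_readLetter_close F ι).comp (hstate.comp (.comp .fst .fst)) .snd).to₂).of_eq
      fun ⟨_, b⟩ => by rcases b with _ | _ <;> rfl
  exact (Primrec.sumCasesOn .snd
    ((primrec_readLetter_open F ι).comp (hstate.comp .fst) .snd).to₂ hinr).of_eq
    fun ⟨_, a⟩ => by rcases a with _ | _ <;> rfl

theorem primrec_readWord (hι : Primrec ι) : Primrec (readWord F ι) :=
  Primrec.snd.comp <| Primrec.list_foldl .id (.const ([], []))
    ((primrec_readLetter F hι).comp (Primrec.fst.comp .snd) (Primrec.snd.comp .snd)).to₂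

end Reading

section Decision

variable {Op K : Type} {F : Signature Op} {Z : Set K}

theorem finite_wordRule [Finite Op] (hZ : Z.Finite) {R : Set (Term Op K × Term Op K)}
    (hR : R.Finite) : {ρ : List (Letter Op K) × List (Letter Op K) |
      WordRule F Z R ρ.1 ρ.2}.Finite := by
  let encode (p : (Term Op K × Term Op K) × Option Op) :
      List (Letter Op K) × List (Letter Op K) := (p.1.1.enc F p.2, p.1.2.enc F p.2)
  let bracket (p : (Op × K) × Option Op) : List (Letter Op K) × List (Letter Op K) :=
    (Letter.opn p.2 p.1.1 :: ([p.1.2].map (Letter.cst (some p.1.1)) ++ [Letter.cls]),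
      [Letter.cst p.2 p.1.2])
  have hencode := (hR.prod (Set.finite_univ (α := Option Op))).image encode
  have hbracket := (((Set.finite_univ (α := Op)).prod hZ).prod
    (Set.finite_univ (α := Option Op))).image bracket
  refine (hencode.union hbracket).subset ?_
  rintro ⟨_, _⟩ (⟨c, d, τ, h⟩ | ⟨g, u, d, τ, hg, hu, h⟩ | ⟨f, u, v, hf, hu, hv, h⟩ |
    ⟨f, c, τ, hf, hc⟩)
  · exact .inl ⟨(_, τ), ⟨h, trivial⟩, by simp only [encode, Term.enc_const]⟩
  · refine .inl ⟨(_, τ), ⟨h, trivial⟩, ?_⟩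
    simp only [encode, Term.enc_const, enc_ofString fun h => hg h.1]
  · refine .inl ⟨(_, some f), ⟨h, trivial⟩, ?_⟩
    simp only [encode, enc_ofString_assoc hf, enc_ofStringBar hf hv]
  · exact .inr ⟨((f, c), τ), ⟨⟨trivial, hc⟩, trivial⟩, rfl⟩

theorem finite_orient [LinearOrder K] {S : Set (Eqn Op K)} (hS : S.Finite) :
    (orient F S).Finite := by
  have hfiber (e : Eqn Op K) : {ρ : Term Op K × Term Op K | s(ρ.1, ρ.2) = e}.Finite := by
    induction e using Sym2.ind with
    | _ a b =>
      refine (Set.toFinite {(a, b), (b, a)}).subset ?_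
      rintro ⟨x, y⟩ hxy
      rcases Sym2.eq_iff.1 hxy with ⟨rfl, rfl⟩ | ⟨rfl, rfl⟩ <;> simp
  exact (hS.biUnion fun e _ => hfiber e).subset fun ρ hρ => Set.mem_biUnion hρ.1 rfl

theorem decidable_sameNormalForm [Finite Op] [LinearOrder K] {S : ℕ → Set (Eqn Op K)}
    (hZ : Z.Finite) (hder : IsDerivation F S) (hfair : IsFair F S)
    (hflat : ∀ i, FlatSet F Z (S i)) (hfin : (persisting S).Finite) {C : Type} [Primcodable Op]
    [Primcodable C] [Primcodable K] {ι : C → K} (hι : Primrec ι) :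
    DecidableOnTerms F fun s t : Term Op C =>
      SameNormalForm F (orient F (persisting S)) (s.map ι) (t.map ι) := by
  obtain ⟨B, μ, hμ, hB⟩ := exists_lexWeight_letterLT Op hZ
  have hdec (x y) (h : StringStep (WordRule F Z (orient F (persisting S))) x y) : μ y < μ x :=
    h.weight_lt hμ.context_lt fun _ _ h => h.weight_lt hμ (persisting_flatSet hflat)
  obtain ⟨normalize, hprimrec, hnormalize⟩ :=
    exists_primrec_hasNormalForm (finite_wordRule hZ (finite_orient hfin)) hdec hB
  have hcode := hprimrec.comp (primrec_readWord F hι)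
  refine ⟨fun p => normalize (readWord F ι p.1) = normalize (readWord F ι p.2),
    (Primrec.eq.comp (hcode.comp .fst) (hcode.comp .snd)).computablePred, fun s t hs ht => ?_⟩
  beta_reduce
  rw [sameNormalForm_iff_eqvGen hμ hder hfair hflat (hs.map ι) (ht.map ι), readWord_word,
    readWord_word]
  have hs' := hnormalize ((s.map ι).enc F none)
  have ht' := hnormalize ((t.map ι).enc F none)
  constructor
  · intro h
    rw [← h] at ht'
    have toEqvGen := Relation.EqvGen.reflTransGen_le_eqvGen
      (StringStep (WordRule F Z (orient F (persisting S))))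
    exact .trans _ _ _ (toEqvGen _ _ hs'.1) (.symm _ _ (toEqvGen _ _ ht'.1))
  · intro h
    exact HasNormalForm.eq_of_eqvGen hdec
      (fun _ _ _ => linkedBelow_of_peak hμ hder hfair hflat) h hs' ht'

end Decision

theorem lemma4p2_general {Op C₀ : Type} [Finite Op] [LinearOrder C₀] [Primcodable Op]
    [Primcodable C₀] (F : Signature Op) (E : Set (Eqn Op C₀)) (hEfin : (constants E).Finite)
    (hE : ∀ e ∈ E, ∀ t ∈ e, F.WF t) (S : ℕ → Set (Eqn Op (Const C₀)))
    (hS₀ : FlatteningOf F E (S 0)) (hder : IsDerivation F S) (hfair : IsFair F S) :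
    (∀ s₀ t₀ : Term Op C₀, F.WF s₀ → F.WF t₀ →
      (CC F E s₀ t₀ ↔
        SameNormalForm F (orient F (persisting S)) (lift s₀) (lift t₀))) ∧
    ((persisting S).Finite → DecidableOnTerms F (Follows F E)) := by
  have hcc (s t : Term Op C₀) (hs : F.WF s) (ht : F.WF t) :=
    cc_iff_sameNormalForm hEfin hE hS₀ hder hfair hs ht
  refine ⟨hcc, fun hfin => ?_⟩
  let e : Const C₀ ≃ C₀ ⊕ ℕ := ofLex.trans (Equiv.sumCongr (.refl C₀) OrderDual.ofDual)
  let : Primcodable (Const C₀) := .ofEquiv (C₀ ⊕ ℕ) e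
  have hinl : Primrec (Sum.inlₗ : C₀ → Const C₀) := (Primrec.of_equiv_iff e).1 .sumInl
  obtain ⟨P, hP, h⟩ := decidable_sameNormalForm (hS₀.finite_constants hEfin) hder hfair
    (hder.flatSet (flatSet_constants (hS₀.wf hE) hS₀.2)) hfin hinl
  refine ⟨P, hP, fun s t hs ht => ?_⟩
  rw [h s t hs ht, follows_iff_cc hE hs ht, hcc s t hs ht]
  rfl

theorem lemma4p2 {Op C₀ : Type} [Finite Op] [Finite C₀] [LinearOrder C₀]
    [Primcodable Op] [Primcodable C₀] (F : Signature Op)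
    (E : Set (Eqn Op C₀)) (hEfin : E.Finite) (hE : ∀ e ∈ E, ∀ t ∈ e, F.WF t)
    (S : ℕ → Set (Eqn Op (Const C₀))) (hS₀ : FlatteningOf F E (S 0))
    (hder : IsDerivation F S) (hfair : IsFair F S) :
    (∀ s₀ t₀ : Term Op C₀, F.WF s₀ → F.WF t₀ →
      (CC F E s₀ t₀ ↔
        SameNormalForm F (orient F (persisting S)) (lift s₀) (lift t₀))) ∧
    ((persisting S).Finite → DecidableOnTerms F (Follows F E)) :=
  lemma4p2_general F E (Set.toFinite _) hE S hS₀ hder hfair
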